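/- Let $k$ be a field, $R=k[x,y,z]$, and let $a,b$ be integers with $b\ge 1$ and $a>2b$. Let $I=(x^a,y^a,z^a,(xyz)^b)\subset R$, let $\mathcal R(I)=R[IT]\subset R[T]$ be its Rees algebra, let $S=R[t,u,v,w]$, and let $\mathcal I\subset S$ be the Rees ideal, i.e. the kernel of the surjection of $R$-algebras $S\to\mathcal R(I)$, $t\mapsto x^aT$, $u\mapsto y^aT$, $v\mapsto z^aT$, $w\mapsto (xyz)^bT$. Give $S$ the bigrading in which $x,y,z$ have bidegree $(1,0)$, $t,u,v$ have bidegree $(a,1)$ and $w$ has bidegree $(3b,1)$; bihomogeneous elements of $S$ are called biforms. If $\alpha,\beta\in R$ are nonzero forms and $f,g\in S$ are biforms with $f=c_1\alpha+c_2\beta$, $g=d_1\alpha+d_2\beta$ for biforms $c_i,d_i\in S$, then $c_1d_2-c_2d_1$ is called a Sylvester form of $f,g$ with respect to $(\alpha,\beta)$. (a) The six syzygies whose associated linear forms are $$f_1=x^au-y^at,\quad f_2=x^av-z^at,\quad f_3=y^av-z^au,$$ $$g_1=x^{a-b}w-(yz)^bt,\quad g_2=y^{a-b}w-(xz)^bu,\quad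 g_3=z^{a-b}w-(xy)^bv$$ generate the syzygy module of $(x^a,y^a,z^a,(xyz)^b)$; put $L=\{f_1,f_2,f_3,g_1,g_2,g_3\}$. The forms $$H_1=(xy)^{a-2b}w^2-z^{2b}tu,\quad H_2=(xz)^{a-2b}w^2-y^{2b}tv,\quad H_3=(yz)^{a-2b}w^2-x^{2b}uv$$ are Sylvester forms of $g_1,g_2$ with respect to $(x^b,y^b)$, of $g_1,g_3$ with respect to $(x^b,z^b)$, and of $g_2,g_3$ with respect to $(y^b,z^b)$, respectively. If $a\le 3b$, then $E=w^3-(xyz)^{3b-a}tuv$ is a Sylvester form of $g_1,H_3$ with respect to $(x^{a-b},(yz)^{a-2b})$, and $\mathcal I=(L,H_1,H_2,H_3,E)$. If $a>3b$, then $E'=(xyz)^{a-3b}w^3-tuv$ is a Sylvester form of $g_1,H_3$ with respect to $(x^{2b},(yz)^{b})$, and $\mathcal I=(L,H_1,H_2,H_3,E')$. (b) $\mathcal R(I)$ is almost Cohen--Macaulay, meaning that its depth on the maximal graded ideal $(x,y,z,\mathcal R(I)_+)$ (the supremum of the lengths of regular sequences contained in that ideal) is at least $3$. Moreover $\mathcal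 R(I)\cong S/\mathcal I$ has projective dimension at most $4$ as an $S$-module. -/

import Mathlib

open MvPolynomial

noncomputable section

namespace ReesSylvester

/-! ### Rees algebra and its presentation ideal -/

section Presentation

variable {R : Type*} [CommRing R] {ι : Type*}

/-- The presentation `R[t_i : i ∈ ι] → R[IT]`, `t_i ↦ f_i T`, of the Rees algebra of the ideal `I`
generated by the family `f`. -/
def reesPresentation (f : ι → R) :
    MvPolynomial ι R →ₐ[R] reesAlgebra (Ideal.span (Set.range f)) :=
  aeval fun i => ⟨Polynomial.monomial 1 (f i),
    reesAlgebra.monomial_mem.mpr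
      (by rw [pow_one]; exact Ideal.subset_span (Set.mem_range_self i))⟩

/-- The Rees ideal: the kernel of the presentation of the Rees algebra. -/
def reesIdeal (f : ι → R) : Ideal (MvPolynomial ι R) :=
  RingHom.ker (reesPresentation f)

/-- The module of syzygies of a finite family. -/
def syzygyModule [Fintype ι] (f : ι → R) : Submodule R (ι → R) :=
  LinearMap.ker (Fintype.linearCombination R f)

/-- The linear form `∑ c_i t_i` attached to a coefficient vector `c`. -/
def linearForm [Fintype ι] (c : ι → R) : MvPolynomial ι R :=
  ∑ i, C (c i) * X i

end Presentation

/-! ### Sylvester forms -/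

section Sylvester

variable {k : Type*} [Field k] {σ ι : Type*}

/-- `F ∈ k[x][t]` is a biform, for the bigrading in which each `x_j` has bidegree `(1, 0)` and
`t_i` has bidegree `(d_i, 1)`. Here `d_i` is the degree of the `i`-th generator of the ideal, so
that `t_i ↦ f_i T` is bihomogeneous. -/
def IsBiform (d : ι → ℕ) (F : MvPolynomial ι (MvPolynomial σ k)) : Prop :=
  ∃ p q : ℕ, ∀ (m : ι →₀ ℕ) (n : σ →₀ ℕ), (F.coeff m).coeff n ≠ 0 →
    n.degree + (m.sum fun i e => e * d i) = p ∧ m.degree = q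

/-- `h` is a Sylvester form `det(f, g)_(α, β)` of the biforms `f, g` with respect to the nonzero
forms `α, β`: the determinant of a content matrix, with biform entries, that expresses `f, g` in
terms of `α, β`. -/
def IsSylvesterForm (d : ι → ℕ) (α β : MvPolynomial σ k)
    (f g h : MvPolynomial ι (MvPolynomial σ k)) : Prop :=
  (α ≠ 0 ∧ ∃ p, α.IsHomogeneous p) ∧ (β ≠ 0 ∧ ∃ p, β.IsHomogeneous p) ∧
  IsBiform d f ∧ IsBiform d g ∧
  ∃ c₁ c₂ d₁ d₂ : MvPolynomial ι (MvPolynomial σ k),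
    IsBiform d c₁ ∧ IsBiform d c₂ ∧ IsBiform d d₁ ∧ IsBiform d d₂ ∧
    f = c₁ * C α + c₂ * C β ∧ g = d₁ * C α + d₂ * C β ∧
    h = Matrix.det !![c₁, c₂; d₁, d₂]

end Sylvester

/-! ### Depth and almost Cohen–Macaulay Rees algebras -/

/-- The depth of the ring `A` on the ideal `J`: the supremum of the lengths of the `A`-regular
sequences contained in `J`. -/
def depthOn {A : Type*} [CommRing A] (J : Ideal A) : ℕ∞ :=
  ⨆ (rs : List A) (_ : (∀ r ∈ rs, r ∈ J) ∧ RingTheory.Sequence.IsRegular A rs),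
    (rs.length : ℕ∞)

/-- The ideal `R(I)_+` of elements of positive degree of the Rees algebra. -/
def reesIrrelevant {R : Type*} [CommRing R] (I : Ideal R) : Ideal (reesAlgebra I) :=
  RingHom.ker ((Polynomial.constantCoeff (R := R)).comp (reesAlgebra I).val.toRingHom)

/-- The maximal graded ideal `(𝔪, R(I)_+)` of the Rees algebra of an ideal of
`k[x_1, …, x_n]`, where `𝔪 = (x_1, …, x_n)`. -/
def reesMaxIdeal {k : Type*} [Field k] {n : ℕ} (I : Ideal (MvPolynomial (Fin n) k)) :
    Ideal (reesAlgebra I) :=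
  (Ideal.span (Set.range (X : Fin n → MvPolynomial (Fin n) k))).map
    (algebraMap (MvPolynomial (Fin n) k) (reesAlgebra I)) ⊔ reesIrrelevant I

/-- The Rees algebra of an ideal of `k[x_1, …, x_n]` (a ring of dimension `n + 1` when the ideal is
nonzero) is almost Cohen–Macaulay if its depth on the maximal graded ideal is at least `n`. -/
def IsAlmostCohenMacaulayRees {k : Type*} [Field k] {n : ℕ}
    (I : Ideal (MvPolynomial (Fin n) k)) : Prop :=
  (n : ℕ∞) ≤ depthOn (reesMaxIdeal I)

/-! ### The ideal `(x^a, y^a, z^a, (xyz)^b)` -/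

section Forms

variable (k : Type*) [Field k]

/-- `R = k[x, y, z]`. -/
abbrev R : Type _ := MvPolynomial (Fin 3) k

/-- `S = R[t, u, v, w]`. -/
abbrev S : Type _ := MvPolynomial (Fin 4) (R k)

abbrev x : R k := X 0
abbrev y : R k := X 1
abbrev z : R k := X 2
abbrev t : S k := X 0
abbrev u : S k := X 1
abbrev v : S k := X 2
abbrev w : S k := X 3

variable (a b : ℕ)

/-- The generators `x^a, y^a, z^a, (xyz)^b`. -/
def gens : Fin 4 → R k := ![x k ^ a, y k ^ a, z k ^ a, (x k * y k * z k) ^ b]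

/-- The degrees `a, a, a, 3b` of the generators. -/
def genDegrees : Fin 4 → ℕ := ![a, a, a, 3 * b]

/-- The six syzygies of the generators, as the columns of a `4 × 6` matrix. -/
def syzygyColumns : Set (Fin 4 → R k) :=
  {![-y k ^ a, x k ^ a, 0, 0],
   ![-z k ^ a, 0, x k ^ a, 0],
   ![0, -z k ^ a, y k ^ a, 0],
   ![-(y k * z k) ^ b, 0, 0, x k ^ (a - b)],
   ![0, -(x k * z k) ^ b, 0, y k ^ (a - b)],
   ![0, 0, -(x k * y k) ^ b, z k ^ (a - b)]}

def f₁ : S k := C (x k ^ a) * u k - C (y k ^ a) * t k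
def f₂ : S k := C (x k ^ a) * v k - C (z k ^ a) * t k
def f₃ : S k := C (y k ^ a) * v k - C (z k ^ a) * u k
def g₁ : S k := C (x k ^ (a - b)) * w k - C ((y k * z k) ^ b) * t k
def g₂ : S k := C (y k ^ (a - b)) * w k - C ((x k * z k) ^ b) * u k
def g₃ : S k := C (z k ^ (a - b)) * w k - C ((x k * y k) ^ b) * v k

/-- The six syzygy forms. -/
def L : Set (S k) := {f₁ k a, f₂ k a, f₃ k a, g₁ k a b, g₂ k a b, g₃ k a b}

def H₁ : S k :=
  C ((x k * y k) ^ (a - 2 * b)) * w k ^ 2 - C (z k ^ (2 * b)) * t k * u k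
def H₂ : S k :=
  C ((x k * z k) ^ (a - 2 * b)) * w k ^ 2 - C (y k ^ (2 * b)) * t k * v k
def H₃ : S k :=
  C ((y k * z k) ^ (a - 2 * b)) * w k ^ 2 - C (x k ^ (2 * b)) * u k * v k

/-- The last form when `a ≤ 3b`. -/
def E : S k :=
  w k ^ 3 - C ((x k * y k * z k) ^ (3 * b - a)) * t k * u k * v k

/-- The last form when `a > 3b`. -/
def E' : S k :=
  C ((x k * y k * z k) ^ (a - 3 * b)) * w k ^ 3 - t k * u k * v k

end Forms

end ReesSylvester

end

/-
The Rees ideal is toric, so it is generated by differences of monomials with the same image in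
`R[T]`. The ten relations rewrite any two such monomials of positive degree in `T` until they have
a common factor of positive degree, and induction on this degree shows that they generate.

For the homological part, choose coordinates of `S` in which the last generator is a monic cubic in
one variable `X` over `P = R[X 0, X 1, X 2]`: it is `X = w` for `E`, whereas for `E'` one takes
`X = t` and `X 0 = u - t`, `X 1 = w`, `X 2 = v - t`. Then `R[IT]` is generated as a `P`-module by
`1, X, X²`, and the successive quotients are `P / J`, with `J` the ideal of maximal minors of a
`2 × 3` matrix, and `P / K P` for two ideals `K` of `R`. Since `R` has global dimension `3`, all
three have projective dimension at most `3` over `P`, and so has `R[IT]`; over `S = P[X]` the bound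
increases by at most one. Moreover, `X 0, X 1 - j 0, X 2 - j 1` is a regular sequence on each of the
three, hence on `R[IT]`, where `X i ↦ j i T`; its terms lie in the maximal graded ideal.
-/

namespace ReesSylvester

/-! ### Projective dimension and Hilbert's syzygy theorem -/

section ProjectiveDimension

open CategoryTheory TensorProduct
open scoped Polynomial

universe q

/-- The module `M` over `A` has projective dimension at most `n`: Mathlib's notion for objects of
`ModuleCat`, applied to unbundled modules. -/
abbrev ProjDimLE (A : Type q) [CommRing A] (M : Type q) [AddCommGroup M] [Module A M] (n : ℕ) :
    Prop :=
  HasProjectiveDimensionLE (ModuleCat.of A M) n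

section Basic

variable {A : Type q} [CommRing A] {M M₁ M₂ M₃ : Type q}
  [AddCommGroup M] [Module A M] [AddCommGroup M₁] [Module A M₁]
  [AddCommGroup M₂] [Module A M₂] [AddCommGroup M₃] [Module A M₃]
  {m n : ℕ} {f : M₁ →ₗ[A] M₂} {g : M₂ →ₗ[A] M₃}

lemma ProjDimLE.mono (h : ProjDimLE A M m) (hmn : m ≤ n) : ProjDimLE A M n :=
  hasProjectiveDimensionLT_of_ge _ (m + 1) (n + 1) (by omega)

lemma projDimLE_zero_iff : ProjDimLE A M 0 ↔ Module.Projective A M := by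
  rw [ProjDimLE, ← projective_iff_hasProjectiveDimensionLE_zero, ← IsProjective.iff_projective]

lemma projDimLE_of_projective [Module.Projective A M] (n : ℕ) : ProjDimLE A M n :=
  (projDimLE_zero_iff.mpr ‹_›).mono n.zero_le

lemma ProjDimLE.of_linearEquiv (h : ProjDimLE A M₁ n) (e : M₁ ≃ₗ[A] M₂) : ProjDimLE A M₂ n :=
  hasProjectiveDimensionLT_of_iso e.toModuleIso _

lemma ProjDimLE.middle (hf : Function.Injective f) (hg : Function.Surjective g)
    (hfg : Function.Exact f g) (h₁ : ProjDimLE A M₁ n) (h₃ : ProjDimLE A M₃ n) :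
    ProjDimLE A M₂ n :=
  (ModuleCat.shortComplex_shortExact (ModuleCat.shortComplexOfCompEqZero f g
    hfg.linearMap_comp_eq_zero) hfg hf hg).hasProjectiveDimensionLT_X₂ _ h₁ h₃

lemma ProjDimLE.right (hf : Function.Injective f) (hg : Function.Surjective g)
    (hfg : Function.Exact f g) (h₁ : ProjDimLE A M₁ n) (h₂ : ProjDimLE A M₂ (n + 1)) :
    ProjDimLE A M₃ (n + 1) :=
  (ModuleCat.shortComplex_shortExact (ModuleCat.shortComplexOfCompEqZero f g
    hfg.linearMap_comp_eq_zero) hfg hf hg).hasProjectiveDimensionLT_X₃ _ h₁ h₂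

lemma ProjDimLE.left (hf : Function.Injective f) (hg : Function.Surjective g)
    (hfg : Function.Exact f g) (h₂ : ProjDimLE A M₂ n) (h₃ : ProjDimLE A M₃ (n + 1)) :
    ProjDimLE A M₁ n :=
  (ModuleCat.shortComplex_shortExact (ModuleCat.shortComplexOfCompEqZero f g
    hfg.linearMap_comp_eq_zero) hfg hf hg).hasProjectiveDimensionLT_X₁ _ h₂ h₃

end Basic

section RingEquiv

variable {A B : Type q} [CommRing A] [CommRing B] {n : ℕ}

attribute [local instance] RingHomInvPair.of_ringEquiv

lemma ProjDimLE.of_semilinearEquiv {M N : Type q} [AddCommGroup M] [Module A M] [AddCommGroup N]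
    [Module B N] (h : ProjDimLE A M n) (e : A ≃+* B)
    (e' : M ≃ₛₗ[RingHomClass.toRingHom e] N) : ProjDimLE B N n :=
  ModuleCat.hasProjectiveDimensionLE_of_semiLinearEquiv (M := ModuleCat.of A M)
    (N := ModuleCat.of B N) e e' n

lemma ProjDimLE.quotient_of_ringEquiv {I : Ideal A} {K : Ideal B} (h : ProjDimLE A (A ⧸ I) n)
    (e : A ≃+* B) (hIK : K = I.map (e : A →+* B)) : ProjDimLE B (B ⧸ K) n :=
  h.of_semilinearEquiv e
    { Ideal.quotientEquiv I K e hIK with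
      map_smul' := fun r m => by
        obtain ⟨m, rfl⟩ := Ideal.Quotient.mk_surjective m
        have hsmul : r • Ideal.Quotient.mk I m = Ideal.Quotient.mk I (r * m) := rfl
        simp [hsmul, Algebra.smul_def] }

lemma projDimLE_of_ringEquiv (e : A ≃+* B)
    (h : ∀ (M : Type q) [AddCommGroup M] [Module A M], ProjDimLE A M n)
    (N : Type q) [AddCommGroup N] [Module B N] : ProjDimLE B N n := by
  let _ : Module A N := Module.compHom N (e : A →+* B)
  exact (h N).of_semilinearEquiv e { AddEquiv.refl N with map_smul' := fun r m => rfl }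

end RingEquiv

lemma ProjDimLE.baseChange_of_ker {A B F M : Type q} [CommRing A] [CommRing B] [Algebra A B]
    [Module.Flat A B] [AddCommGroup F] [Module A F] [Module.Projective A F] [AddCommGroup M]
    [Module A M] {g : F →ₗ[A] M} (hg : Function.Surjective g) {n : ℕ}
    (h : ProjDimLE B (B ⊗[A] LinearMap.ker g) n) : ProjDimLE B (B ⊗[A] M) (n + 1) :=
  .right (f := (LinearMap.ker g).subtype.baseChange B) (g := g.baseChange B)
    (Module.Flat.lTensor_preserves_injective_linearMap _ (Submodule.injective_subtype _))
    (LinearMap.lTensor_surjective B hg) (lTensor_exact B (LinearMap.exact_subtype_ker_map g) hg)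
    h (projDimLE_of_projective _)

lemma ProjDimLE.baseChange {A : Type q} [CommRing A] (B : Type q) [CommRing B] [Algebra A B]
    [Module.Flat A B] {n : ℕ} {M : Type q} [AddCommGroup M] [Module A M] (h : ProjDimLE A M n) :
    ProjDimLE B (B ⊗[A] M) n := by
  induction n generalizing M with
  | zero =>
    rw [projDimLE_zero_iff] at h ⊢
    infer_instance
  | succ n ih =>
    obtain ⟨g, hg⟩ : ∃ g : (M →₀ A) →ₗ[A] M, Function.Surjective g :=
      ⟨_, Finsupp.linearCombination_id_surjective A M⟩
    exact .baseChange_of_ker hg (ih (.left (Submodule.injective_subtype _) hg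
      (LinearMap.exact_subtype_ker_map g) (projDimLE_of_projective n) h))

section PolynomialRing

variable (A M : Type*) [CommRing A] [AddCommGroup M] [Module A M]

/-- The coefficients of an element of `A[X] ⊗ M` at the powers of `X`. -/
noncomputable def tensorCoeffs : A[X] ⊗[A] M ≃ₗ[A] ℕ →₀ M :=
  TensorProduct.equivFinsuppOfBasisLeft (Polynomial.basisMonomials A)

variable {A M} in
lemma tensorCoeffs_tmul (p : A[X]) (m : M) (i : ℕ) :
    tensorCoeffs A M (p ⊗ₜ m) i = p.coeff i • m :=
  TensorProduct.equivFinsuppOfBasisLeft_apply_tmul_apply ..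

variable [Module A[X] M] [IsScalarTower A A[X] M]

/-- The endomorphism `X ⊗ 1 - 1 ⊗ X` of `A[X] ⊗ M`, the first map of the characteristic sequence
`0 → A[X] ⊗ M → A[X] ⊗ M → M → 0` of an `A[X]`-module `M`. -/
noncomputable def charMap : A[X] ⊗[A] M →ₗ[A[X]] A[X] ⊗[A] M :=
  (Polynomial.X : A[X]) • LinearMap.id -
    ((LinearMap.lsmul A[X] M Polynomial.X).restrictScalars A).baseChange A[X]

/-- The action map `A[X] ⊗ M → M`, the second map of the characteristic sequence. -/
noncomputable def actMap : A[X] ⊗[A] M →ₗ[A[X]] M :=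
  TensorProduct.AlgebraTensorModule.lift
    { toFun := fun p => (LinearMap.lsmul A[X] M p).restrictScalars A
      map_add' := fun p r => by ext; simp
      map_smul' := fun p r => by ext; simp [mul_smul] }

variable {A M}

lemma charMap_tmul (p : A[X]) (m : M) :
    charMap A M (p ⊗ₜ m) = (Polynomial.X * p) ⊗ₜ[A] m - p ⊗ₜ[A] ((Polynomial.X : A[X]) • m) := by
  simp [charMap, smul_tmul']

lemma actMap_tmul (p : A[X]) (m : M) : actMap A M (p ⊗ₜ m) = p • m := rfl

lemma actMap_surjective : Function.Surjective (actMap A M) := fun m =>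
  ⟨1 ⊗ₜ m, by simp only [actMap_tmul, one_smul]⟩

lemma tmul_sub_one_tmul_smul_mem_range (p : A[X]) (m : M) :
    p ⊗ₜ[A] m - 1 ⊗ₜ (p • m) ∈ LinearMap.range (charMap A M) := by
  induction p using Polynomial.induction_on with
  | C a =>
    have : (Polynomial.C a : A[X]) ⊗ₜ[A] m = 1 ⊗ₜ ((Polynomial.C a : A[X]) • m) := by
      rw [← Polynomial.algebraMap_eq, algebraMap_smul, tmul_smul, smul_tmul',
        Algebra.smul_def, mul_one]
    rw [this, sub_self]
    exact zero_mem _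
  | add p r hp hr =>
    rw [add_smul, tmul_add, add_tmul, add_sub_add_comm]
    exact add_mem hp hr
  | monomial n a ih =>
    have h := add_mem ((LinearMap.range (charMap A M)).smul_mem Polynomial.X ih)
      (LinearMap.mem_range_self (charMap A M) (1 ⊗ₜ ((Polynomial.C a * Polynomial.X ^ n) • m)))
    rw [charMap_tmul, smul_sub, smul_tmul', smul_tmul', smul_eq_mul, smul_eq_mul,
      sub_add_sub_cancel, smul_smul] at h
    rwa [show (Polynomial.C a * Polynomial.X ^ (n + 1) : A[X]) =
      Polynomial.X * (Polynomial.C a * Polynomial.X ^ n) by ring]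

lemma exact_charMap_actMap : Function.Exact (charMap A M) (actMap A M) := by
  have hcomp : actMap A M ∘ₗ charMap A M = 0 := by
    ext m
    simp [charMap_tmul, actMap_tmul]
  have hmem (z : A[X] ⊗[A] M) : z - 1 ⊗ₜ actMap A M z ∈ LinearMap.range (charMap A M) := by
    induction z with
    | zero => simp
    | add a b ha hb =>
      rw [map_add, tmul_add, add_sub_add_comm]
      exact add_mem ha hb
    | tmul p m => exact tmul_sub_one_tmul_smul_mem_range p m
  rw [LinearMap.exact_iff]
  refine le_antisymm (fun z hz => ?_) (LinearMap.range_le_ker_iff.mpr hcomp)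
  simpa only [LinearMap.mem_ker.mp hz, tmul_zero, sub_zero] using hmem z

lemma tensorCoeffs_charMap (z : A[X] ⊗[A] M) (i : ℕ) :
    tensorCoeffs A M (charMap A M z) (i + 1) =
      tensorCoeffs A M z i - (Polynomial.X : A[X]) • tensorCoeffs A M z (i + 1) := by
  induction z with
  | zero => simp
  | add a b ha hb =>
    simp only [map_add, Finsupp.add_apply, ha, hb, smul_add]
    abel
  | tmul p m =>
    rw [charMap_tmul, map_sub, Finsupp.sub_apply, tensorCoeffs_tmul, tensorCoeffs_tmul,
      tensorCoeffs_tmul, tensorCoeffs_tmul, Polynomial.coeff_X_mul,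
      ← algebraMap_smul A[X] (p.coeff (i + 1)) m, smul_comm, algebraMap_smul]

lemma charMap_injective : Function.Injective (charMap A M) := by
  rw [injective_iff_map_eq_zero]
  intro z hz
  have hcoeff (i : ℕ) :
      tensorCoeffs A M z i = (Polynomial.X : A[X]) • tensorCoeffs A M z (i + 1) := by
    rw [← sub_eq_zero, ← tensorCoeffs_charMap, hz, map_zero, Finsupp.zero_apply]
  have hiter (i n : ℕ) :
      tensorCoeffs A M z i = (Polynomial.X ^ n : A[X]) • tensorCoeffs A M z (i + n) := by
    induction n with
    | zero => simp
    | succ n ih => rw [ih, hcoeff, smul_smul, ← pow_succ, add_assoc]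
  obtain ⟨n, hn⟩ := (tensorCoeffs A M z).support.exists_nat_subset_range
  refine (tensorCoeffs A M).map_eq_zero_iff.mp (Finsupp.ext fun i => ?_)
  have hlarge : tensorCoeffs A M z (i + n) = 0 := by
    by_contra h
    have := Finset.mem_range.mp (hn (Finsupp.mem_support_iff.mpr h))
    omega
  rw [hiter i n, hlarge, smul_zero, Finsupp.zero_apply]

end PolynomialRing

lemma ProjDimLE.polynomial {A M : Type q} [CommRing A] [AddCommGroup M] [Module A M]
    [Module A[X] M] [IsScalarTower A A[X] M] {n : ℕ} (h : ProjDimLE A M n) :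
    ProjDimLE A[X] M (n + 1) :=
  .right charMap_injective actMap_surjective exact_charMap_actMap (h.baseChange A[X])
    ((h.baseChange A[X]).mono n.le_succ)

/-- **Hilbert's syzygy theorem** -/
theorem projDimLE_mvPolynomial (k : Type q) [Field k] (n : ℕ) (M : Type q) [AddCommGroup M]
    [Module (MvPolynomial (Fin n) k) M] : ProjDimLE (MvPolynomial (Fin n) k) M n := by
  induction n generalizing M with
  | zero =>
    exact projDimLE_of_ringEquiv (MvPolynomial.isEmptyRingEquiv k (Fin 0)).symm
      (fun M _ _ => projDimLE_of_projective 0) M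
  | succ n ih =>
    refine projDimLE_of_ringEquiv (MvPolynomial.finSuccEquiv k n).symm.toRingEquiv
      (fun M _ _ => ?_) M
    let _ : Module (MvPolynomial (Fin n) k) M :=
      Module.compHom M (Polynomial.C : MvPolynomial (Fin n) k →+* _)
    have : IsScalarTower (MvPolynomial (Fin n) k) (MvPolynomial (Fin n) k)[X] M :=
      ⟨fun a p m => by rw [Algebra.smul_def, mul_smul]; rfl⟩
    exact (ih M).polynomial

end ProjectiveDimension

/-! ### Regular elements and weakly regular sequences -/

section Regular

open RingTheory.Sequence

section Quotient

variable {A : Type*} [CommRing A] {I : Ideal A} {c d : A}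

lemma isSMulRegular_quotient_iff :
    IsSMulRegular (A ⧸ I) c ↔ ∀ p, c * p ∈ I → p ∈ I :=
  isSMulRegular_quotient_iff_mem_of_smul_mem I c

lemma isSMulRegular_quotient_congr (hc : IsSMulRegular (A ⧸ I) c) (h : c - d ∈ I) :
    IsSMulRegular (A ⧸ I) d := by
  rw [isSMulRegular_quotient_iff] at hc ⊢
  intro p hp
  refine hc p ?_
  simpa [sub_mul] using I.add_mem (I.mul_mem_right p h) hp

lemma isSMulRegular_quotient_bot_iff :
    IsSMulRegular (A ⧸ (⊥ : Ideal A)) c ↔ IsSMulRegular A c :=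
  (Submodule.quotEquivOfEqBot ⊥ rfl).isSMulRegular_congr c

lemma isSMulRegular_quotient_ker {B : Type*} [CommRing B] {π : A →+* B}
    (hc : π c ∈ nonZeroDivisors B) : IsSMulRegular (A ⧸ RingHom.ker π) c := by
  rw [isSMulRegular_quotient_iff]
  intro p hp
  rw [RingHom.mem_ker, map_mul] at hp
  exact (mul_left_mem_nonZeroDivisors_eq_zero_iff hc).mp hp

lemma mk_mem_nonZeroDivisors (hc : IsSMulRegular (A ⧸ I) c) :
    Ideal.Quotient.mk I c ∈ nonZeroDivisors (A ⧸ I) := by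
  rw [mem_nonZeroDivisors_iff_right]
  intro p hp
  exact hc.right_eq_zero_of_smul (by rwa [Algebra.smul_def, mul_comm])

lemma sup_span_singleton_congr (h : c - d ∈ I) : I ⊔ Ideal.span {c} = I ⊔ Ideal.span {d} := by
  refine le_antisymm (sup_le le_sup_left ?_) (sup_le le_sup_left ?_) <;>
    rw [Ideal.span_singleton_le_iff_mem, sup_comm, Ideal.mem_span_singleton_sup]
  · exact ⟨1, c - d, h, by ring⟩
  · exact ⟨1, d - c, by simpa using I.neg_mem h, by ring⟩

lemma isSMulRegular_quotient_sup_span_mul {d₁ d₂ : A} (hd : IsSMulRegular (A ⧸ I) d₁)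
    (h₁ : IsSMulRegular (A ⧸ (I ⊔ Ideal.span {d₁})) c)
    (h₂ : IsSMulRegular (A ⧸ (I ⊔ Ideal.span {d₂})) c) :
    IsSMulRegular (A ⧸ (I ⊔ Ideal.span {d₁ * d₂})) c := by
  simp only [isSMulRegular_quotient_iff, sup_comm I, Ideal.mem_span_singleton_sup] at hd h₁ h₂ ⊢
  rintro p ⟨r, i, hi, h⟩
  obtain ⟨p', i', hi', rfl⟩ := h₁ p ⟨r * d₂, i, hi, by rw [← h]; ring⟩
  have hdiv : d₁ * (c * p' - r * d₂) ∈ I := by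
    convert I.sub_mem hi (I.mul_mem_left c hi') using 1
    linear_combination -h
  obtain ⟨s, j, hj, rfl⟩ := h₂ p' ⟨r, _, hd _ hdiv, by ring⟩
  exact ⟨s, i' + j * d₁, I.add_mem hi' (I.mul_mem_right _ hj), by ring⟩

lemma isSMulRegular_quotient_sup_span_pow (hd : IsSMulRegular (A ⧸ I) d)
    (h : IsSMulRegular (A ⧸ (I ⊔ Ideal.span {d})) c) (n : ℕ) :
    IsSMulRegular (A ⧸ (I ⊔ Ideal.span {d ^ n})) c := by
  induction n with
  | zero => simp [isSMulRegular_quotient_iff]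
  | succ n ih => exact pow_succ' d n ▸ isSMulRegular_quotient_sup_span_mul hd h ih

/-- `(A / I) / c (A / I) ≃ A / (I + (c))`. -/
def quotSMulTopQuotientEquiv (I : Ideal A) (c : A) :
    QuotSMulTop c (A ⧸ I) ≃ₗ[A] A ⧸ (I ⊔ Ideal.span {c}) :=
  (Submodule.quotEquivOfEq _ _ (by
    rw [← Submodule.ideal_span_singleton_smul, ← I.range_mkQ, LinearMap.range_eq_map,
      ← Submodule.map_smul'', smul_eq_mul, Ideal.mul_top])).trans
    (Submodule.quotientQuotientEquivQuotientSup I (Ideal.span {c}))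

lemma isWeaklyRegular_quotient_cons_iff {cs : List A} :
    IsWeaklyRegular (A ⧸ I) (c :: cs) ↔
      IsSMulRegular (A ⧸ I) c ∧ IsWeaklyRegular (A ⧸ (I ⊔ Ideal.span {c})) cs := by
  rw [isWeaklyRegular_cons_iff, (quotSMulTopQuotientEquiv I c).isWeaklyRegular_congr]

lemma isWeaklyRegular_quotient_triple_iff {c₀ c₁ c₂ : A} :
    IsWeaklyRegular (A ⧸ I) [c₀, c₁, c₂] ↔
      IsSMulRegular (A ⧸ I) c₀ ∧ IsSMulRegular (A ⧸ (I ⊔ Ideal.span {c₀})) c₁ ∧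
        IsSMulRegular (A ⧸ (I ⊔ Ideal.span {c₀} ⊔ Ideal.span {c₁})) c₂ := by
  rw [isWeaklyRegular_quotient_cons_iff, isWeaklyRegular_quotient_cons_iff,
    isWeaklyRegular_singleton_iff]

lemma isWeaklyRegular_triple_iff {c₀ c₁ c₂ : A} :
    IsWeaklyRegular A [c₀, c₁, c₂] ↔
      IsSMulRegular A c₀ ∧ IsSMulRegular (A ⧸ Ideal.span {c₀}) c₁ ∧
        IsSMulRegular (A ⧸ (Ideal.span {c₀} ⊔ Ideal.span {c₁})) c₂ := by
  rw [← (Submodule.quotEquivOfEqBot (⊥ : Ideal A) rfl).isWeaklyRegular_congr,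
    isWeaklyRegular_quotient_triple_iff, isSMulRegular_quotient_bot_iff, bot_sup_eq]

end Quotient

lemma isSMulRegular_neg {A M : Type*} [Ring A] [AddCommGroup M] [Module A M] {c : A}
    (hc : IsSMulRegular M c) : IsSMulRegular M (-c) :=
  fun m n h => hc (by simpa using h)

lemma isWeaklyRegular_of_exact {A M₁ M₂ M₃ : Type*} [CommRing A] [AddCommGroup M₁] [Module A M₁]
    [AddCommGroup M₂] [Module A M₂] [AddCommGroup M₃] [Module A M₃] {f : M₁ →ₗ[A] M₂}
    {g : M₂ →ₗ[A] M₃} {cs : List A} (hf : Function.Injective f) (hg : Function.Surjective g)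
    (hfg : Function.Exact f g) (h₁ : IsWeaklyRegular M₁ cs) (h₃ : IsWeaklyRegular M₃ cs) :
    IsWeaklyRegular M₂ cs := by
  induction cs generalizing M₁ M₂ M₃ with
  | nil => exact .nil _ _
  | cons c cs ih =>
    rw [isWeaklyRegular_cons_iff] at h₁ h₃ ⊢
    have hf' : Function.Injective (QuotSMulTop.map c f) := by
      have hzero : Function.Exact (0 : PUnit →ₗ[A] M₁) f := by
        simpa [LinearMap.exact_zero_iff_injective] using hf
      have := QuotSMulTop.map_first_exact_on_four_term_exact_of_isSMulRegular_last hzero hfg h₃.1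
      simpa [LinearMap.exact_zero_iff_injective] using this
    exact ⟨isSMulRegular_of_range_eq_ker hf hfg.linearMap_ker_eq.symm h₁.1 h₃.1,
      ih hf' (QuotSMulTop.map_surjective c hg) (QuotSMulTop.map_exact c hfg hg) h₁.2 h₃.2⟩

end Regular

/-! ### Maximal minors of a `2 × 3` matrix -/

section Minors

open scoped Matrix

section Syzygies

variable {A : Type*} [CommRing A]

/-- The ideal of maximal minors of the matrix with rows `a` and `b`; the signed minors are the
entries of the cross product. -/
def minorIdeal (a b : Fin 3 → A) : Ideal A := Ideal.span (Set.range (a ⨯₃ b))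

/-- The syzygies modulo `I` of the maximal minors are generated by the rows `a` and `b`. -/
def MinorSyzygies (I : Ideal A) (a b : Fin 3 → A) : Prop :=
  ∀ s : Fin 3 → A, s ⬝ᵥ (a ⨯₃ b) ∈ I → ∃ l m : A, ∀ i, s i - (l * a i + m * b i) ∈ I

variable {a b : Fin 3 → A} {I : Ideal A} {D : A}

lemma mem_minorIdeal {p : A} : p ∈ minorIdeal a b ↔ ∃ s : Fin 3 → A, s ⬝ᵥ (a ⨯₃ b) = p :=
  Ideal.mem_span_range_iff_exists_fun

lemma cross_mem_minorIdeal (i : Fin 3) : (a ⨯₃ b) i ∈ minorIdeal a b :=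
  Ideal.subset_span ⟨i, rfl⟩

lemma dotProduct_mem {e : Fin 3 → A} (he : ∀ i, e i ∈ I) (s : Fin 3 → A) : s ⬝ᵥ e ∈ I :=
  I.sum_mem fun i _ => I.mul_mem_left (s i) (he i)

lemma exists_mul_sub_mem {s : Fin 3 → A} (hs : s ⬝ᵥ (a ⨯₃ b) ∈ I) (hD : D ∈ minorIdeal a b) :
    ∃ l m : A, ∀ i, D * s i - (l * a i + m * b i) ∈ I := by
  obtain ⟨d, rfl⟩ := mem_minorIdeal.mp hD
  refine ⟨d ⬝ᵥ (s ⨯₃ b), d ⬝ᵥ (a ⨯₃ s), fun i => ?_⟩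
  have cramer : d ⬝ᵥ (a ⨯₃ b) * s i - (d ⬝ᵥ (s ⨯₃ b) * a i + d ⬝ᵥ (a ⨯₃ s) * b i) =
      d i * (s ⬝ᵥ (a ⨯₃ b)) := by
    simp only [cross_apply, Matrix.vec3_dotProduct, Matrix.cons_val]
    fin_cases i <;> simp <;> ring
  exact cramer ▸ I.mul_mem_left (d i) hs

lemma mul_mem_of_combination_mem {l m : A} (h : ∀ i, l * a i + m * b i ∈ I)
    (hD : D ∈ minorIdeal a b) : D * l ∈ I ∧ D * m ∈ I := by
  obtain ⟨d, rfl⟩ := mem_minorIdeal.mp hD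
  set r : Fin 3 → A := fun i => l * a i + m * b i with hr
  have hl : d ⬝ᵥ (a ⨯₃ b) * l = (b ⨯₃ d) ⬝ᵥ r := by
    simp only [hr, cross_apply, Matrix.vec3_dotProduct, Matrix.cons_val]; ring
  have hm : d ⬝ᵥ (a ⨯₃ b) * m = (d ⨯₃ a) ⬝ᵥ r := by
    simp only [hr, cross_apply, Matrix.vec3_dotProduct, Matrix.cons_val]; ring
  exact ⟨hl ▸ dotProduct_mem h _, hm ▸ dotProduct_mem h _⟩

/-- The **Hilbert–Burch** criterion for a `2 × 3` matrix. -/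
lemma minorSyzygies_of_isSMulRegular {D' : A} (hD : D ∈ minorIdeal a b)
    (hD' : D' ∈ minorIdeal a b) (h : IsSMulRegular (A ⧸ I) D)
    (h' : IsSMulRegular (A ⧸ (I ⊔ Ideal.span {D})) D') : MinorSyzygies I a b := by
  rw [isSMulRegular_quotient_iff] at h h'
  intro s hs
  obtain ⟨l, m, hlm⟩ := exists_mul_sub_mem hs hD
  obtain ⟨l', m', hlm'⟩ := exists_mul_sub_mem hs hD'
  obtain ⟨hl, hm⟩ : D * (D' * l - D * l') ∈ I ∧ D * (D' * m - D * m') ∈ I :=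
    mul_mem_of_combination_mem (a := a) (b := b) (fun i => by
      convert I.sub_mem (I.mul_mem_left D (hlm' i)) (I.mul_mem_left D' (hlm i)) using 1
      ring) hD
  have divisible : ∀ {r r' : A}, D * (D' * r - D * r') ∈ I → ∃ r₀, ∃ i ∈ I, r₀ * D + i = r := by
    intro r r' hr
    simp only [sup_comm I, Ideal.mem_span_singleton_sup] at h'
    exact h' r ⟨r', _, h _ hr, by ring⟩
  obtain ⟨l₀, i, hi, rfl⟩ := divisible hl
  obtain ⟨m₀, j, hj, rfl⟩ := divisible hm
  refine ⟨l₀, m₀, fun n => h _ ?_⟩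
  convert I.add_mem (hlm n) (I.add_mem (I.mul_mem_right (a n) hi) (I.mul_mem_right (b n) hj))
    using 1
  ring

lemma isSMulRegular_quotient_sup_minorIdeal {c : A} (hc : IsSMulRegular (A ⧸ I) c)
    (h : MinorSyzygies (I ⊔ Ideal.span {c}) a b) :
    IsSMulRegular (A ⧸ (I ⊔ minorIdeal a b)) c := by
  rw [isSMulRegular_quotient_iff] at hc ⊢
  intro p hp
  obtain ⟨i, hi, _, hm, hp⟩ := Submodule.mem_sup.mp hp
  obtain ⟨s, rfl⟩ := mem_minorIdeal.mp hm
  have hs : s ⬝ᵥ (a ⨯₃ b) ∈ I ⊔ Ideal.span {c} := by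
    rw [sup_comm, Ideal.mem_span_singleton_sup]
    exact ⟨p, -i, I.neg_mem hi, by linear_combination -hp⟩
  obtain ⟨l, m, hlm⟩ := h s hs
  simp only [sup_comm I, Ideal.mem_span_singleton_sup] at hlm
  choose r e he hr using hlm
  have key : p - r ⬝ᵥ (a ⨯₃ b) ∈ I := by
    refine hc _ ?_
    have hse : s = l • a + m • b + c • r + e := by
      ext n
      simp only [Pi.add_apply, Pi.smul_apply, smul_eq_mul]
      linear_combination -hr n
    have hsdot : s ⬝ᵥ (a ⨯₃ b) = c * r ⬝ᵥ (a ⨯₃ b) + (a ⨯₃ b) ⬝ᵥ e := by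
      rw [hse, dotProduct_comm _ e]
      simp [add_dotProduct]
    have : c * (p - r ⬝ᵥ (a ⨯₃ b)) = i + (a ⨯₃ b) ⬝ᵥ e := by
      linear_combination -hp + hsdot
    exact this ▸ I.add_mem hi (dotProduct_mem he _)
  exact Submodule.mem_sup.mpr ⟨_, key, _, mem_minorIdeal.mpr ⟨r, rfl⟩, sub_add_cancel _ _⟩

end Syzygies

universe q

variable {A : Type q} [CommRing A] {a b : Fin 3 → A}

lemma projDimLE_quotient_minorIdeal {D : A} (hD : D ∈ minorIdeal a b) (hreg : IsSMulRegular A D)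
    (h : MinorSyzygies ⊥ a b) : ProjDimLE A (A ⧸ minorIdeal a b) 2 := by
  let f : (Fin 2 → A) →ₗ[A] (Fin 3 → A) := Fintype.linearCombination A ![a, b]
  let g : (Fin 3 → A) →ₗ[A] A := Fintype.linearCombination A (a ⨯₃ b)
  have hfa : ∀ s i, f s i = s 0 * a i + s 1 * b i := fun s i => by
    simp [f, Fintype.linearCombination_apply, Fin.sum_univ_two]
  have hf : Function.Injective f := by
    rw [injective_iff_map_eq_zero]
    intro s hs
    obtain ⟨h0, h1⟩ := mul_mem_of_combination_mem (I := ⊥) (l := s 0) (m := s 1) (a := a) (b := b)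
      (fun i => by rw [← hfa, hs]; rfl) hD
    ext i
    fin_cases i
    · exact hreg.right_eq_zero_of_smul h0
    · exact hreg.right_eq_zero_of_smul h1
  have hfg : Function.Exact f g.rangeRestrict := by
    rw [LinearMap.exact_iff, LinearMap.ker_rangeRestrict]
    refine le_antisymm (fun s hs => ?_) ?_
    · obtain ⟨l, m, hlm⟩ := h s hs
      exact ⟨![l, m], funext fun i => by rw [hfa]; exact (sub_eq_zero.mp (hlm i)).symm⟩
    · rintro _ ⟨s, rfl⟩
      have hfs : f s = s 0 • a + s 1 • b := funext fun i => by simp [hfa]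
      change f s ⬝ᵥ (a ⨯₃ b) = 0
      simp [hfs, add_dotProduct]
  have hrange : LinearMap.range g = minorIdeal a b := Fintype.range_linearCombination A _
  have hideal : ProjDimLE A (minorIdeal a b) 1 := hrange ▸
    ProjDimLE.right hf g.surjective_rangeRestrict hfg (projDimLE_of_projective 0)
      (projDimLE_of_projective 1)
  exact ProjDimLE.right (Submodule.injective_subtype _) (Submodule.mkQ_surjective _)
    (LinearMap.exact_subtype_mkQ _) hideal (projDimLE_of_projective 2)

end Minors

/-! ### Cyclic filtrations -/

section CyclicFiltration

/-- The cyclic module `A / (N : e)` is the quotient by `N` of the submodule that `N` and `e`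
generate. -/
noncomputable def quotientSupSpanEquiv {A M : Type*} [CommRing A] [AddCommGroup M] [Module A M]
    (N : Submodule A M) (e : M) (K : Ideal A) (hK : ∀ p : A, p • e ∈ N ↔ p ∈ K) :
    (A ⧸ K) ≃ₗ[A] ↥(N ⊔ Submodule.span A {e}) ⧸ N.submoduleOf (N ⊔ Submodule.span A {e}) :=
  let e' : ↥(N ⊔ Submodule.span A {e}) :=
    ⟨e, Submodule.mem_sup_right (Submodule.mem_span_singleton_self e)⟩
  (Submodule.quotEquivOfEq _ _ (by
    ext p
    rw [← hK, LinearMap.mem_ker, LinearMap.comp_apply, LinearMap.toSpanSingleton_apply,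
      Submodule.mkQ_apply, Submodule.Quotient.mk_eq_zero]
    rfl)).trans
    (((N.submoduleOf _).mkQ ∘ₗ
        LinearMap.toSpanSingleton A _ e').quotKerEquivOfSurjective fun m => by
      obtain ⟨⟨m, hm⟩, rfl⟩ := (N.submoduleOf _).mkQ_surjective m
      obtain ⟨m', hm', _, hp, rfl⟩ := Submodule.mem_sup.mp hm
      obtain ⟨p, rfl⟩ := Submodule.mem_span_singleton.mp hp
      refine ⟨p, ((Submodule.Quotient.eq _).mpr ?_).symm⟩
      change m' + p • e - p • e ∈ N
      rwa [add_sub_cancel_right])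

universe q

variable {A : Type q} [CommRing A] {M : Type q} [AddCommGroup M] [Module A M] {n : ℕ}

/-- `M` is generated by `e 0, …, e (n - 1)`, with successive annihilators
`K i = ((e 0, …, e (i - 1)) : e i)`. -/
structure CyclicFiltration (e : Fin n → M) (K : Fin n → Ideal A) : Prop where
  span_range : Submodule.span A (Set.range e) = ⊤
  smul_mem_iff : ∀ (i : Fin n) (p : A), p • e i ∈ Submodule.span A (e '' Set.Iio i) ↔ p ∈ K i

variable {e : Fin n → M} {K : Fin n → Ideal A}

lemma CyclicFiltration.induction (h : CyclicFiltration e K)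
    (Q : ∀ (N : Type q) [AddCommGroup N] [Module A N], Prop)
    (hzero : ∀ (N : Type q) [AddCommGroup N] [Module A N] [Subsingleton N], Q N)
    (hiso : ∀ (N N' : Type q) [AddCommGroup N] [Module A N] [AddCommGroup N'] [Module A N'],
      (N ≃ₗ[A] N') → Q N → Q N')
    (hext : ∀ (N : Type q) [AddCommGroup N] [Module A N] (N' : Submodule A N),
      Q N' → Q (N ⧸ N') → Q N)
    (hK : ∀ i, Q (A ⧸ K i)) : Q M := by
  let N (i : ℕ) : Submodule A M := Submodule.span A (e '' {j | (j : ℕ) < i})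
  have hN : ∀ i ≤ n, Q (N i) := fun i hi => by
    induction i with
    | zero =>
      have hbot : N 0 = ⊥ := by simp [N]
      have : Subsingleton (N 0) := by rw [hbot]; infer_instance
      exact hzero _
    | succ i ih =>
      have hsucc : N (i + 1) = N i ⊔ Submodule.span A {e ⟨i, hi⟩} := by
        rw [← Submodule.span_union, ← Set.image_singleton, ← Set.image_union]
        congr! 2
        ext j
        simp [Fin.ext_iff, le_iff_eq_or_lt]
      rw [hsucc]
      exact hext _ ((N i).submoduleOf _)
        (hiso _ _ (Submodule.submoduleOfEquivOfLe le_sup_left).symm (ih (by omega)))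
        (hiso _ _ (quotientSupSpanEquiv _ _ _ (h.smul_mem_iff ⟨i, hi⟩)) (hK ⟨i, hi⟩))
  have htop : N n = ⊤ := by
    have : {j : Fin n | (j : ℕ) < n} = Set.univ := Set.eq_univ_of_forall fun j => j.2
    rw [← h.span_range, ← Set.image_univ, ← this]
  exact hiso _ _ ((LinearEquiv.ofEq _ _ htop).trans Submodule.topEquiv) (hN n le_rfl)

lemma CyclicFiltration.projDimLE (h : CyclicFiltration e K) {m : ℕ}
    (hK : ∀ i, ProjDimLE A (A ⧸ K i) m) : ProjDimLE A M m :=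
  h.induction (fun N _ _ => ProjDimLE A N m) (fun _ _ _ _ => projDimLE_of_projective m)
    (fun _ _ _ _ _ _ e hN => hN.of_linearEquiv e)
    (fun _ _ _ N' => ProjDimLE.middle N'.injective_subtype N'.mkQ_surjective
      (LinearMap.exact_subtype_mkQ N')) hK

lemma CyclicFiltration.isWeaklyRegular (h : CyclicFiltration e K) {cs : List A}
    (hK : ∀ i, RingTheory.Sequence.IsWeaklyRegular (A ⧸ K i) cs) :
    RingTheory.Sequence.IsWeaklyRegular M cs :=
  h.induction (fun N _ _ => RingTheory.Sequence.IsWeaklyRegular N cs)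
    (fun _ _ _ _ => ⟨fun _ _ => Function.injective_of_subsingleton _⟩)
    (fun _ _ _ _ _ _ e hN => (e.isWeaklyRegular_congr cs).mp hN)
    (fun _ _ _ N' => isWeaklyRegular_of_exact N'.injective_subtype N'.mkQ_surjective
      (LinearMap.exact_subtype_mkQ N')) hK

end CyclicFiltration

/-! ### Regular elements of polynomial rings -/

section PolynomialRegular

variable {R : Type*} [CommRing R] {σ : Type*} {i : σ} {g : MvPolynomial σ R}

lemma C_mul_X_sub_mem_nonZeroDivisors {a : R} (ha : a ∈ nonZeroDivisors R)
    (hg : g.degreeOf i = 0) : C a * X i - g ∈ nonZeroDivisors (MvPolynomial σ R) := by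
  rw [mem_nonZeroDivisors_iff_right]
  intro p hp
  by_contra hp0
  obtain ⟨m, hm, hmax⟩ := p.support.exists_max_image (fun m => m i) (by simpa using hp0)
  have hdeg : p.degreeOf i = m i := by
    rw [degreeOf_eq_sup]
    exact le_antisymm (Finset.sup_le hmax) (Finset.le_sup (f := fun m => m i) hm)
  have hcoeff_g : (p * g).coeff (m + Finsupp.single i 1) = 0 := by
    by_contra h
    have hle := monomial_le_degreeOf i (mem_support_iff.mpr h)
    have hmul := degreeOf_mul_le i p g
    simp only [Finsupp.add_apply, Finsupp.single_eq_same] at hle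
    omega
  have hcoeff_X : (p * (C a * X i)).coeff (m + Finsupp.single i 1) = a * p.coeff m := by
    rw [mul_left_comm, coeff_C_mul, coeff_mul_X]
  have htop := congrArg (coeff (m + Finsupp.single i 1)) hp
  rw [mul_sub, coeff_sub, hcoeff_g, hcoeff_X, sub_zero, coeff_zero] at htop
  exact mem_support_iff.mp hm ((mul_left_mem_nonZeroDivisors_eq_zero_iff ha).mp htop)

variable {K : Ideal R}

lemma isSMulRegular_map_C_mul_X_sub {a : R} (ha : IsSMulRegular (R ⧸ K) a)
    (hg : g.degreeOf i = 0) :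
    IsSMulRegular (MvPolynomial σ R ⧸ K.map C) (C a * X i - g) := by
  have hker : K.map C = RingHom.ker (MvPolynomial.map (σ := σ) (Ideal.Quotient.mk K)) := by
    rw [MvPolynomial.ker_map, Ideal.mk_ker]
  rw [hker]
  refine isSMulRegular_quotient_ker ?_
  rw [map_sub, map_mul, map_C, map_X]
  refine C_mul_X_sub_mem_nonZeroDivisors (mk_mem_nonZeroDivisors ha) ?_
  rw [degreeOf_eq_sup, ← Nat.bot_eq_zero, eq_bot_iff] at hg ⊢
  exact (Finset.sup_mono (support_map_subset _ _)).trans hg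

lemma isSMulRegular_map_C {a : R} (ha : IsSMulRegular (R ⧸ K) a) :
    IsSMulRegular (MvPolynomial σ R ⧸ K.map C) (C a : MvPolynomial σ R) := by
  rw [isSMulRegular_quotient_iff] at ha ⊢
  intro p hp
  rw [mem_map_C_iff] at hp ⊢
  exact fun m => ha _ (by simpa using hp m)

lemma isSMulRegular_C {a : R} (ha : IsSMulRegular R a) :
    IsSMulRegular (MvPolynomial σ R) (C a : MvPolynomial σ R) := by
  rw [← isSMulRegular_quotient_bot_iff] at ha ⊢
  rw [← Ideal.map_bot (f := C)]
  exact isSMulRegular_map_C ha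

lemma isSMulRegular_map_C_X_sub_C (K : Ideal R) (i : σ) (r : R) :
    IsSMulRegular (MvPolynomial σ R ⧸ K.map C) (X i - C r : MvPolynomial σ R) := by
  simpa using isSMulRegular_map_C_mul_X_sub (IsSMulRegular.one (R ⧸ K)) (degreeOf_C r i)

lemma map_C_span_singleton (r : R) :
    (Ideal.span {r}).map (C : R →+* MvPolynomial σ R) = Ideal.span {C r} := by
  rw [Ideal.map_span, Set.image_singleton]

variable {v : σ → MvPolynomial σ R}

lemma ker_bind₁_eq_span (hv : ∀ i, bind₁ v (v i) = v i) :
    RingHom.ker (bind₁ v) =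
      Ideal.span (Set.range fun i => X i - v i) := by
  set I := Ideal.span (Set.range fun i => X i - v i) with hI
  refine le_antisymm (fun p hp => ?_) ?_
  · have hsubst : Ideal.Quotient.mkₐ R I = (Ideal.Quotient.mkₐ R I).comp (bind₁ v) := by
      ext i
      simpa [Ideal.Quotient.eq] using Ideal.subset_span (Set.mem_range_self i)
    have hp' := congrArg (fun f => f p) hsubst
    rw [← Ideal.Quotient.eq_zero_iff_mem]
    exact hp'.trans (by simp [show bind₁ v p = 0 from hp])
  · rw [hI, Ideal.span_le]
    rintro _ ⟨i, rfl⟩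
    simp [hv]

lemma isSMulRegular_map_C_sup_ker_bind₁ (hv : ∀ i, bind₁ v (v i) = v i) {c : MvPolynomial σ R}
    (hc : IsSMulRegular (MvPolynomial σ R ⧸ K.map C) (bind₁ v c)) :
    IsSMulRegular (MvPolynomial σ R ⧸ (K.map C ⊔ RingHom.ker (bind₁ v))) c := by
  have hidem : (bind₁ v).comp (bind₁ v) = (bind₁ v) := by
    ext i
    simp [hv]
  rw [isSMulRegular_quotient_iff] at hc ⊢
  intro p hp
  have hmap : bind₁ v (c * p) ∈ K.map (C : R →+* MvPolynomial σ R) := by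
    obtain ⟨q, hq, r, hr, h⟩ := Submodule.mem_sup.mp hp
    rw [← h, map_add, show bind₁ v r = 0 from hr, add_zero]
    have hq' := Ideal.mem_map_of_mem (bind₁ v).toRingHom hq
    rwa [Ideal.map_map, show (bind₁ v).toRingHom.comp C = C by ext; simp] at hq'
  rw [map_mul] at hmap
  refine Submodule.mem_sup.mpr ⟨_, hc _ hmap, p - bind₁ v p, ?_, by ring⟩
  rw [RingHom.mem_ker, map_sub, sub_eq_zero]
  exact (congrArg (fun f => f p) hidem).symm

lemma isSMulRegular_ker_bind₁ (hv : ∀ i, bind₁ v (v i) = v i) {c : MvPolynomial σ R}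
    (hc : IsSMulRegular (MvPolynomial σ R) (bind₁ v c)) :
    IsSMulRegular (MvPolynomial σ R ⧸ RingHom.ker (bind₁ v)) c := by
  have := isSMulRegular_map_C_sup_ker_bind₁ (K := ⊥) hv
    (by rwa [Ideal.map_bot, isSMulRegular_quotient_bot_iff])
  rwa [Ideal.map_bot, bot_sup_eq] at this

lemma isSMulRegular_ker_bind₁_X_sub_C (hv : ∀ i, bind₁ v (v i) = v i) (hi : v i = X i) (r : R) :
    IsSMulRegular (MvPolynomial σ R ⧸ RingHom.ker (bind₁ v)) (X i - C r : MvPolynomial σ R) := by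
  refine isSMulRegular_ker_bind₁ hv ?_
  have hreg := isSMulRegular_map_C_X_sub_C (⊥ : Ideal R) i r
  rw [Ideal.map_bot, isSMulRegular_quotient_bot_iff] at hreg
  simpa [hi] using hreg

end PolynomialRegular

/-! ### Ideals generated by regular sequences of length three -/

section RegularSequence

open RingTheory.Sequence
open scoped Matrix

section LinearType

variable {R : Type*} [CommRing R] {j : Fin 3 → R}

/-- The ideal of maximal minors of the matrix with rows `j` and `X 0, X 1, X 2`; it is generated by
the linear forms of the Koszul syzygies of `j`. -/
noncomputable abbrev relIdeal (j : Fin 3 → R) : Ideal (MvPolynomial (Fin 3) R) :=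
  minorIdeal (C ∘ j) X

/-- The map `R[X 0, X 1, X 2] → R[T]`, `X i ↦ j i T`. -/
noncomputable def reesMap (j : Fin 3 → R) : MvPolynomial (Fin 3) R →ₐ[R] Polynomial R :=
  aeval fun i => Polynomial.monomial 1 (j i)

lemma cross_C_X_zero : ((C ∘ j) ⨯₃ (X : Fin 3 → MvPolynomial (Fin 3) R)) 0 =
    C (j 1) * X 2 - C (j 2) * X 1 := rfl

lemma cross_C_X_one : ((C ∘ j) ⨯₃ (X : Fin 3 → MvPolynomial (Fin 3) R)) 1 =
    C (j 2) * X 0 - C (j 0) * X 2 := rfl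

lemma cross_C_X_two : ((C ∘ j) ⨯₃ (X : Fin 3 → MvPolynomial (Fin 3) R)) 2 =
    C (j 0) * X 1 - C (j 1) * X 0 := rfl

lemma degreeOf_C_mul_X_of_ne {σ : Type*} (r : R) {i l : σ} (h : l ≠ i) :
    (C r * X l : MvPolynomial σ R).degreeOf i = 0 := by
  classical
  cases subsingleton_or_nontrivial R
  · rw [Subsingleton.elim (C r * X l) 0, degreeOf_zero]
  · refine Nat.eq_zero_of_le_zero ((degreeOf_C_mul_le _ _ _).trans ?_)
    rw [degreeOf_X, if_neg h.symm]

section Substitution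

variable {v : Fin 3 → MvPolynomial (Fin 3) R}

lemma ker_bind₁_fin_three (hv : ∀ i, bind₁ v (v i) = v i) :
    RingHom.ker (bind₁ v) =
      Ideal.span {X 0 - v 0} ⊔ Ideal.span {X 1 - v 1} ⊔ Ideal.span {X 2 - v 2} := by
  have hcons : (fun i => X i - v i) = ![X 0 - v 0, X 1 - v 1, X 2 - v 2] := by
    ext1 i
    fin_cases i <;> rfl
  rw [ker_bind₁_eq_span hv, hcons, Matrix.range_cons, Matrix.range_cons, Matrix.range_cons,
    Matrix.range_empty, Set.union_empty, Ideal.span_union, Ideal.span_union, sup_assoc]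

variable (R) in
lemma exists_ker_bind₁_eq_span_X_zero : ∃ v : Fin 3 → MvPolynomial (Fin 3) R,
    v 1 = X 1 ∧ v 2 = X 2 ∧ (∀ i, bind₁ v (v i) = v i) ∧
      RingHom.ker (bind₁ v) = Ideal.span {X 0} := by
  obtain ⟨v, h₀, h₁, h₂⟩ : ∃ v : Fin 3 → MvPolynomial (Fin 3) R, v 0 = 0 ∧ v 1 = X 1 ∧ v 2 = X 2 :=
    ⟨![0, X 1, X 2], rfl, rfl, rfl⟩
  have hv : ∀ i, bind₁ v (v i) = v i := by simp [Fin.forall_fin_succ, h₀, h₁, h₂]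
  exact ⟨v, h₁, h₂, hv, by simp [ker_bind₁_fin_three hv, h₀, h₁, h₂]⟩

lemma exists_ker_bind₁_eq_span_X_zero_X_one (r : R) : ∃ v : Fin 3 → MvPolynomial (Fin 3) R,
    v 0 = 0 ∧ v 1 = C r ∧ v 2 = X 2 ∧ (∀ i, bind₁ v (v i) = v i) ∧
      RingHom.ker (bind₁ v) = Ideal.span {X 0} ⊔ Ideal.span {X 1 - C r} := by
  obtain ⟨v, h₀, h₁, h₂⟩ : ∃ v : Fin 3 → MvPolynomial (Fin 3) R, v 0 = 0 ∧ v 1 = C r ∧ v 2 = X 2 :=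
    ⟨![0, C r, X 2], rfl, rfl, rfl⟩
  have hv : ∀ i, bind₁ v (v i) = v i := by simp [Fin.forall_fin_succ, h₀, h₁, h₂]
  exact ⟨v, h₀, h₁, h₂, hv, by simp [ker_bind₁_fin_three hv, h₀, h₁, h₂]⟩

lemma exists_ker_bind₁_eq_span_X_zero_X_one_X_two (r s : R) :
    ∃ v : Fin 3 → MvPolynomial (Fin 3) R,
      v 0 = 0 ∧ v 1 = C r ∧ v 2 = C s ∧ (∀ i, bind₁ v (v i) = v i) ∧
      RingHom.ker (bind₁ v) =
        Ideal.span {X 0} ⊔ Ideal.span {X 1 - C r} ⊔ Ideal.span {X 2 - C s} := by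
  obtain ⟨v, h₀, h₁, h₂⟩ : ∃ v : Fin 3 → MvPolynomial (Fin 3) R, v 0 = 0 ∧ v 1 = C r ∧ v 2 = C s :=
    ⟨![0, C r, C s], rfl, rfl, rfl⟩
  have hv : ∀ i, bind₁ v (v i) = v i := by simp [Fin.forall_fin_succ, h₀, h₁, h₂]
  exact ⟨v, h₀, h₁, h₂, hv, by simp [ker_bind₁_fin_three hv, h₀, h₁, h₂]⟩

end Substitution

lemma minorSyzygies_span_C (hj : IsWeaklyRegular R [j 0, j 1, j 2]) :
    MinorSyzygies (Ideal.span {C (j 0)}) (C ∘ j) (X : Fin 3 → MvPolynomial (Fin 3) R) := by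
  obtain ⟨-, h₁, h₂⟩ := isWeaklyRegular_triple_iff.mp hj
  set I : Ideal (MvPolynomial (Fin 3) R) := Ideal.span {C (j 0)}
  have hmap : (Ideal.span {j 0}).map C = I := map_C_span_singleton _
  have hcongr : ((C ∘ j) ⨯₃ X) 2 - -(C (j 1) * X 0) ∈ I :=
    Ideal.mem_span_singleton.mpr ⟨X 1, by rw [cross_C_X_two]; ring⟩
  have hC : IsSMulRegular (MvPolynomial (Fin 3) R ⧸ I) (C (j 1) : MvPolynomial (Fin 3) R) :=
    hmap ▸ isSMulRegular_map_C h₁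
  have hX : IsSMulRegular (MvPolynomial (Fin 3) R ⧸ I) (X 0 : MvPolynomial (Fin 3) R) := by
    rw [← hmap]
    simpa using isSMulRegular_map_C_X_sub_C (Ideal.span {j 0}) (0 : Fin 3) 0
  refine minorSyzygies_of_isSMulRegular (cross_mem_minorIdeal 2) (cross_mem_minorIdeal 0) ?_ ?_
  · exact isSMulRegular_quotient_congr (isSMulRegular_neg (hC.mul hX))
      (by rw [← neg_sub]; exact I.neg_mem hcongr)
  · rw [sup_span_singleton_congr hcongr, Ideal.span_singleton_neg, cross_C_X_zero]
    refine isSMulRegular_quotient_sup_span_mul hC ?_ ?_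
    · rw [← hmap, ← map_C_span_singleton, ← Ideal.map_sup]
      simpa using isSMulRegular_neg (isSMulRegular_map_C_mul_X_sub h₂ (i := (1 : Fin 3))
        (degreeOf_C_mul_X_of_ne (j 1) (l := 2) (by decide)))
    · obtain ⟨v, hv₁, hv₂, hv, hker⟩ := exists_ker_bind₁_eq_span_X_zero R
      rw [← hmap, ← hker]
      refine isSMulRegular_map_C_sup_ker_bind₁ hv ?_
      simpa [hv₁, hv₂] using isSMulRegular_map_C_mul_X_sub h₁ (i := (2 : Fin 3))
        (degreeOf_C_mul_X_of_ne (j 2) (l := 1) (by decide))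

lemma isSMulRegular_relIdeal_C (hj : IsWeaklyRegular R [j 0, j 1, j 2]) :
    IsSMulRegular (MvPolynomial (Fin 3) R ⧸ relIdeal j) (C (j 0) : MvPolynomial (Fin 3) R) := by
  have := isSMulRegular_quotient_sup_minorIdeal (I := ⊥) (a := C ∘ j) (b := X)
    (isSMulRegular_quotient_bot_iff.mpr (isSMulRegular_C (isWeaklyRegular_triple_iff.mp hj).1))
    (by simpa using minorSyzygies_span_C hj)
  rwa [bot_sup_eq] at this

lemma relIdeal_le_ker (j : Fin 3 → R) : relIdeal j ≤ RingHom.ker (reesMap j) := by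
  rw [relIdeal, minorIdeal, Ideal.span_le]
  rintro _ ⟨i, rfl⟩
  have hswap : ∀ r s : R, Polynomial.C r * Polynomial.monomial 1 s =
      Polynomial.C s * Polynomial.monomial 1 r := fun r s => by
    simp only [Polynomial.C_mul_monomial, mul_comm]
  fin_cases i <;> simp [cross_apply, reesMap, hswap]

lemma C_mul_X_sub_mem_relIdeal (i : Fin 3) : C (j 0) * X i - C (j i) * X 0 ∈ relIdeal j := by
  fin_cases i
  · simp
  · exact cross_mem_minorIdeal 2
  · simpa [cross_C_X_one] using neg_mem (cross_mem_minorIdeal (a := C ∘ j)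
      (b := (X : Fin 3 → MvPolynomial (Fin 3) R)) 1)

lemma exists_pow_mul_sub_mem (F : MvPolynomial (Fin 3) R) :
    ∃ (N : ℕ) (g : Polynomial R), C (j 0) ^ N * F - Polynomial.aeval (X 0) g ∈ relIdeal j := by
  induction F using MvPolynomial.induction_on with
  | C a => exact ⟨0, Polynomial.C a, by simp [algebraMap_eq]⟩
  | add p q hp hq =>
    obtain ⟨N, g, h⟩ := hp
    obtain ⟨N', g', h'⟩ := hq
    refine ⟨N + N', Polynomial.C (j 0) ^ N' * g + Polynomial.C (j 0) ^ N * g', ?_⟩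
    convert Ideal.add_mem _ (Ideal.mul_mem_left _ (C (j 0) ^ N') h)
      (Ideal.mul_mem_left _ (C (j 0) ^ N) h') using 1
    simp [algebraMap_eq]
    ring
  | mul_X p i hp =>
    obtain ⟨N, g, h⟩ := hp
    refine ⟨N + 1, Polynomial.C (j i) * Polynomial.X * g, ?_⟩
    convert Ideal.add_mem _ (Ideal.mul_mem_left _ (C (j i) * X 0) h)
      (Ideal.mul_mem_left _ (C (j 0) ^ N * p) (C_mul_X_sub_mem_relIdeal i)) using 1
    simp [algebraMap_eq]
    ring

/-- An ideal generated by a regular sequence is of linear type. -/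
theorem ker_reesMap (hj : IsWeaklyRegular R [j 0, j 1, j 2]) :
    RingHom.ker (reesMap j) = relIdeal j := by
  refine le_antisymm (fun F hF => ?_) (relIdeal_le_ker j)
  obtain ⟨N, g, h⟩ := exists_pow_mul_sub_mem (j := j) F
  have hcomp : g.comp (Polynomial.C (j 0) * Polynomial.X) = 0 := by
    have := relIdeal_le_ker j h
    rw [RingHom.mem_ker, map_sub, map_mul, RingHom.mem_ker.mp hF, mul_zero, zero_sub,
      neg_eq_zero, ← Polynomial.aeval_algHom_apply, reesMap, aeval_X,
      ← Polynomial.C_mul_X_eq_monomial, ← Polynomial.comp_eq_aeval] at this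
    exact this
  have hg : g = 0 := by
    ext n
    have := congrArg (fun p => Polynomial.coeff p n) hcomp
    rw [Polynomial.comp_C_mul_X_coeff, mul_comm] at this
    exact ((isWeaklyRegular_triple_iff.mp hj).1.pow n).right_eq_zero_of_smul this
  rw [hg, map_zero, sub_zero] at h
  exact mem_of_isSMulRegular_quotient_of_smul_mem ((isSMulRegular_relIdeal_C hj).pow N) h

lemma isSMulRegular_relIdeal_X_zero (hj : IsWeaklyRegular R [j 0, j 1, j 2]) :
    IsSMulRegular (MvPolynomial (Fin 3) R ⧸ relIdeal j) (X 0 : MvPolynomial (Fin 3) R) := by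
  rw [← ker_reesMap hj]
  refine isSMulRegular_quotient_ker (π := (reesMap j : MvPolynomial (Fin 3) R →+* Polynomial R))
    (Polynomial.mem_nonZeroDivisors_iff.mpr fun r hr => ?_)
  have hr : j 0 * r = 0 := by simpa [reesMap, Polynomial.smul_monomial, mul_comm] using hr
  exact (isWeaklyRegular_triple_iff.mp hj).1.right_eq_zero_of_smul hr

section ProjectiveDimension

variable [IsDomain R]

lemma ne_zero_of_isWeaklyRegular_triple (hj : IsWeaklyRegular R [j 0, j 1, j 2]) : j 0 ≠ 0 :=
  fun h => IsSMulRegular.not_zero (M := R) (h ▸ (isWeaklyRegular_triple_iff.mp hj).1)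

lemma isUnit_of_dvd_of_isWeaklyRegular (hj : IsWeaklyRegular R [j 0, j 1, j 2]) {d : R}
    (h₀ : d ∣ j 0) (h₁ : d ∣ j 1) : IsUnit d := by
  obtain ⟨e, he⟩ := h₀
  obtain ⟨e', he'⟩ := h₁
  have hmul : j 1 * e ∈ Ideal.span {j 0} :=
    Ideal.mem_span_singleton.mpr ⟨e', by rw [he, he']; ring⟩
  obtain ⟨c, hc⟩ := Ideal.mem_span_singleton.mp
    (isSMulRegular_quotient_iff.mp (isWeaklyRegular_triple_iff.mp hj).2.1 e hmul)
  refine IsUnit.of_mul_eq_one c (mul_left_cancel₀ (ne_zero_of_isWeaklyRegular_triple hj) ?_)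
  linear_combination d * hc.symm - he

lemma irreducible_cross_C_X_two (hj : IsWeaklyRegular R [j 0, j 1, j 2]) :
    Irreducible (((C ∘ j) ⨯₃ (X : Fin 3 → MvPolynomial (Fin 3) R)) 2) := by
  rw [cross_C_X_two]
  set D : MvPolynomial (Fin 3) R := C (j 0) * X 1 - C (j 1) * X 0 with hD
  have h₀ : D.coeff (Finsupp.single 1 1) = j 0 := by
    simp [hD, coeff_C_mul, coeff_X, Finsupp.single_left_inj]
  have h₁ : D.coeff (Finsupp.single 0 1) = -j 1 := by
    simp [hD, coeff_C_mul, coeff_X, Finsupp.single_left_inj]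
  refine irreducible_of_totalDegree_eq_one (le_antisymm ?_ ?_) fun d hd => ?_
  · refine (totalDegree_sub _ _).trans (max_le ?_ ?_) <;>
      exact (totalDegree_mul _ _).trans (by simp)
  · have hmem : Finsupp.single 1 1 ∈ D.support :=
      mem_support_iff.mpr (h₀ ▸ ne_zero_of_isWeaklyRegular_triple hj)
    simpa using le_totalDegree hmem
  · exact isUnit_of_dvd_of_isWeaklyRegular hj (h₀ ▸ hd _) (dvd_neg.mp (h₁ ▸ hd _))

lemma projDimLE_quotient_relIdeal [UniqueFactorizationMonoid R]
    (hj : IsWeaklyRegular R [j 0, j 1, j 2]) (hj₂ : j 2 ≠ 0) :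
    ProjDimLE (MvPolynomial (Fin 3) R) (MvPolynomial (Fin 3) R ⧸ relIdeal j) 2 := by
  have hirr := irreducible_cross_C_X_two hj
  have hD : IsSMulRegular (MvPolynomial (Fin 3) R) (((C ∘ j) ⨯₃ X) 2) :=
    IsSMulRegular.of_ne_zero hirr.ne_zero
  refine projDimLE_quotient_minorIdeal (cross_mem_minorIdeal 2) hD
    (minorSyzygies_of_isSMulRegular (cross_mem_minorIdeal 2) (cross_mem_minorIdeal 1)
      (isSMulRegular_quotient_bot_iff.mpr hD) ?_)
  rw [bot_sup_eq, isSMulRegular_quotient_iff]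
  intro p hp
  rw [Ideal.mem_span_singleton] at hp ⊢
  refine (hirr.prime.dvd_or_dvd hp).resolve_left fun h => ?_
  have heval := map_dvd (eval ![j 0, j 1, 0]) h
  simp [cross_apply, mul_comm (j 1), ne_zero_of_isWeaklyRegular_triple hj, hj₂] at heval

end ProjectiveDimension

lemma minorSyzygies_ker_bind₁ (hj : IsWeaklyRegular R [j 0, j 1, j 2])
    {v : Fin 3 → MvPolynomial (Fin 3) R} (hv : ∀ i, bind₁ v (v i) = v i)
    (hv₀ : v 0 = 0) (hv₁ : v 1 = C (j 0))
    (hv₂ : IsSMulRegular (MvPolynomial (Fin 3) R ⧸ (Ideal.span {j 0}).map C)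
      (C (j 1) * v 2 - C (j 2 * j 0))) :
    MinorSyzygies (RingHom.ker (bind₁ v)) (C ∘ j) X := by
  have hcongr : ((C ∘ j) ⨯₃ X) 2 - C (j 0) ^ 2 ∈ RingHom.ker (bind₁ v) := by
    rw [RingHom.mem_ker, cross_C_X_two]
    simp [sq, hv₀, hv₁]
  have hC : IsSMulRegular (MvPolynomial (Fin 3) R ⧸ RingHom.ker (bind₁ v))
      (C (j 0) : MvPolynomial (Fin 3) R) :=
    isSMulRegular_ker_bind₁ hv
      (by rw [bind₁_C_right]; exact isSMulRegular_C (isWeaklyRegular_triple_iff.mp hj).1)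
  refine minorSyzygies_of_isSMulRegular (cross_mem_minorIdeal 2) (cross_mem_minorIdeal 0) ?_ ?_
  · exact isSMulRegular_quotient_congr (hC.pow 2)
      (by rw [← neg_sub]; exact Ideal.neg_mem_iff _ |>.mpr hcongr)
  · rw [sup_span_singleton_congr hcongr]
    refine isSMulRegular_quotient_sup_span_pow hC ?_ 2
    rw [← map_C_span_singleton, sup_comm]
    refine isSMulRegular_map_C_sup_ker_bind₁ hv ?_
    rw [cross_C_X_zero]
    simpa [hv₁] using hv₂

lemma isSMulRegular_relIdeal_X_one (hj : IsWeaklyRegular R [j 0, j 1, j 2]) :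
    IsSMulRegular (MvPolynomial (Fin 3) R ⧸ (relIdeal j ⊔ Ideal.span {X 0}))
      (X 1 - C (j 0) : MvPolynomial (Fin 3) R) := by
  obtain ⟨v, hv₁, -, hv, hker⟩ := exists_ker_bind₁_eq_span_X_zero R
  obtain ⟨v', hv'₀, hv'₁, hv'₂, hv', hker'⟩ := exists_ker_bind₁_eq_span_X_zero_X_one (j 0)
  rw [sup_comm]
  refine isSMulRegular_quotient_sup_minorIdeal
    (hker ▸ isSMulRegular_ker_bind₁_X_sub_C hv hv₁ (j 0))
    (hker' ▸ minorSyzygies_ker_bind₁ hj hv' hv'₀ hv'₁ ?_)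
  rw [hv'₂]
  exact isSMulRegular_map_C_mul_X_sub (isWeaklyRegular_triple_iff.mp hj).2.1 (degreeOf_C _ _)

lemma isSMulRegular_relIdeal_X_two (hj : IsWeaklyRegular R [j 0, j 1, j 2]) :
    IsSMulRegular (MvPolynomial (Fin 3) R ⧸ (relIdeal j ⊔ Ideal.span {X 0} ⊔
      Ideal.span {X 1 - C (j 0)})) (X 2 - C (j 1) : MvPolynomial (Fin 3) R) := by
  obtain ⟨v, -, -, hv₂, hv, hker⟩ := exists_ker_bind₁_eq_span_X_zero_X_one (j 0)
  obtain ⟨v', hv'₀, hv'₁, hv'₂, hv', hker'⟩ :=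
    exists_ker_bind₁_eq_span_X_zero_X_one_X_two (j 0) (j 1)
  rw [sup_assoc, sup_comm]
  refine isSMulRegular_quotient_sup_minorIdeal
    (hker ▸ isSMulRegular_ker_bind₁_X_sub_C hv hv₂ (j 1))
    (hker' ▸ minorSyzygies_ker_bind₁ hj hv' hv'₀ hv'₁ ?_)
  have h₁ := (isWeaklyRegular_triple_iff.mp hj).2.1
  have hsq : IsSMulRegular (R ⧸ Ideal.span {j 0}) (j 1 * j 1 - j 2 * j 0) :=
    isSMulRegular_quotient_congr (h₁.mul h₁)
      (by rw [sub_sub_cancel]; exact Ideal.mul_mem_left _ _ (Ideal.mem_span_singleton_self _))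
  simpa [hv'₂] using isSMulRegular_map_C (σ := Fin 3) hsq

theorem isWeaklyRegular_quotient_relIdeal (hj : IsWeaklyRegular R [j 0, j 1, j 2]) :
    IsWeaklyRegular (MvPolynomial (Fin 3) R ⧸ relIdeal j)
      ([X 0, X 1 - C (j 0), X 2 - C (j 1)] : List (MvPolynomial (Fin 3) R)) :=
  isWeaklyRegular_quotient_triple_iff.mpr ⟨isSMulRegular_relIdeal_X_zero hj,
    isSMulRegular_relIdeal_X_one hj, isSMulRegular_relIdeal_X_two hj⟩

end LinearType

end RegularSequence

/-! ### Adjoining one generator to an ideal of linear type -/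

section Extension

open RingTheory.Sequence

universe q

variable {R : Type q} [CommRing R] {j : Fin 3 → R} {h : R}

/-- The map `R[X 0, X 1, X 2][X] → R[T]`, `X i ↦ j i T`, `X ↦ h T`, whose image is the Rees algebra
of the ideal `(j 0, j 1, j 2, h)`. -/
noncomputable def extReesMap (j : Fin 3 → R) (h : R) :
    Polynomial (MvPolynomial (Fin 3) R) →ₐ[R] Polynomial R :=
  Polynomial.eval₂AlgHom (reesMap j) (Polynomial.monomial 1 h) fun _ => Commute.all _ _

lemma extReesMap_C (p : MvPolynomial (Fin 3) R) :
    extReesMap j h (Polynomial.C p) = reesMap j p :=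
  Polynomial.eval₂_C _ _

lemma extReesMap_X : extReesMap j h Polynomial.X = Polynomial.monomial 1 h :=
  Polynomial.eval₂_X _ _

lemma coeff_zero_reesMap (p : MvPolynomial (Fin 3) R) :
    (reesMap j p).coeff 0 = constantCoeff p := by
  have hcomp : (Polynomial.constantCoeff (R := R)).comp (reesMap j).toRingHom =
      constantCoeff := by
    ext i <;> simp [reesMap, Polynomial.coeff_monomial]
  exact RingHom.congr_fun hcomp p

lemma sum_C_mul_mem_map_C (c : Fin 3 → MvPolynomial (Fin 3) R) :
    ∑ i, C (j i) * c i ∈ (Ideal.span (Set.range j)).map C :=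
  sum_mem fun i _ => Ideal.mul_mem_right _ _
    (Ideal.mem_map_of_mem _ (Ideal.subset_span (Set.mem_range_self i)))

lemma relIdeal_le_map_C (j : Fin 3 → R) : relIdeal j ≤ (Ideal.span (Set.range j)).map C := by
  have hj : ∀ i p, C (j i) * p ∈ (Ideal.span (Set.range j)).map
      (C : R →+* MvPolynomial (Fin 3) R) := fun i p =>
    Ideal.mul_mem_right _ _ (Ideal.mem_map_of_mem _ (Ideal.subset_span (Set.mem_range_self i)))
  rw [relIdeal, minorIdeal, Ideal.span_le]
  rintro _ ⟨i, rfl⟩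
  fin_cases i <;> exact sub_mem (hj _ _) (hj _ _)

lemma exists_sum_mul_X_of_constantCoeff_eq_zero {p : MvPolynomial (Fin 3) R}
    (hp : constantCoeff p = 0) : ∃ c : Fin 3 → MvPolynomial (Fin 3) R, ∑ i, c i * X i = p := by
  rw [← Ideal.mem_span_range_iff_exists_fun, ← pow_one (Ideal.span _), mem_pow_idealOfVars_iff']
  intro m hm
  rwa [(Finsupp.degree_eq_zero_iff m).mp (Nat.lt_one_iff.mp hm)]

/-- Comparing the coefficients of `T` turns a relation between `h` and the `j i` in `R[T]` into a
relation in `R[X 0, X 1, X 2]`, up to an element of `relIdeal j`. -/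
lemma mem_map_C_colon_of_reesMap_mul_eq (hj : IsWeaklyRegular R [j 0, j 1, j 2])
    {p p₀ : MvPolynomial (Fin 3) R}
    (hp : reesMap j p * Polynomial.monomial 1 h = reesMap j p₀) :
    p ∈ ((Ideal.span (Set.range j)).colon {h}).map C := by
  have h₀ : constantCoeff p₀ = 0 := by
    rw [← coeff_zero_reesMap (j := j), ← hp, ← Polynomial.C_mul_X_eq_monomial, ← mul_assoc,
      Polynomial.coeff_mul_X_zero]
  obtain ⟨c, rfl⟩ := exists_sum_mul_X_of_constantCoeff_eq_zero h₀
  have hker : C h * p - ∑ i, C (j i) * c i ∈ RingHom.ker (reesMap j) := by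
    have hC : ∀ r, reesMap j (C r) = Polynomial.C r := fun r => by simp [reesMap]
    have hX : ∀ i, reesMap j (X i) = Polynomial.C (j i) * Polynomial.X := fun i => by
      simp [reesMap, Polynomial.C_mul_X_eq_monomial]
    rw [RingHom.mem_ker, map_sub, sub_eq_zero]
    refine Polynomial.isRegular_X.right ?_
    beta_reduce
    simp only [map_mul, map_sum, hX, hC, ← Polynomial.C_mul_X_eq_monomial] at hp ⊢
    rw [mul_right_comm, mul_comm, hp, Finset.sum_mul]
    exact Finset.sum_congr rfl fun i _ => by ring
  rw [ker_reesMap hj] at hker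
  have hmem : C h * p ∈ (Ideal.span (Set.range j)).map (C : R →+* MvPolynomial (Fin 3) R) := by
    simpa using add_mem (relIdeal_le_map_C j hker) (sum_C_mul_mem_map_C c)
  rw [mem_map_C_iff] at hmem ⊢
  intro m
  rw [Submodule.mem_colon_singleton, smul_eq_mul, mul_comm, ← coeff_C_mul]
  exact hmem m

variable {F : Polynomial (MvPolynomial (Fin 3) R)}

lemma mem_of_quadratic_mem {A : Type*} [CommRing A] {K : Ideal A} {F : Polynomial A}
    (hF : F.Monic) (hdeg : F.natDegree = 3) {p₀ p₁ p₂ : A}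
    (hp : Polynomial.C p₂ * Polynomial.X ^ 2 - Polynomial.C p₁ * Polynomial.X - Polynomial.C p₀ ∈
      K.map Polynomial.C ⊔ Ideal.span {F}) : p₂ ∈ K := by
  by_contra hp₂
  have : Nontrivial (A ⧸ K) :=
    Ideal.Quotient.nontrivial_iff.mpr fun hK => hp₂ (hK ▸ Submodule.mem_top)
  let π := Polynomial.mapRingHom (Ideal.Quotient.mk K)
  have hdvd : π F ∣ π (Polynomial.C p₂ * Polynomial.X ^ 2 - Polynomial.C p₁ * Polynomial.X -
      Polynomial.C p₀) := by
    have hmem := Ideal.mem_map_of_mem π hp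
    have hbot : (K.map Polynomial.C).map π = ⊥ := by
      rw [Ideal.map_eq_bot_iff_le_ker, Polynomial.ker_mapRingHom, Ideal.mk_ker]
    rwa [Ideal.map_sup, hbot, bot_sup_eq, Ideal.map_span, Set.image_singleton,
      Ideal.mem_span_singleton] at hmem
  refine (hF.map (Ideal.Quotient.mk K)).not_dvd_of_natDegree_lt ?_ ?_ hdvd
  · intro hzero
    have hcoeff := congrArg (fun f => Polynomial.coeff f 2) hzero
    exact hp₂ (by simpa [π, Ideal.Quotient.eq_zero_iff_mem] using hcoeff)
  · rw [hF.natDegree_map, hdeg, Nat.lt_succ_iff]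
    simp only [π, map_sub, map_mul, map_pow, Polynomial.coe_mapRingHom, Polynomial.map_C,
      Polynomial.map_X]
    compute_degree

lemma smul_mk_ker (p : MvPolynomial (Fin 3) R) (f : Polynomial (MvPolynomial (Fin 3) R)) :
    p • Ideal.Quotient.mk (RingHom.ker (extReesMap j h)) f =
      Ideal.Quotient.mk (RingHom.ker (extReesMap j h)) (Polynomial.C p * f) := by
  rw [← Polynomial.smul_eq_C_mul]
  rfl

lemma mk_ker_eq_iff {f g : Polynomial (MvPolynomial (Fin 3) R)} :
    Ideal.Quotient.mk (RingHom.ker (extReesMap j h)) f =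
      Ideal.Quotient.mk (RingHom.ker (extReesMap j h)) g ↔
        extReesMap j h f = extReesMap j h g := by
  rw [Ideal.Quotient.eq, RingHom.sub_mem_ker_iff]

lemma map_C_le_comap_toSpanSingleton {M : Type*} [AddCommGroup M]
    [Module (MvPolynomial (Fin 3) R) M] {N : Submodule (MvPolynomial (Fin 3) R) M} {m : M}
    {s : Set R} (hs : ∀ r ∈ s, (C r : MvPolynomial (Fin 3) R) • m ∈ N) :
    (Ideal.span s).map C ≤ N.comap (LinearMap.toSpanSingleton _ _ m) := by
  rw [Ideal.map_span, Ideal.span_le]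
  rintro _ ⟨r, hr, rfl⟩
  exact hs r hr

variable (j h) in
/-- The residue classes of `1, X, X²` in `R[X 0, X 1, X 2][X] ⧸ ker (extReesMap j h)`. -/
noncomputable abbrev extReesGen (i : Fin 3) :
    Polynomial (MvPolynomial (Fin 3) R) ⧸ RingHom.ker (extReesMap j h) :=
  Ideal.Quotient.mk _ (Polynomial.X ^ (i : ℕ))

lemma span_range_extReesGen (hF : F.Monic) (hdeg : F.natDegree = 3) (hF₀ : extReesMap j h F = 0) :
    Submodule.span (MvPolynomial (Fin 3) R) (Set.range (extReesGen j h)) = ⊤ := by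
  refine eq_top_iff.mpr fun m _ => ?_
  obtain ⟨f, rfl⟩ := Ideal.Quotient.mk_surjective m
  have hlt : (f %ₘ F).natDegree < 3 :=
    (Polynomial.natDegree_modByMonic_lt f hF (by rintro rfl; simp at hdeg)).trans_eq hdeg
  have hmod : Ideal.Quotient.mk (RingHom.ker (extReesMap j h)) f =
      Ideal.Quotient.mk (RingHom.ker (extReesMap j h)) (f %ₘ F) := by
    rw [mk_ker_eq_iff]
    conv_lhs => rw [← Polynomial.modByMonic_add_div f F]
    rw [map_add, map_mul, hF₀, zero_mul, add_zero]
  rw [hmod, Polynomial.as_sum_range_C_mul_X_pow' _ hlt, map_sum, Finset.sum_range]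
  refine sum_mem fun i _ => ?_
  rw [← smul_mk_ker]
  exact Submodule.smul_mem _ _ (Submodule.subset_span (Set.mem_range_self i))

lemma smul_extReesGen_zero_mem_iff (hj : IsWeaklyRegular R [j 0, j 1, j 2])
    (p : MvPolynomial (Fin 3) R) :
    p • extReesGen j h 0 ∈ Submodule.span (MvPolynomial (Fin 3) R) (extReesGen j h '' ∅) ↔
      p ∈ relIdeal j := by
  rw [Set.image_empty, Submodule.span_empty, Submodule.mem_bot, extReesGen, Fin.val_zero, pow_zero,
    smul_mk_ker, mul_one, Ideal.Quotient.eq_zero_iff_mem, RingHom.mem_ker, extReesMap_C,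
    ← ker_reesMap hj, RingHom.mem_ker]

lemma smul_extReesGen_one_mem_iff (hj : IsWeaklyRegular R [j 0, j 1, j 2])
    (p : MvPolynomial (Fin 3) R) :
    p • extReesGen j h 1 ∈ Submodule.span (MvPolynomial (Fin 3) R) (extReesGen j h '' {0}) ↔
      p ∈ ((Ideal.span (Set.range j)).colon {h}).map C := by
  have hmem : ∀ p, p • extReesGen j h 1 ∈
      Submodule.span (MvPolynomial (Fin 3) R) (extReesGen j h '' {0}) ↔
        ∃ p₀, reesMap j p₀ = reesMap j p * Polynomial.monomial 1 h := fun p => by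
    simp only [Set.image_singleton, Submodule.mem_span_singleton, smul_mk_ker, mk_ker_eq_iff]
    simp [extReesMap_C, extReesMap_X]
  refine ⟨fun hp => ?_, fun hp => ?_⟩
  · obtain ⟨p₀, hp₀⟩ := (hmem p).mp hp
    exact mem_map_C_colon_of_reesMap_mul_eq hj hp₀.symm
  · rw [← Ideal.span_eq ((Ideal.span (Set.range j)).colon {h})] at hp
    refine map_C_le_comap_toSpanSingleton (fun r hr => (hmem _).mpr ?_) hp
    obtain ⟨c, hc⟩ := Ideal.mem_span_range_iff_exists_fun.mp (Submodule.mem_colon_singleton.mp hr)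
    refine ⟨∑ i, C (c i) * X i, ?_⟩
    rw [smul_eq_mul] at hc
    simp [reesMap, ← hc, Polynomial.C_mul_monomial]

lemma smul_extReesGen_two_mem_iff (hF : F.Monic) (hdeg : F.natDegree = 3) {s : Set R}
    (hs : ∀ r ∈ s, ∃ p₀ p₁, Polynomial.C r * Polynomial.monomial 1 h ^ 2 =
      reesMap j p₀ + reesMap j p₁ * Polynomial.monomial 1 h)
    (hker : RingHom.ker (extReesMap j h) ≤
      ((Ideal.span s).map C).map Polynomial.C ⊔ Ideal.span {F}) (p : MvPolynomial (Fin 3) R) :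
    p • extReesGen j h 2 ∈ Submodule.span (MvPolynomial (Fin 3) R) (extReesGen j h '' {0, 1}) ↔
      p ∈ (Ideal.span s).map C := by
  have hmem : ∀ p, p • extReesGen j h 2 ∈
      Submodule.span (MvPolynomial (Fin 3) R) (extReesGen j h '' {0, 1}) ↔
        ∃ p₀ p₁, reesMap j p₀ + reesMap j p₁ * Polynomial.monomial 1 h =
          reesMap j p * Polynomial.monomial 1 h ^ 2 := fun p => by
    simp only [Set.image_pair, Submodule.mem_span_pair, extReesGen, smul_mk_ker, ← map_add,
      mk_ker_eq_iff]
    simp [extReesMap_C, extReesMap_X]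
  refine ⟨fun hp => ?_, fun hp => ?_⟩
  · obtain ⟨p₀, p₁, hp⟩ := (hmem p).mp hp
    refine mem_of_quadratic_mem hF hdeg (p₀ := p₀) (p₁ := p₁) (hker ?_)
    rw [RingHom.mem_ker, map_sub, map_sub]
    simp only [map_mul, map_pow, extReesMap_C, extReesMap_X, ← hp]
    ring
  · refine map_C_le_comap_toSpanSingleton (fun r hr => (hmem _).mpr ?_) hp
    obtain ⟨p₀, p₁, hp⟩ := hs r hr
    exact ⟨p₀, p₁, by simpa [reesMap] using hp.symm⟩

/-- The Rees algebra of `(j 0, j 1, j 2, h)` is generated as a module over the polynomial ring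
`R[X 0, X 1, X 2]` by `1, h T, (h T) ^ 2`. -/
lemma cyclicFiltration_extReesGen (hj : IsWeaklyRegular R [j 0, j 1, j 2])
    (hF : F.Monic) (hdeg : F.natDegree = 3) (hF₀ : extReesMap j h F = 0) {s : Set R}
    (hs : ∀ r ∈ s, ∃ p₀ p₁, Polynomial.C r * Polynomial.monomial 1 h ^ 2 =
      reesMap j p₀ + reesMap j p₁ * Polynomial.monomial 1 h)
    (hker : RingHom.ker (extReesMap j h) ≤
      ((Ideal.span s).map C).map Polynomial.C ⊔ Ideal.span {F}) :
    CyclicFiltration (extReesGen j h)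
      ![relIdeal j, ((Ideal.span (Set.range j)).colon {h}).map C, (Ideal.span s).map C] where
  span_range := span_range_extReesGen hF hdeg hF₀
  smul_mem_iff i := by
    have h₀ : Set.Iio (0 : Fin 3) = ∅ := by ext i; fin_cases i <;> simp
    have h₁ : Set.Iio (1 : Fin 3) = {0} := by ext i; fin_cases i <;> simp
    have h₂ : Set.Iio (2 : Fin 3) = {0, 1} := by ext i; fin_cases i <;> simp
    fin_cases i
    · exact h₀ ▸ smul_extReesGen_zero_mem_iff hj
    · exact h₁ ▸ smul_extReesGen_one_mem_iff hj
    · exact h₂ ▸ smul_extReesGen_two_mem_iff hF hdeg hs hker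

lemma projDimLE_quotient_map_C {K : Ideal R} {n : ℕ} (hK : ProjDimLE R (R ⧸ K) n) :
    ProjDimLE (MvPolynomial (Fin 3) R) (MvPolynomial (Fin 3) R ⧸ K.map C) n :=
  (hK.baseChange (MvPolynomial (Fin 3) R)).of_linearEquiv (Ideal.qoutMapEquivTensorQout _).symm

lemma isWeaklyRegular_quotient_map_C (K : Ideal R) (r s : R) :
    IsWeaklyRegular (MvPolynomial (Fin 3) R ⧸ K.map C)
      ([X 0, X 1 - C r, X 2 - C s] : List (MvPolynomial (Fin 3) R)) := by
  obtain ⟨v, hv₁, -, hv, hker⟩ := exists_ker_bind₁_eq_span_X_zero R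
  obtain ⟨v', -, -, hv'₂, hv', hker'⟩ := exists_ker_bind₁_eq_span_X_zero_X_one r
  refine isWeaklyRegular_quotient_triple_iff.mpr ⟨?_, ?_, ?_⟩
  · simpa using isSMulRegular_map_C_X_sub_C K (0 : Fin 3) 0
  · rw [← hker]
    refine isSMulRegular_map_C_sup_ker_bind₁ hv ?_
    simpa [hv₁] using isSMulRegular_map_C_X_sub_C K (1 : Fin 3) r
  · rw [sup_assoc, ← hker']
    refine isSMulRegular_map_C_sup_ker_bind₁ hv' ?_
    simpa [hv'₂] using isSMulRegular_map_C_X_sub_C K (2 : Fin 3) s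

variable {K₁ K₂ : Ideal R}

theorem projDimLE_quotient_ker_extReesMap [IsDomain R] [UniqueFactorizationMonoid R]
    (hR : ∀ K : Ideal R, ProjDimLE R (R ⧸ K) 3) (hj : IsWeaklyRegular R [j 0, j 1, j 2])
    (hj₂ : j 2 ≠ 0)
    (hfil : CyclicFiltration (extReesGen j h) ![relIdeal j, K₁.map C, K₂.map C]) :
    ProjDimLE (Polynomial (MvPolynomial (Fin 3) R))
      (Polynomial (MvPolynomial (Fin 3) R) ⧸ RingHom.ker (extReesMap j h)) 4 := by
  refine ProjDimLE.polynomial (hfil.projDimLE fun i => ?_)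
  fin_cases i
  · exact (projDimLE_quotient_relIdeal hj hj₂).mono (by norm_num)
  · exact projDimLE_quotient_map_C (hR K₁)
  · exact projDimLE_quotient_map_C (hR K₂)

theorem isWeaklyRegular_quotient_ker_extReesMap (hj : IsWeaklyRegular R [j 0, j 1, j 2])
    (hfil : CyclicFiltration (extReesGen j h) ![relIdeal j, K₁.map C, K₂.map C]) :
    IsWeaklyRegular (Polynomial (MvPolynomial (Fin 3) R) ⧸ RingHom.ker (extReesMap j h))
      ([X 0, X 1 - C (j 0), X 2 - C (j 1)] : List (MvPolynomial (Fin 3) R)) := by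
  refine hfil.isWeaklyRegular fun i => ?_
  fin_cases i
  · exact isWeaklyRegular_quotient_relIdeal hj
  · exact isWeaklyRegular_quotient_map_C K₁ _ _
  · exact isWeaklyRegular_quotient_map_C K₂ _ _

end Extension

/-! ### The toric ideal of the monomial generators -/

section Toric

variable {Q Q' : Type*} [CommRing Q] [CommRing Q'] {b d : ℕ}

/-- Exponents of monomials in `x₀, x₁, x₂`, `t₀, t₁, t₂` and `w`, in this order. -/
abbrev ToricExp : Type := (Fin 3 → ℕ) × (Fin 3 → ℕ) × ℕ

/-- The value of a monomial at given elements of a ring. -/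
def toricMonomial (x t : Fin 3 → Q) (w : Q) (m : ToricExp) : Q :=
  (∏ c, x c ^ m.1 c) * (∏ c, t c ^ m.2.1 c) * w ^ m.2.2

/-- The exponents of `x₀, x₁, x₂` and of `T` in the image of a monomial under
`t_c ↦ x_c ^ (2b + d) T`, `w ↦ (x₀ x₁ x₂) ^ b T`. -/
def toricWeight (b d : ℕ) (m : ToricExp) : (Fin 3 → ℕ) × ℕ :=
  (fun c => m.1 c + (2 * b + d) * m.2.1 c + b * m.2.2, ∑ c, m.2.1 c + m.2.2)

lemma toricMonomial_add (x t : Fin 3 → Q) (w : Q) (m m' : ToricExp) :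
    toricMonomial x t w (m + m') = toricMonomial x t w m * toricMonomial x t w m' := by
  simp only [toricMonomial, Prod.fst_add, Prod.snd_add, Pi.add_apply, pow_add,
    Finset.prod_mul_distrib]
  ring

lemma map_toricMonomial (φ : Q →+* Q') (x t : Fin 3 → Q) (w : Q) (m : ToricExp) :
    φ (toricMonomial x t w m) = toricMonomial (φ ∘ x) (φ ∘ t) (φ w) m := by
  simp only [toricMonomial, map_mul, map_prod, map_pow, Function.comp_apply]

lemma toricWeight_add (m m' : ToricExp) :
    toricWeight b d (m + m') = toricWeight b d m + toricWeight b d m' := by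
  ext
  · simp only [toricWeight, Prod.fst_add, Prod.snd_add, Pi.add_apply]
    ring
  · simp only [toricWeight, Prod.snd_add, Prod.fst_add, Pi.add_apply, Finset.sum_add_distrib]
    ring

/-- The relations `fᵢ = gᵢ = Hᵢ = 0` for `a = 2b + d`, together with `E = 0` if `d ≤ b` or `E' = 0`
if `b ≤ d`. The indices `c, c + 1, c + 2` are cyclic, and subtractions of exponents are avoided by
means of `e = |b - d|`. -/
structure ToricRel (b d : ℕ) (x t : Fin 3 → Q) (w : Q) : Prop where
  f : ∀ c c', x c ^ (2 * b + d) * t c' = x c' ^ (2 * b + d) * t c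
  g : ∀ c, x c ^ (b + d) * w = (x (c + 1) * x (c + 2)) ^ b * t c
  H : ∀ c, (x (c + 1) * x (c + 2)) ^ d * w ^ 2 = x c ^ (2 * b) * (t (c + 1) * t (c + 2))
  E : (∃ e, b = d + e ∧ w ^ 3 = (∏ c, x c) ^ e * ∏ c, t c) ∨
    ∃ e, d = b + e ∧ (∏ c, x c) ^ e * w ^ 3 = ∏ c, t c

/-- Monomials of the same image whose values at `x`, `t`, `w` agree. -/
def ToricEq (b d : ℕ) (x t : Fin 3 → Q) (w : Q) (m m' : ToricExp) : Prop :=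
  toricWeight b d m = toricWeight b d m' ∧ toricMonomial x t w m = toricMonomial x t w m'

variable {x t : Fin 3 → Q} {w : Q} {m m' p q : ToricExp}

lemma ToricEq.exists_of_le (h : ToricEq b d x t w p q) (hp : p ≤ m) :
    ∃ m', ToricEq b d x t w m m' ∧ q ≤ m' := by
  obtain ⟨r, rfl⟩ := exists_add_of_le hp
  exact ⟨q + r, ⟨by rw [toricWeight_add, toricWeight_add, h.1],
    by rw [toricMonomial_add, toricMonomial_add, h.2]⟩, le_self_add⟩

lemma ToricRel.toricEq_f (h : ToricRel b d x t w) {c c' : Fin 3} (hc : c ≠ c') :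
    ToricEq b d x t w (Pi.single c (2 * b + d), Pi.single c' 1, 0)
      (Pi.single c' (2 * b + d), Pi.single c 1, 0) := by
  have := h.f c c'
  constructor
  · ext i
    · fin_cases c <;> fin_cases c' <;> fin_cases i <;> simp_all [toricWeight]
    · simp [toricWeight]
  · fin_cases c <;> fin_cases c' <;> simp_all [toricMonomial, Fin.prod_univ_three]

lemma ToricRel.toricEq_g (h : ToricRel b d x t w) (c : Fin 3) :
    ToricEq b d x t w (Pi.single (c + 1) b + Pi.single (c + 2) b, Pi.single c 1, 0)
      (Pi.single c (b + d), 0, 1) := by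
  have := h.g c
  constructor
  · ext i
    · fin_cases c <;> fin_cases i <;> simp [toricWeight] <;> ring
    · simp [toricWeight]
  · fin_cases c <;> simp_all [toricMonomial, Fin.prod_univ_three] <;> ring

lemma ToricRel.toricEq_H (h : ToricRel b d x t w) (c : Fin 3) :
    ToricEq b d x t w (Pi.single c (2 * b), Pi.single (c + 1) 1 + Pi.single (c + 2) 1, 0)
      (Pi.single (c + 1) d + Pi.single (c + 2) d, 0, 2) := by
  have := h.H c
  constructor
  · ext i
    · fin_cases c <;> fin_cases i <;> simp [toricWeight] <;> ring
    · fin_cases c <;> simp [toricWeight, Fin.sum_univ_three]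
  · fin_cases c <;> simp_all [toricMonomial, Fin.prod_univ_three] <;> linear_combination -this

lemma ToricRel.toricEq_E (h : ToricRel b d x t w) :
    (∃ e, ToricEq b d x t w (0, 0, 3) (fun _ => e, 1, 0)) ∨
      ∃ e, ToricEq b d x t w (0, 1, 0) (fun _ => e, 0, 3) := by
  refine h.E.imp (Exists.imp ?_) (Exists.imp ?_) <;> rintro e ⟨rfl, he⟩ <;>
    refine ⟨Prod.ext (funext fun i => ?_) ?_, ?_⟩ <;>
    simp [toricWeight, toricMonomial, Finset.prod_pow, he] <;> ring

/-- Monomials that can be rewritten by the relations so as to acquire a common divisor of positive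
degree in `T`. -/
def ToricLinked (b d : ℕ) (x t : Fin 3 → Q) (w : Q) (m m' : ToricExp) : Prop :=
  ∃ s m₁ m₁', (toricWeight b d s).2 ≠ 0 ∧ (s ≤ m₁ ∧ s ≤ m₁') ∧
    ToricEq b d x t w m m₁ ∧ ToricEq b d x t w m' m₁'

lemma ToricLinked.symm (h : ToricLinked b d x t w m m') : ToricLinked b d x t w m' m :=
  let ⟨s, m₁, m₁', hs, hle, hm, hm'⟩ := h
  ⟨s, m₁', m₁, hs, hle.symm, hm', hm⟩

lemma toricLinked_of_le {s : ToricExp} (hs : (toricWeight b d s).2 ≠ 0) (hm : s ≤ m)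
    (hm' : s ≤ m') : ToricLinked b d x t w m m' :=
  ⟨s, m, m', hs, ⟨hm, hm'⟩, ⟨rfl, rfl⟩, ⟨rfl, rfl⟩⟩

lemma ToricEq.toricLinked {s : ToricExp} (h : ToricEq b d x t w p q) (hp : p ≤ m')
    (hs : (toricWeight b d s).2 ≠ 0) (hm : s ≤ m) (hq : s ≤ q) : ToricLinked b d x t w m m' :=
  let ⟨m₁', hm₁', hle⟩ := h.exists_of_le hp
  ⟨s, m, m₁', hs, ⟨hm, hq.trans hle⟩, ⟨rfl, rfl⟩, hm₁'⟩

lemma le_exponent_of_toricWeight_eq (hw : toricWeight b d m = toricWeight b d m') {c : Fin 3}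
    (ht : m'.2.1 c = 0) (hl : m'.2.2 = 0) : (2 * b + d) * m.2.1 c + b * m.2.2 ≤ m'.1 c := by
  have := congrFun (congrArg Prod.fst hw) c
  simp only [toricWeight, ht, hl] at this
  omega

lemma single_le_iff {f : Fin 3 → ℕ} {c : Fin 3} {n : ℕ} : Pi.single c n ≤ f ↔ n ≤ f c := by
  rw [Pi.single, update_le_iff]
  exact and_iff_left fun _ _ => zero_le

lemma single_add_single_le_iff {f : Fin 3 → ℕ} (c : Fin 3) {n : ℕ} :
    Pi.single (c + 1) n + Pi.single (c + 2) n ≤ f ↔ n ≤ f (c + 1) ∧ n ≤ f (c + 2) := by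
  fin_cases c <;> simp [Pi.le_def, Fin.forall_fin_succ, and_comm (a := n ≤ f 2)]

lemma ToricRel.toricLinked_of_eq_zero (h : ToricRel b d x t w)
    (hw : toricWeight b d m = toricWeight b d m') (hdeg : (toricWeight b d m).2 ≠ 0)
    (hdisj : ∀ c, m.2.1 c = 0 ∨ m'.2.1 c = 0) (hl : m.2.2 = 0) (hl' : m'.2.2 = 0) :
    ToricLinked b d x t w m m' := by
  have hdeg' : (toricWeight b d m').2 ≠ 0 := hw ▸ hdeg
  simp only [toricWeight, hl, hl', add_zero, ne_eq, Finset.sum_eq_zero_iff, Finset.mem_univ,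
    true_implies, not_forall] at hdeg hdeg'
  obtain ⟨c, hc⟩ := hdeg
  obtain ⟨c', hc'⟩ := hdeg'
  have hm'c : m'.2.1 c = 0 := (hdisj c).resolve_left hc
  have hne : c ≠ c' := fun hcc => hc' (hcc ▸ hm'c)
  have hpow : 2 * b + d ≤ m'.1 c :=
    (Nat.le_mul_of_pos_right _ (Nat.pos_of_ne_zero hc)).trans
      ((Nat.le_add_right _ _).trans (le_exponent_of_toricWeight_eq hw hm'c hl'))
  exact (h.toricEq_f hne).toricLinked (s := (0, Pi.single c 1, 0))
    ⟨single_le_iff.mpr hpow, single_le_iff.mpr (Nat.pos_of_ne_zero hc'), zero_le⟩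
    (by simp [toricWeight]) ⟨zero_le, single_le_iff.mpr (Nat.pos_of_ne_zero hc), zero_le⟩
    ⟨zero_le, le_rfl, le_rfl⟩

lemma toricWeight_w_ne_zero : (toricWeight b d (0, 0, 1)).2 ≠ 0 := by
  simp [toricWeight]

lemma w_le_iff : ((0, 0, 1) : ToricExp) ≤ m ↔ 1 ≤ m.2.2 :=
  ⟨fun h => h.2.2, fun h => ⟨zero_le, zero_le, h⟩⟩

lemma sum_fin_three_cyclic (f : Fin 3 → ℕ) (c : Fin 3) :
    ∑ i, f i = f c + (f (c + 1) + f (c + 2)) := by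
  fin_cases c <;> simp [Fin.sum_univ_three] <;> ring

lemma ToricRel.toricLinked_of_one_t (h : ToricRel b d x t w)
    (hw : toricWeight b d m = toricWeight b d m') (hl : m.2.2 ≠ 0) (hl' : m'.2.2 = 0) {c : Fin 3}
    (hc : m'.2.1 c ≠ 0) (hc₁ : m'.2.1 (c + 1) = 0) (hc₂ : m'.2.1 (c + 2) = 0) :
    ToricLinked b d x t w m m' := by
  have hb : b ≤ b * m.2.2 := Nat.le_mul_of_pos_right _ (Nat.pos_of_ne_zero hl)
  have h₁ := le_exponent_of_toricWeight_eq hw hc₁ hl'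
  have h₂ := le_exponent_of_toricWeight_eq hw hc₂ hl'
  exact (h.toricEq_g c).toricLinked
    ⟨(single_add_single_le_iff c).mpr ⟨by omega, by omega⟩,
      single_le_iff.mpr (Nat.pos_of_ne_zero hc), zero_le⟩
    toricWeight_w_ne_zero (w_le_iff.mpr (Nat.pos_of_ne_zero hl)) (w_le_iff.mpr le_rfl)

lemma ToricRel.toricLinked_of_two_t (h : ToricRel b d x t w)
    (hw : toricWeight b d m = toricWeight b d m') (hl : m.2.2 ≠ 0) (hl' : m'.2.2 = 0)
    (hdisj : ∀ c, m.2.1 c = 0 ∨ m'.2.1 c = 0) {c : Fin 3} (hc : m'.2.1 c = 0)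
    (hc₁ : m'.2.1 (c + 1) ≠ 0) (hc₂ : m'.2.1 (c + 2) ≠ 0) : ToricLinked b d x t w m m' := by
  have hT : ∑ i, m.2.1 i + m.2.2 = ∑ i, m'.2.1 i + m'.2.2 := congrArg Prod.snd hw
  rw [sum_fin_three_cyclic _ c, sum_fin_three_cyclic _ c, (hdisj _).resolve_right hc₁,
    (hdisj _).resolve_right hc₂] at hT
  have hpow : 2 * b ≤ m'.1 c := by
    refine le_trans ?_ (le_exponent_of_toricWeight_eq hw hc hl')
    rcases Nat.eq_zero_or_pos (m.2.1 c) with hm | hm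
    · nlinarith [show 2 ≤ m.2.2 by omega]
    · nlinarith [Nat.zero_le (d * m.2.1 c), Nat.zero_le (b * m.2.2)]
  exact (h.toricEq_H c).toricLinked
    ⟨single_le_iff.mpr hpow, (single_add_single_le_iff c).mpr ⟨by omega, by omega⟩, zero_le⟩
    toricWeight_w_ne_zero (w_le_iff.mpr (Nat.pos_of_ne_zero hl)) (w_le_iff.mpr one_le_two)

lemma ToricRel.toricLinked_of_three_t (h : ToricRel b d x t w)
    (hw : toricWeight b d m = toricWeight b d m') (hl : m.2.2 ≠ 0) (hl' : m'.2.2 = 0)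
    (hdisj : ∀ c, m.2.1 c = 0 ∨ m'.2.1 c = 0) (hm' : ∀ c, m'.2.1 c ≠ 0) :
    ToricLinked b d x t w m m' := by
  have ht : (1 : Fin 3 → ℕ) ≤ m'.2.1 := fun c => Nat.pos_of_ne_zero (hm' c)
  have hT : ∑ i, m.2.1 i + m.2.2 = ∑ i, m'.2.1 i + m'.2.2 := congrArg Prod.snd hw
  have hm : ∀ c, m.2.1 c = 0 := fun c => (hdisj c).resolve_right (hm' c)
  have hl₃ : 3 ≤ m.2.2 := by
    simp only [hm, Fin.sum_univ_three] at hT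
    have := ht 0; have := ht 1; have := ht 2
    simp only [Pi.one_apply] at *
    omega
  obtain ⟨e, he⟩ | ⟨e, he⟩ := h.toricEq_E
  · exact (he.toricLinked (s := (0, 1, 0)) ⟨zero_le, zero_le, hl₃⟩ (by simp [toricWeight])
      ⟨zero_le, ht, zero_le⟩ ⟨zero_le, le_rfl, zero_le⟩).symm
  · exact he.toricLinked ⟨zero_le, ht, zero_le⟩ toricWeight_w_ne_zero
      (w_le_iff.mpr (Nat.pos_of_ne_zero hl)) (w_le_iff.mpr (by norm_num))

lemma ToricRel.toricLinked_of_w_ne_zero (h : ToricRel b d x t w)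
    (hw : toricWeight b d m = toricWeight b d m') (hdisj : ∀ c, m.2.1 c = 0 ∨ m'.2.1 c = 0)
    (hl : m.2.2 ≠ 0) (hl' : m'.2.2 = 0) : ToricLinked b d x t w m m' := by
  have hT : ∑ i, m.2.1 i + m.2.2 = ∑ i, m'.2.1 i + m'.2.2 := congrArg Prod.snd hw
  by_cases hall : ∀ c, m'.2.1 c ≠ 0
  · exact h.toricLinked_of_three_t hw hl hl' hdisj hall
  push Not at hall
  obtain ⟨c, hc⟩ := hall
  have h₂₁ : c + 2 + 1 = c := by fin_cases c <;> rfl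
  have h₂₂ : c + 2 + 2 = c + 1 := by fin_cases c <;> rfl
  have h₁₁ : c + 1 + 1 = c + 2 := by fin_cases c <;> rfl
  have h₁₂ : c + 1 + 2 = c := by fin_cases c <;> rfl
  by_cases hc₁ : m'.2.1 (c + 1) = 0 <;> by_cases hc₂ : m'.2.1 (c + 2) = 0
  · rw [sum_fin_three_cyclic m'.2.1 c, hc, hc₁, hc₂, hl'] at hT
    omega
  · exact h.toricLinked_of_one_t hw hl hl' hc₂ (by rwa [h₂₁]) (by rwa [h₂₂])
  · exact h.toricLinked_of_one_t hw hl hl' hc₁ (by rwa [h₁₁]) (by rwa [h₁₂])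
  · exact h.toricLinked_of_two_t hw hl hl' hdisj hc hc₁ hc₂

lemma ToricRel.toricLinked (h : ToricRel b d x t w)
    (hw : toricWeight b d m = toricWeight b d m') (hdeg : (toricWeight b d m).2 ≠ 0) :
    ToricLinked b d x t w m m' := by
  by_cases hdisj : ∀ c, m.2.1 c = 0 ∨ m'.2.1 c = 0
  · by_cases hl : m.2.2 = 0 <;> by_cases hl' : m'.2.2 = 0
    · exact h.toricLinked_of_eq_zero hw hdeg hdisj hl hl'
    · exact (h.toricLinked_of_w_ne_zero hw.symm (fun c => (hdisj c).symm) hl' hl).symm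
    · exact h.toricLinked_of_w_ne_zero hw hdisj hl hl'
    · exact toricLinked_of_le toricWeight_w_ne_zero (w_le_iff.mpr (Nat.pos_of_ne_zero hl))
        (w_le_iff.mpr (Nat.pos_of_ne_zero hl'))
  · push Not at hdisj
    obtain ⟨c, hc, hc'⟩ := hdisj
    exact toricLinked_of_le (s := (0, Pi.single c 1, 0)) (by simp [toricWeight])
      ⟨zero_le, single_le_iff.mpr (Nat.pos_of_ne_zero hc), zero_le⟩
      ⟨zero_le, single_le_iff.mpr (Nat.pos_of_ne_zero hc'), zero_le⟩

lemma toricMonomial_eq_of_degree_eq_zero (hw : toricWeight b d m = toricWeight b d m')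
    (hdeg : (toricWeight b d m).2 = 0) : toricMonomial x t w m = toricMonomial x t w m' := by
  have hdeg' : (toricWeight b d m').2 = 0 := hw ▸ hdeg
  obtain ⟨p, i, l⟩ := m
  obtain ⟨p', i', l'⟩ := m'
  simp only [toricWeight, Nat.add_eq_zero_iff, Finset.sum_eq_zero_iff, Finset.mem_univ,
    true_implies] at hdeg hdeg'
  have hp : p = p' := by simpa [toricWeight, hdeg, hdeg'] using congrArg Prod.fst hw
  have hi : i = i' := funext fun c => (hdeg.1 c).trans (hdeg'.1 c).symm
  rw [hp, hi, hdeg.2, hdeg'.2]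

/-- The relations of `ToricRel` generate the toric ideal: by induction on the degree in `T`, two
monomials with the same image can be rewritten until they share a variable, which is cancelled. -/
theorem ToricRel.toricMonomial_eq (h : ToricRel b d x t w)
    (hw : toricWeight b d m = toricWeight b d m') :
    toricMonomial x t w m = toricMonomial x t w m' := by
  induction hn : (toricWeight b d m).2 using Nat.strong_induction_on generalizing m m' with
  | _ n ih =>
  rcases eq_or_ne n 0 with rfl | hn₀
  · exact toricMonomial_eq_of_degree_eq_zero hw hn
  obtain ⟨s, m₁, m₁', hs, ⟨hm₁, hm₁'⟩, ⟨hw₁, he₁⟩, hw₁', he₁'⟩ := h.toricLinked hw (hn ▸ hn₀)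
  obtain ⟨r, rfl⟩ := exists_add_of_le hm₁
  obtain ⟨r', rfl⟩ := exists_add_of_le hm₁'
  have hr : toricWeight b d r = toricWeight b d r' := by
    rw [hw₁, hw₁', toricWeight_add, toricWeight_add] at hw
    exact add_left_cancel hw
  have hlt : (toricWeight b d r).2 < n := by
    rw [← hn, hw₁, toricWeight_add, Prod.snd_add]
    omega
  rw [he₁, he₁', toricMonomial_add, toricMonomial_add, ih _ hlt hr rfl]

end Toric

/-! ### The equations of the Rees algebra -/

section ReesIdeal

variable {R : Type*} [CommRing R] {ι : Type*}

lemma coe_reesPresentation (f : ι → R) (F : MvPolynomial ι R) :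
    (reesPresentation f F : Polynomial R) = aeval (fun i => Polynomial.monomial 1 (f i)) F := by
  have : (reesAlgebra (Ideal.span (Set.range f))).val.comp (reesPresentation f) =
      aeval (fun i => Polynomial.monomial 1 (f i)) := by
    ext i
    simp [reesPresentation]
  exact congrArg (fun φ => φ F) this

lemma reesIdeal_eq_ker (f : ι → R) :
    reesIdeal f = RingHom.ker (aeval (R := R) fun i => Polynomial.monomial 1 (f i)) := by
  ext F
  rw [reesIdeal, RingHom.mem_ker, RingHom.mem_ker, ← coe_reesPresentation,
    ZeroMemClass.coe_eq_zero]

lemma mem_reesIdeal {f : ι → R} {F : MvPolynomial ι R} :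
    F ∈ reesIdeal f ↔ aeval (fun i => Polynomial.monomial 1 (f i)) F = 0 := by
  rw [reesIdeal_eq_ker, RingHom.mem_ker]

lemma reesPresentation_surjective (f : ι → R) : Function.Surjective (reesPresentation f) := by
  rintro ⟨F, hF⟩
  have hspan : Submodule.map (Polynomial.monomial 1) (Ideal.span (Set.range f)) ≤
      Subalgebra.toSubmodule (aeval (R := R) fun i => Polynomial.monomial 1 (f i)).range := by
    rw [Ideal.span, Submodule.map_span, Submodule.span_le]
    rintro _ ⟨_, ⟨i, rfl⟩, rfl⟩
    exact ⟨X i, by simp⟩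
  rw [← adjoin_monomial_eq_reesAlgebra] at hF
  obtain ⟨G, hG⟩ := Algebra.adjoin_le hspan hF
  exact ⟨G, Subtype.ext (by rw [coe_reesPresentation]; exact hG)⟩

end ReesIdeal

section Monomials

lemma ker_le_ker_of_basis {K ι κ M N Q : Type*} [CommRing K] [AddCommGroup M] [AddCommGroup N]
    [AddCommGroup Q] [Module K M] [Module K N] [Module K Q] (B : Module.Basis ι K M)
    (B' : Module.Basis κ K N) {φ : M →ₗ[K] N} {ψ : M →ₗ[K] Q} {e : ι → κ}
    (he : ∀ i, φ (B i) = B' (e i)) (hψ : ∀ i j, e i = e j → ψ (B i) = ψ (B j)) :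
    LinearMap.ker φ ≤ LinearMap.ker ψ := by
  let θ : N →ₗ[K] Q := B'.constr K (Function.extend e (fun i => ψ (B i)) 0)
  have hfac : Function.FactorsThrough (fun i => ψ (B i)) e := fun i j => hψ i j
  have hθ : θ ∘ₗ φ = ψ := B.ext fun i => by
    rw [LinearMap.comp_apply, he, Module.Basis.constr_basis, hfac.extend_apply]
  rw [← hθ]
  exact LinearMap.ker_le_ker_comp φ θ

lemma toricMonomial_image {A : Type*} [CommRing A] (b d : ℕ) (x : Fin 3 → A) (m : ToricExp) :
    toricMonomial (fun c => Polynomial.C (x c)) (fun c => Polynomial.monomial 1 (x c ^ (2 * b + d)))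
        (Polynomial.monomial 1 ((∏ c, x c) ^ b)) m =
      (∏ c, x c ^ (toricWeight b d m).1 c) • Polynomial.X ^ (toricWeight b d m).2 := by
  simp only [toricMonomial, toricWeight, ← Polynomial.C_mul_X_eq_monomial,
    Polynomial.smul_eq_C_mul, mul_pow, Finset.prod_mul_distrib, Finset.prod_pow_eq_pow_sum,
    ← map_pow, pow_add, pow_mul, Finset.prod_pow, map_mul, map_prod]
  ring

variable (k : Type*) [Field k]

/-- The monomial basis of `S` over `k`. -/
noncomputable def basisS : Module.Basis ((Fin 3 →₀ ℕ) × (Fin 4 →₀ ℕ)) k (S k) :=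
  (basisMonomials (Fin 3) k).smulTower (basisMonomials (Fin 4) (R k))

/-- The monomial basis of `R[T]` over `k`. -/
noncomputable def basisRT : Module.Basis ((Fin 3 →₀ ℕ) × ℕ) k (Polynomial (R k)) :=
  (basisMonomials (Fin 3) k).smulTower (Polynomial.basisMonomials (R k))

variable {k}

lemma basisS_apply (m : (Fin 3 →₀ ℕ) × (Fin 4 →₀ ℕ)) :
    basisS k m = toricMonomial (fun c => C (X c)) (fun c => X c.castSucc) (w k)
      (m.1, m.2 ∘ Fin.castSucc, m.2 3) := by
  simp only [basisS, Module.Basis.smulTower_apply, coe_basisMonomials, monomial_eq, C_1, one_mul,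
    Finsupp.prod_fintype, pow_zero, implies_true, Fin.prod_univ_castSucc (n := 3), toricMonomial,
    smul_eq_C_mul, map_prod, map_pow, Function.comp_apply, mul_assoc]
  rfl

lemma basisRT_apply (m : (Fin 3 →₀ ℕ) × ℕ) :
    basisRT k m = (∏ c, (X c : R k) ^ m.1 c) • Polynomial.X ^ m.2 := by
  simp only [basisRT, Module.Basis.smulTower_apply, coe_basisMonomials, monomial_eq, C_1, one_mul,
    Finsupp.prod_fintype, pow_zero, implies_true, Polynomial.coe_basisMonomials,
    Polynomial.X_pow_eq_monomial]

lemma aeval_basisS (b d : ℕ) (m : (Fin 3 →₀ ℕ) × (Fin 4 →₀ ℕ)) :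
    aeval (fun i => Polynomial.monomial 1 (gens k (2 * b + d) b i)) (basisS k m) =
      basisRT k ((toricWeight b d (m.1, m.2 ∘ Fin.castSucc, m.2 3)).map
        Finsupp.equivFunOnFinite.symm id) := by
  rw [basisS_apply, basisRT_apply, ← RingHom.coe_coe, map_toricMonomial]
  refine Eq.trans ?_ (toricMonomial_image b d X _)
  congr 1
  · ext1 c
    simp [← algebraMap_eq]
  · ext1 c
    fin_cases c <;> simp [gens]
  · simp [gens, Fin.prod_univ_three]

variable {Q : Type*} [CommRing Q] {b d : ℕ}

lemma reesIdeal_le_ker (φ : S k →+* Q)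
    (h : ToricRel b d (fun c => φ (C (X c))) (fun c => φ (X c.castSucc)) (φ (w k))) :
    reesIdeal (gens k (2 * b + d) b) ≤ RingHom.ker φ := by
  let _ : Algebra k Q := (φ.comp (algebraMap k (S k))).toAlgebra
  let φ' : S k →ₐ[k] Q := { φ with commutes' := fun _ => rfl }
  have hφ (m) : φ (basisS k m) = toricMonomial (fun c => φ (C (X c))) (fun c => φ (X c.castSucc))
      (φ (w k)) (m.1, m.2 ∘ Fin.castSucc, m.2 3) := by
    rw [basisS_apply]
    exact map_toricMonomial φ _ _ _ _
  have hker := ker_le_ker_of_basis (basisS k) (basisRT k)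
    (φ := (aeval fun i => Polynomial.monomial 1 (gens k (2 * b + d) b i)).toLinearMap
      |>.restrictScalars k) (ψ := φ'.toLinearMap)
    (e := fun m => (toricWeight b d (m.1, m.2 ∘ Fin.castSucc, m.2 3)).map
      Finsupp.equivFunOnFinite.symm id) (aeval_basisS b d) fun m m' hm => by
        have hw := (Finsupp.equivFunOnFinite.symm.injective.prodMap Function.injective_id) hm
        exact (hφ m).trans ((h.toricMonomial_eq hw).trans (hφ m').symm)
  exact fun F hF => hker (mem_reesIdeal.mp hF)

end Monomials

section Generators

variable {k : Type*} [Field k] {b d : ℕ}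

section Relations

variable {Q : Type*} [CommRing Q] {φ : S k →+* Q}

lemma map_f_of_L_subset_ker (hL : L k (2 * b + d) b ⊆ (RingHom.ker φ : Set (S k)))
    (c c' : Fin 3) : φ (C (X c)) ^ (2 * b + d) * φ (X c'.castSucc) =
      φ (C (X c')) ^ (2 * b + d) * φ (X c.castSucc) := by
  have hf₁ : φ (f₁ k (2 * b + d)) = 0 := hL (by simp [L])
  have hf₂ : φ (f₂ k (2 * b + d)) = 0 := hL (by simp [L])
  have hf₃ : φ (f₃ k (2 * b + d)) = 0 := hL (by simp [L])
  simp only [f₁, f₂, f₃, map_sub, map_mul, map_pow, sub_eq_zero] at hf₁ hf₂ hf₃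
  fin_cases c <;> fin_cases c' <;> first | rfl | assumption | (symm; assumption)

lemma map_g_of_L_subset_ker (hL : L k (2 * b + d) b ⊆ (RingHom.ker φ : Set (S k)))
    (c : Fin 3) : φ (C (X c)) ^ (b + d) * φ (w k) =
      (φ (C (X (c + 1))) * φ (C (X (c + 2)))) ^ b * φ (X c.castSucc) := by
  have hb : 2 * b + d - b = b + d := by omega
  have hg₁ : φ (g₁ k (2 * b + d) b) = 0 := hL (by simp [L])
  have hg₂ : φ (g₂ k (2 * b + d) b) = 0 := hL (by simp [L])
  have hg₃ : φ (g₃ k (2 * b + d) b) = 0 := hL (by simp [L])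
  simp only [g₁, g₂, g₃, hb, map_sub, map_mul, map_pow, sub_eq_zero] at hg₁ hg₂ hg₃
  fin_cases c
  · exact hg₁
  · exact hg₂.trans (by simp [mul_comm])
  · exact hg₃

lemma map_H_of_subset_ker
    (hH : {H₁ k (2 * b + d) b, H₂ k (2 * b + d) b, H₃ k (2 * b + d) b} ⊆
      (RingHom.ker φ : Set (S k))) (c : Fin 3) :
    (φ (C (X (c + 1))) * φ (C (X (c + 2)))) ^ d * φ (w k) ^ 2 =
      φ (C (X c)) ^ (2 * b) * (φ (X (c + 1).castSucc) * φ (X (c + 2).castSucc)) := by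
  have h2b : 2 * b + d - 2 * b = d := by omega
  have hH₁ : φ (H₁ k (2 * b + d) b) = 0 := hH (by simp)
  have hH₂ : φ (H₂ k (2 * b + d) b) = 0 := hH (by simp)
  have hH₃ : φ (H₃ k (2 * b + d) b) = 0 := hH (by simp)
  simp only [H₁, H₂, H₃, h2b, map_sub, map_mul, map_pow, sub_eq_zero] at hH₁ hH₂ hH₃
  rw [← mul_assoc]
  fin_cases c
  · exact hH₃
  · rw [mul_right_comm, mul_comm (φ _) (φ _)]
    exact hH₂
  · exact hH₁

lemma toricRel_of_subset_ker (hL : L k (2 * b + d) b ⊆ (RingHom.ker φ : Set (S k)))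
    (hH : {H₁ k (2 * b + d) b, H₂ k (2 * b + d) b, H₃ k (2 * b + d) b} ⊆
      (RingHom.ker φ : Set (S k)))
    (hE : (∃ e, b = d + e ∧ φ (E k (2 * b + d) b) = 0) ∨
      ∃ e, d = b + e ∧ φ (E' k (2 * b + d) b) = 0) :
    ToricRel b d (fun c => φ (C (X c))) (fun c => φ (X c.castSucc)) (φ (w k)) := by
  refine ⟨map_f_of_L_subset_ker hL, map_g_of_L_subset_ker hL, map_H_of_subset_ker hH,
    hE.imp (Exists.imp fun e he => ⟨he.1, ?_⟩) (Exists.imp fun e he => ⟨he.1, ?_⟩)⟩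
  · have hE₀ := he.2
    rw [E, show 3 * b - (2 * b + d) = e by omega, map_sub, sub_eq_zero] at hE₀
    simpa [Fin.prod_univ_three, mul_assoc] using hE₀
  · have hE₀ := he.2
    rw [E', show 2 * b + d - 3 * b = e by omega, map_sub, sub_eq_zero] at hE₀
    simpa [Fin.prod_univ_three, mul_assoc] using hE₀

lemma reesIdeal_le_ker_of_subset {F : S k}
    (h : L k (2 * b + d) b ∪ {H₁ k (2 * b + d) b, H₂ k (2 * b + d) b, H₃ k (2 * b + d) b} ∪ {F} ⊆
      (RingHom.ker φ : Set (S k)))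
    (hE : (∃ e, b = d + e ∧ E k (2 * b + d) b = F) ∨ ∃ e, d = b + e ∧ E' k (2 * b + d) b = F) :
    reesIdeal (gens k (2 * b + d) b) ≤ RingHom.ker φ := by
  have hF : φ F = 0 := h (Or.inr rfl)
  have hE₀ : (∃ e, b = d + e ∧ φ (E k (2 * b + d) b) = 0) ∨
      ∃ e, d = b + e ∧ φ (E' k (2 * b + d) b) = 0 := by
    refine hE.imp ?_ ?_ <;> rintro ⟨e, he, rfl⟩ <;> exact ⟨e, he, hF⟩
  exact reesIdeal_le_ker φ (toricRel_of_subset_ker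
    ((Set.subset_union_left.trans Set.subset_union_left).trans h)
    ((Set.subset_union_right.trans Set.subset_union_left).trans h) hE₀)

end Relations

lemma L_subset_reesIdeal : L k (2 * b + d) b ⊆ (reesIdeal (gens k (2 * b + d) b) : Set (S k)) := by
  have hb : 2 * b + d - b = b + d := by omega
  rintro F (rfl | rfl | rfl | rfl | rfl | rfl) <;> rw [SetLike.mem_coe, mem_reesIdeal] <;>
    simp only [f₁, f₂, f₃, g₁, g₂, g₃, hb, ← algebraMap_eq, map_sub, map_mul, map_pow, aeval_X,
      AlgHom.commutes, gens, ← Polynomial.C_mul_X_eq_monomial, Polynomial.algebraMap_eq,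
      Matrix.cons_val] <;> ring

lemma H_subset_reesIdeal : {H₁ k (2 * b + d) b, H₂ k (2 * b + d) b, H₃ k (2 * b + d) b} ⊆
    (reesIdeal (gens k (2 * b + d) b) : Set (S k)) := by
  have hb : 2 * b + d - 2 * b = d := by omega
  rintro F (rfl | rfl | rfl) <;> rw [SetLike.mem_coe, mem_reesIdeal] <;>
    simp only [H₁, H₂, H₃, hb, ← algebraMap_eq, map_sub, map_mul, map_pow, aeval_X,
      AlgHom.commutes, gens, ← Polynomial.C_mul_X_eq_monomial, Polynomial.algebraMap_eq,
      Matrix.cons_val] <;> ring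

lemma E_mem_reesIdeal {e : ℕ} (h : b = d + e) :
    E k (2 * b + d) b ∈ reesIdeal (gens k (2 * b + d) b) := by
  have he : 3 * b - (2 * b + d) = e := by omega
  rw [mem_reesIdeal]
  simp only [E, he, ← algebraMap_eq, map_sub, map_mul, map_pow, aeval_X,
      AlgHom.commutes, gens, ← Polynomial.C_mul_X_eq_monomial, Polynomial.algebraMap_eq,
      Matrix.cons_val]
  rw [h]
  ring

lemma E'_mem_reesIdeal {e : ℕ} (h : d = b + e) :
    E' k (2 * b + d) b ∈ reesIdeal (gens k (2 * b + d) b) := by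
  have he : 2 * b + d - 3 * b = e := by omega
  rw [mem_reesIdeal]
  simp only [E', he, ← algebraMap_eq, map_sub, map_mul, map_pow, aeval_X,
      AlgHom.commutes, gens, ← Polynomial.C_mul_X_eq_monomial, Polynomial.algebraMap_eq,
      Matrix.cons_val]
  rw [h]
  ring

lemma le_span_of_forall_ker.{v} {A : Type v} [CommRing A] {I : Ideal A} {s : Set A}
    (h : ∀ {Q : Type v} [CommRing Q] (φ : A →+* Q), s ⊆ RingHom.ker φ → I ≤ RingHom.ker φ) :
    I ≤ Ideal.span s := by
  have := h (Ideal.Quotient.mk (Ideal.span s))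
  rw [Ideal.mk_ker] at this
  exact this Ideal.subset_span

lemma reesIdeal_eq_span {F : S k} (hF : F ∈ reesIdeal (gens k (2 * b + d) b))
    (hE : (∃ e, b = d + e ∧ E k (2 * b + d) b = F) ∨ ∃ e, d = b + e ∧ E' k (2 * b + d) b = F) :
    reesIdeal (gens k (2 * b + d) b) = Ideal.span (L k (2 * b + d) b ∪
      {H₁ k (2 * b + d) b, H₂ k (2 * b + d) b, H₃ k (2 * b + d) b, F}) := by
  have hunion : L k (2 * b + d) b ∪
      {H₁ k (2 * b + d) b, H₂ k (2 * b + d) b, H₃ k (2 * b + d) b, F} =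
      L k (2 * b + d) b ∪
        {H₁ k (2 * b + d) b, H₂ k (2 * b + d) b, H₃ k (2 * b + d) b} ∪ {F} := by
    simp only [Set.union_assoc, Set.insert_union, Set.singleton_union]
  rw [hunion]
  exact le_antisymm (le_span_of_forall_ker fun _ h => reesIdeal_le_ker_of_subset h hE)
    (Ideal.span_le.mpr (Set.union_subset
      (Set.union_subset L_subset_reesIdeal H_subset_reesIdeal) (Set.singleton_subset_iff.mpr hF)))

lemma reesIdeal_eq_of_le {e : ℕ} (h : b = d + e) : reesIdeal (gens k (2 * b + d) b) =
    Ideal.span (L k (2 * b + d) b ∪ {H₁ k (2 * b + d) b, H₂ k (2 * b + d) b, H₃ k (2 * b + d) b,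
      E k (2 * b + d) b}) :=
  reesIdeal_eq_span (E_mem_reesIdeal h) (Or.inl ⟨e, h, rfl⟩)

lemma reesIdeal_eq_of_ge {e : ℕ} (h : d = b + e) : reesIdeal (gens k (2 * b + d) b) =
    Ideal.span (L k (2 * b + d) b ∪ {H₁ k (2 * b + d) b, H₂ k (2 * b + d) b, H₃ k (2 * b + d) b,
      E' k (2 * b + d) b}) :=
  reesIdeal_eq_span (E'_mem_reesIdeal h) (Or.inr ⟨e, h, rfl⟩)

end Generators

/-! ### Syzygies -/

section Syzygies

variable {R ι : Type*} [CommRing R]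

lemma linearForm_mem_reesIdeal_iff [Fintype ι] {f c : ι → R} :
    linearForm c ∈ reesIdeal f ↔ c ∈ syzygyModule f := by
  have haeval : aeval (fun i => Polynomial.monomial 1 (f i)) (linearForm c) =
      Polynomial.monomial 1 (Fintype.linearCombination R f c) := by
    simp [linearForm, Fintype.linearCombination_apply, Polynomial.C_mul_monomial]
  rw [mem_reesIdeal, syzygyModule, LinearMap.mem_ker, haeval, Polynomial.monomial_eq_zero_iff]

/-- The vector of coefficients of the linear part of a polynomial. -/
noncomputable def linearPart : MvPolynomial ι R →ₗ[R] ι → R :=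
  LinearMap.pi fun i => lcoeff R (Finsupp.single i 1)

lemma linearPart_mul (F G : MvPolynomial ι R) :
    linearPart (F * G) = constantCoeff F • linearPart G + constantCoeff G • linearPart F := by
  classical
  ext i
  simp [linearPart, coeff_mul, Finsupp.antidiagonal_single, constantCoeff_eq,
    Finset.Nat.antidiagonal_succ, mul_comm]

lemma constantCoeff_linearForm [Fintype ι] (c : ι → R) : constantCoeff (linearForm c) = 0 := by
  simp [linearForm]

lemma linearPart_linearForm [Fintype ι] (c : ι → R) : linearPart (linearForm c) = c := by
  classical
  ext i
  simp [linearPart, linearForm, coeff_C_mul, coeff_X, Finsupp.single_left_inj]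

lemma linearPart_mem_of_mem_span {s : Set (MvPolynomial ι R)} {N : Submodule R (ι → R)}
    (hs : ∀ F ∈ s, constantCoeff F = 0 ∧ linearPart F ∈ N) {F : MvPolynomial ι R}
    (hF : F ∈ Ideal.span s) : linearPart F ∈ N := by
  have hconst : Ideal.span s ≤ RingHom.ker (constantCoeff (σ := ι) (R := R)) :=
    Ideal.span_le.mpr fun F hF => (hs F hF).1
  induction hF using Submodule.span_induction with
  | mem F hF => exact (hs F hF).2
  | zero => exact (map_zero (linearPart (ι := ι) (R := R))) ▸ zero_mem N
  | add F G _ _ hF hG => exact (map_add linearPart F G) ▸ add_mem hF hG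
  | smul G F hF hFN =>
    have hF₀ : constantCoeff F = 0 := hconst hF
    rw [smul_eq_mul, linearPart_mul, hF₀, zero_smul, add_zero]
    exact N.smul_mem _ hFN

lemma span_eq_syzygyModule [Fintype ι] {f : ι → R} {s : Set (ι → R)}
    {s' : Set (MvPolynomial ι R)} (hI : reesIdeal f = Ideal.span (linearForm '' s ∪ s'))
    (hs' : ∀ F ∈ s', constantCoeff F = 0 ∧ linearPart F = 0) :
    Submodule.span R s = syzygyModule f := by
  apply le_antisymm
  · refine Submodule.span_le.mpr fun c hc => linearForm_mem_reesIdeal_iff.mp ?_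
    rw [hI]
    exact Ideal.subset_span (Or.inl ⟨c, hc, rfl⟩)
  · intro c hc
    rw [← linearForm_mem_reesIdeal_iff, hI] at hc
    rw [← linearPart_linearForm c]
    refine linearPart_mem_of_mem_span ?_ hc
    rintro _ (⟨c, hc, rfl⟩ | hF)
    · exact ⟨constantCoeff_linearForm c, (linearPart_linearForm c).symm ▸ Submodule.subset_span hc⟩
    · exact ⟨(hs' _ hF).1, (hs' _ hF).2 ▸ zero_mem _⟩

end Syzygies

section SyzygyColumns

variable {k : Type*} [Field k] (a b : ℕ)

lemma linearForm_image_syzygyColumns : linearForm '' syzygyColumns k a b = L k a b := by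
  have hsum (c : Fin 4 → R k) : linearForm c =
      C (c 0) * t k + C (c 1) * u k + C (c 2) * v k + C (c 3) * w k := Fin.sum_univ_four _
  have hf₁ : linearForm ![-y k ^ a, x k ^ a, 0, 0] = f₁ k a := by
    rw [hsum, f₁]; simp; ring
  have hf₂ : linearForm ![-z k ^ a, 0, x k ^ a, 0] = f₂ k a := by
    rw [hsum, f₂]; simp; ring
  have hf₃ : linearForm ![0, -z k ^ a, y k ^ a, 0] = f₃ k a := by
    rw [hsum, f₃]; simp; ring
  have hg₁ : linearForm ![-(y k * z k) ^ b, 0, 0, x k ^ (a - b)] = g₁ k a b := by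
    rw [hsum, g₁]; simp; ring
  have hg₂ : linearForm ![0, -(x k * z k) ^ b, 0, y k ^ (a - b)] = g₂ k a b := by
    rw [hsum, g₂]; simp; ring
  have hg₃ : linearForm ![0, 0, -(x k * y k) ^ b, z k ^ (a - b)] = g₃ k a b := by
    rw [hsum, g₃]; simp; ring
  simp only [syzygyColumns, L, Set.image_insert_eq, Set.image_singleton, hf₁, hf₂, hf₃, hg₁, hg₂,
    hg₃]

lemma linearPart_E : constantCoeff (E k a b) = 0 ∧ linearPart (E k a b) = 0 := by
  simp [E, linearPart_mul, pow_succ]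

lemma linearPart_E' : constantCoeff (E' k a b) = 0 ∧ linearPart (E' k a b) = 0 := by
  simp [E', linearPart_mul, pow_succ]

variable {a b}

lemma span_syzygyColumns {F : S k} (hF : constantCoeff F = 0 ∧ linearPart F = 0)
    (hI : reesIdeal (gens k a b) = Ideal.span (L k a b ∪ {H₁ k a b, H₂ k a b, H₃ k a b, F})) :
    Submodule.span (R k) (syzygyColumns k a b) = syzygyModule (gens k a b) := by
  rw [← linearForm_image_syzygyColumns] at hI
  refine span_eq_syzygyModule hI ?_
  rintro G (rfl | rfl | rfl | rfl)
  · simp [H₁, linearPart_mul, sq]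
  · simp [H₂, linearPart_mul, sq]
  · simp [H₃, linearPart_mul, sq]
  · exact hF

end SyzygyColumns

/-! ### Sylvester forms -/

section Biforms

variable {k : Type*} [Field k] {σ ι : Type*} {d : ι → ℕ} {p q p' q' : ℕ}
  {F G : MvPolynomial ι (MvPolynomial σ k)}

/-- `F` is a biform of bidegree `(p, q)`. -/
def HasBidegree (d : ι → ℕ) (p q : ℕ) (F : MvPolynomial ι (MvPolynomial σ k)) : Prop :=
  ∀ (m : ι →₀ ℕ) (n : σ →₀ ℕ), (F.coeff m).coeff n ≠ 0 →
    n.degree + (m.sum fun i e => e * d i) = p ∧ m.degree = q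

lemma HasBidegree.isBiform (h : HasBidegree d p q F) : IsBiform d F := ⟨p, q, h⟩

lemma HasBidegree.neg (h : HasBidegree d p q F) : HasBidegree d p q (-F) := fun m n hmn =>
  h m n (by simpa using hmn)

lemma HasBidegree.sub (hF : HasBidegree d p q F) (hG : HasBidegree d p q G) :
    HasBidegree d p q (F - G) := by
  intro m n hmn
  by_cases h : (F.coeff m).coeff n = 0
  · exact hG m n fun h' => hmn (by simp [h, h'])
  · exact hF m n h

lemma HasBidegree.mul (hF : HasBidegree d p q F) (hG : HasBidegree d p' q' G) :
    HasBidegree d (p + p') (q + q') (F * G) := by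
  classical
  intro m n hmn
  rw [coeff_mul, coeff_sum] at hmn
  obtain ⟨⟨m₁, m₂⟩, hm, h⟩ := Finset.exists_ne_zero_of_sum_ne_zero hmn
  rw [coeff_mul] at h
  obtain ⟨⟨n₁, n₂⟩, hn, h⟩ := Finset.exists_ne_zero_of_sum_ne_zero h
  rw [Finset.HasAntidiagonal.mem_antidiagonal] at hm hn
  obtain ⟨hp, hq⟩ := hF m₁ n₁ (left_ne_zero_of_mul h)
  obtain ⟨hp', hq'⟩ := hG m₂ n₂ (right_ne_zero_of_mul h)
  subst hm hn
  simp only [map_add]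
  rw [Finsupp.sum_add_index' (by simp) (by intros; ring)]
  omega

lemma hasBidegree_C {α : MvPolynomial σ k} (h : α.IsHomogeneous p) :
    HasBidegree d p 0 (C α : MvPolynomial ι (MvPolynomial σ k)) := by
  classical
  intro m n hmn
  rw [coeff_C] at hmn
  split_ifs at hmn with hm
  · subst hm
    have : n.degree = p := by
      rw [Finsupp.degree_eq_weight_one]
      exact h hmn
    simpa using this
  · simp at hmn

lemma HasBidegree.pow (hF : HasBidegree d p q F) (n : ℕ) :
    HasBidegree d (n * p) (n * q) (F ^ n) := by
  induction n with
  | zero => simpa using hasBidegree_C (isHomogeneous_one σ k)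
  | succ n ih => simpa only [pow_succ, add_mul, one_mul] using ih.mul hF

lemma hasBidegree_X (i : ι) :
    HasBidegree d (d i) 1 (X i : MvPolynomial ι (MvPolynomial σ k)) := by
  classical
  intro m n hmn
  obtain ⟨rfl, rfl⟩ : Finsupp.single i 1 = m ∧ n = 0 := by
    rw [coeff_X] at hmn
    split_ifs at hmn with hm
    · rw [coeff_one] at hmn
      exact ⟨hm, (of_not_not fun hn => hmn (if_neg hn)).symm⟩
    · exact absurd (coeff_zero n) hmn
  simp

end Biforms

section SylvesterForms

variable {k : Type*} [Field k] {b d e : ℕ}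

lemma isHomogeneous_X_mul_X_pow (i j : Fin 3) (n : ℕ) :
    ((X i * X j : R k) ^ n).IsHomogeneous (2 * n) :=
  ((isHomogeneous_X k i).mul (isHomogeneous_X k j)).pow n

lemma isNonzeroForm_X_pow (i : Fin 3) (n : ℕ) :
    (X i : R k) ^ n ≠ 0 ∧ ∃ p, ((X i : R k) ^ n).IsHomogeneous p :=
  ⟨pow_ne_zero _ (X_ne_zero i), _, isHomogeneous_X_pow i n⟩

lemma isNonzeroForm_X_mul_X_pow (i j : Fin 3) (n : ℕ) :
    (X i * X j : R k) ^ n ≠ 0 ∧ ∃ p, ((X i * X j : R k) ^ n).IsHomogeneous p :=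
  ⟨pow_ne_zero _ (mul_ne_zero (X_ne_zero i) (X_ne_zero j)), _, isHomogeneous_X_mul_X_pow i j n⟩

lemma genDegrees_castSucc (a b : ℕ) (c : Fin 3) : genDegrees a b c.castSucc = a := by
  fin_cases c <;> rfl

lemma hasBidegree_w (a b : ℕ) : HasBidegree (genDegrees a b) (3 * b) 1 (w k) := hasBidegree_X 3

lemma hasBidegree_X_castSucc (a b : ℕ) (c : Fin 3) :
    HasBidegree (genDegrees a b) a 1 (X c.castSucc : S k) := by
  convert hasBidegree_X (d := genDegrees a b) c.castSucc
  exact (genDegrees_castSucc a b c).symm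

lemma isBiform_syzygy (i j l c : Fin 3) : IsBiform (genDegrees (2 * b + d) b)
    (C (X i ^ (b + d)) * w k - C ((X j * X l) ^ b) * X c.castSucc : S k) := by
  refine (HasBidegree.sub (p := 4 * b + d) (q := 1) ?_ ?_).isBiform
  · convert (hasBidegree_C (isHomogeneous_X_pow i (b + d))).mul (hasBidegree_w _ b) using 1
    ring
  · convert (hasBidegree_C (isHomogeneous_X_mul_X_pow j l b)).mul
      (hasBidegree_X_castSucc _ b c) using 1
    ring

lemma isBiform_quadratic (i j l c c' : Fin 3) : IsBiform (genDegrees (2 * b + d) b)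
    (C ((X i * X j) ^ d) * w k ^ 2 - C (X l ^ (2 * b)) * X c.castSucc * X c'.castSucc : S k) := by
  refine (HasBidegree.sub (p := 6 * b + 2 * d) (q := 2) ?_ ?_).isBiform
  · convert (hasBidegree_C (isHomogeneous_X_mul_X_pow i j d)).mul
      ((hasBidegree_w _ b).pow 2) using 1
    ring
  · convert ((hasBidegree_C (isHomogeneous_X_pow l (2 * b))).mul
      (hasBidegree_X_castSucc _ b c)).mul (hasBidegree_X_castSucc _ b c') using 1
    ring

lemma isSylvesterForm_quadratic {i j l : Fin 3} (c c' : Fin 3) :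
    IsSylvesterForm (genDegrees (2 * b + d) b) (X i ^ b) (X j ^ b)
      (C (X i ^ (b + d)) * w k - C ((X j * X l) ^ b) * X c.castSucc)
      (C (X j ^ (b + d)) * w k - C ((X i * X l) ^ b) * X c'.castSucc)
      (C ((X i * X j) ^ d) * w k ^ 2 - C (X l ^ (2 * b)) * X c.castSucc * X c'.castSucc) := by
  have hmul (i : Fin 3) (n : ℕ) (s : Fin 4) : HasBidegree (genDegrees (2 * b + d) b)
      (n + genDegrees (2 * b + d) b s) (0 + 1) (C (X i ^ n) * X s : S k) :=
    (hasBidegree_C (isHomogeneous_X_pow i n)).mul (hasBidegree_X s)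
  refine ⟨isNonzeroForm_X_pow _ _, isNonzeroForm_X_pow _ _, isBiform_syzygy _ _ _ _,
    isBiform_syzygy _ _ _ _, C (X i ^ d) * w k, -(C (X l ^ b) * X c.castSucc),
    -(C (X l ^ b) * X c'.castSucc), C (X j ^ d) * w k, (hmul _ _ _).isBiform,
    (hmul _ _ _).neg.isBiform, (hmul _ _ _).neg.isBiform, (hmul _ _ _).isBiform, ?_, ?_, ?_⟩ <;>
  simp only [Matrix.det_fin_two_of, map_mul, map_pow] <;> ring

lemma isSylvesterForm_H₁ : IsSylvesterForm (genDegrees (2 * b + d) b) (x k ^ b) (y k ^ b)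
    (g₁ k (2 * b + d) b) (g₂ k (2 * b + d) b) (H₁ k (2 * b + d) b) := by
  rw [g₁, g₂, H₁, show 2 * b + d - b = b + d by omega, Nat.add_sub_cancel_left]
  exact isSylvesterForm_quadratic 0 1

lemma isSylvesterForm_H₂ : IsSylvesterForm (genDegrees (2 * b + d) b) (x k ^ b) (z k ^ b)
    (g₁ k (2 * b + d) b) (g₃ k (2 * b + d) b) (H₂ k (2 * b + d) b) := by
  rw [g₁, g₃, H₂, show 2 * b + d - b = b + d by omega, Nat.add_sub_cancel_left,
    mul_comm (y k) (z k)]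
  exact isSylvesterForm_quadratic 0 2

lemma isSylvesterForm_H₃ : IsSylvesterForm (genDegrees (2 * b + d) b) (y k ^ b) (z k ^ b)
    (g₂ k (2 * b + d) b) (g₃ k (2 * b + d) b) (H₃ k (2 * b + d) b) := by
  rw [g₂, g₃, H₃, show 2 * b + d - b = b + d by omega, Nat.add_sub_cancel_left,
    mul_comm (x k) (z k), mul_comm (x k) (y k)]
  exact isSylvesterForm_quadratic 1 2

lemma isSylvesterForm_E (h : b = d + e) :
    IsSylvesterForm (genDegrees (2 * b + d) b) (x k ^ (2 * b + d - b))
      ((y k * z k) ^ (2 * b + d - 2 * b)) (g₁ k (2 * b + d) b) (H₃ k (2 * b + d) b)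
      (E k (2 * b + d) b) := by
  have hb : 2 * b + d - b = b + d := by omega
  have h2b : 2 * b + d - 2 * b = d := by omega
  have h3b : 3 * b - (2 * b + d) = e := by omega
  rw [g₁, H₃, E, hb, h2b, h3b]
  refine ⟨isNonzeroForm_X_pow _ _, isNonzeroForm_X_mul_X_pow _ _ _,
    isBiform_syzygy 0 1 2 0, isBiform_quadratic 1 2 0 1 2,
    w k, -(C ((y k * z k) ^ e) * t k), -(C (x k ^ e) * u k * v k), w k ^ 2,
    (hasBidegree_X _).isBiform,
    ((hasBidegree_C (isHomogeneous_X_mul_X_pow _ _ _)).mul (hasBidegree_X _)).neg.isBiform,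
    (((hasBidegree_C (isHomogeneous_X_pow _ _)).mul (hasBidegree_X _)).mul
      (hasBidegree_X _)).neg.isBiform, ((hasBidegree_X _).pow 2).isBiform, ?_, ?_, ?_⟩ <;>
  simp only [Matrix.det_fin_two_of, map_mul, map_pow, h] <;> ring

lemma isSylvesterForm_E' (h : d = b + e) :
    IsSylvesterForm (genDegrees (2 * b + d) b) (x k ^ (2 * b)) ((y k * z k) ^ b)
      (g₁ k (2 * b + d) b) (H₃ k (2 * b + d) b) (E' k (2 * b + d) b) := by
  have hb : 2 * b + d - b = b + d := by omega
  have h2b : 2 * b + d - 2 * b = d := by omega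
  have h3b : 2 * b + d - 3 * b = e := by omega
  rw [g₁, H₃, E', hb, h2b, h3b]
  refine ⟨isNonzeroForm_X_pow _ _, isNonzeroForm_X_mul_X_pow _ _ _,
    isBiform_syzygy 0 1 2 0, isBiform_quadratic 1 2 0 1 2,
    C (x k ^ e) * w k, -t k, -(u k * v k), C ((y k * z k) ^ e) * w k ^ 2,
    ((hasBidegree_C (isHomogeneous_X_pow _ _)).mul (hasBidegree_X _)).isBiform,
    (hasBidegree_X _).neg.isBiform, ((hasBidegree_X _).mul (hasBidegree_X _)).neg.isBiform,
    ((hasBidegree_C (isHomogeneous_X_mul_X_pow _ _ _)).mul ((hasBidegree_X _).pow 2)).isBiform,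
    ?_, ?_, ?_⟩ <;>
  simp only [Matrix.det_fin_two_of, map_mul, map_pow, h] <;> ring

end SylvesterForms

/-! ### Regular sequences of monomials and differences of powers -/

section RegularSequences

open RingTheory.Sequence

section Quotient

variable {A : Type*} [CommRing A] {I : Ideal A} {c d : A}

lemma isSMulRegular_quotient_swap (hd : IsSMulRegular (A ⧸ I) d)
    (hc : IsSMulRegular (A ⧸ (I ⊔ Ideal.span {d})) c) :
    IsSMulRegular (A ⧸ (I ⊔ Ideal.span {c})) d := by
  simp only [isSMulRegular_quotient_iff, sup_comm I, Ideal.mem_span_singleton_sup] at hd hc ⊢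
  rintro p ⟨q, i, hi, h⟩
  obtain ⟨q', i', hi', rfl⟩ := hc q ⟨p, -i, I.neg_mem hi, by linear_combination -h⟩
  refine ⟨q', p - q' * c, hd _ ?_, by ring⟩
  convert I.add_mem hi (I.mul_mem_right c hi') using 1
  linear_combination -h

lemma isSMulRegular_quotient_span_singleton_of_prime [IsDomain A] (hd : Prime d) (h : ¬ d ∣ c) :
    IsSMulRegular (A ⧸ Ideal.span {c}) d := by
  simp only [isSMulRegular_quotient_iff, Ideal.mem_span_singleton]
  rintro p ⟨q, hq⟩
  obtain ⟨q, rfl⟩ := (hd.dvd_or_dvd ⟨p, hq.symm⟩).resolve_left h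
  exact ⟨q, mul_left_cancel₀ hd.ne_zero (by rw [hq]; ring)⟩

end Quotient

section MvPolynomial

variable {σ R : Type*} [CommRing R] {i j l : σ}

lemma isSMulRegular_quotient_span_monomial [Nontrivial R] {s : Set (σ →₀ ℕ)}
    (hs : ∀ m ∈ s, m i = 0) :
    IsSMulRegular (MvPolynomial σ R ⧸ Ideal.span ((fun m => monomial m (1 : R)) '' s))
      (X i : MvPolynomial σ R) := by
  classical
  simp only [isSMulRegular_quotient_iff, mem_ideal_span_monomial_image]
  intro p hp m hm
  obtain ⟨n, hn, hle⟩ := hp (Finsupp.single i 1 + m) (by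
    rw [support_X_mul]; exact Finset.mem_map.mpr ⟨m, hm, rfl⟩)
  refine ⟨n, hn, fun l => ?_⟩
  rcases eq_or_ne l i with rfl | hl
  · simp [hs n hn]
  · simpa [Finsupp.single_apply, hl.symm] using hle l

lemma isSMulRegular_quotient_span_X_pow_sup [Nontrivial R] (hi : i ≠ l) (hj : j ≠ l) (m n : ℕ) :
    IsSMulRegular (MvPolynomial σ R ⧸
        (Ideal.span {(X i : MvPolynomial σ R) ^ m} ⊔ Ideal.span {X j ^ n}))
      (X l : MvPolynomial σ R) := by
  have := isSMulRegular_quotient_span_monomial (R := R) (i := l)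
    (s := {Finsupp.single i m, Finsupp.single j n}) (by simp [hi, hj])
  rwa [Set.image_pair, Ideal.span_insert, ← X_pow_eq_monomial, ← X_pow_eq_monomial] at this

lemma isSMulRegular_quotient_span_X_pow [Nontrivial R] (hi : i ≠ l) (m : ℕ) :
    IsSMulRegular (MvPolynomial σ R ⧸ Ideal.span {(X i : MvPolynomial σ R) ^ m})
      (X l : MvPolynomial σ R) := by
  rw [← sup_idem (Ideal.span {(X i : MvPolynomial σ R) ^ m})]
  exact isSMulRegular_quotient_span_X_pow_sup hi hi m m

lemma X_pow_mem_span_X (i : σ) {n : ℕ} (hn : n ≠ 0) :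
    (X i : MvPolynomial σ R) ^ n ∈ Ideal.span {(X i : MvPolynomial σ R)} :=
  Ideal.mem_span_singleton.mpr (dvd_pow_self _ hn)

lemma not_X_dvd_X_pow_sub_X_pow [Nontrivial R] (hi : i ≠ l) (hj : j ≠ l) {n : ℕ} (hn : n ≠ 0) :
    ¬ (X j : MvPolynomial σ R) ∣ X l ^ n - X i ^ n := by
  classical
  rintro ⟨q, hq⟩
  have := congrArg (aeval (R := R) fun m => if m = l then (1 : R) else 0) hq
  simp [hi, hj, hn] at this

lemma isSMulRegular_quotient_span_X_pow_sub_X_pow [IsDomain R] {n : ℕ} (hn : n ≠ 0) (h : i ≠ l)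
    (j : σ) : IsSMulRegular (MvPolynomial σ R ⧸ Ideal.span {(X l : MvPolynomial σ R) ^ n - X i ^ n})
      (X j : MvPolynomial σ R) := by
  refine isSMulRegular_quotient_span_singleton_of_prime X_prime ?_
  rcases eq_or_ne j l with rfl | hj
  · rw [← dvd_neg, neg_sub]
    exact not_X_dvd_X_pow_sub_X_pow h.symm h.symm hn
  · exact not_X_dvd_X_pow_sub_X_pow h hj hn

lemma isSMulRegular_quotient_X_pow_sub_sup_X [Nontrivial R] {n : ℕ} (hn : n ≠ 0) (hi : i ≠ l)
    (hj : j ≠ l) : IsSMulRegular (MvPolynomial σ R ⧸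
        (Ideal.span {(X i : MvPolynomial σ R) ^ n - X j ^ n} ⊔
          Ideal.span {(X j : MvPolynomial σ R)}))
      ((X l : MvPolynomial σ R) ^ n - X j ^ n) := by
  rw [sup_comm, sup_span_singleton_congr (d := X i ^ n)
    (by simpa using X_pow_mem_span_X (R := R) j hn), sup_comm]
  have hl := isSMulRegular_quotient_span_X_pow_sup (R := R) hi hj n 1
  rw [pow_one] at hl
  refine isSMulRegular_quotient_congr (hl.pow n) ?_
  simpa using Ideal.mem_sup_right (X_pow_mem_span_X j hn)

lemma isSMulRegular_quotient_X_pow_sub_sup_X_of_ne [Nontrivial R] {n : ℕ} (hn : n ≠ 0)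
    (hij : i ≠ j) (hi : i ≠ l) (hj : j ≠ l) : IsSMulRegular (MvPolynomial σ R ⧸
        (Ideal.span {(X i : MvPolynomial σ R) ^ n - X j ^ n} ⊔
          Ideal.span {(X l : MvPolynomial σ R)}))
      ((X l : MvPolynomial σ R) ^ n - X j ^ n) := by
  have hXj : IsSMulRegular (MvPolynomial σ R ⧸ Ideal.span {(X l : MvPolynomial σ R)})
      (X j : MvPolynomial σ R) := by
    rw [← pow_one (X l : MvPolynomial σ R)]
    exact isSMulRegular_quotient_span_X_pow hj.symm 1
  have hXi := isSMulRegular_quotient_span_X_pow_sup (R := R) hi.symm hij.symm 1 1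
  rw [pow_one, pow_one] at hXi
  have hsub := isSMulRegular_quotient_congr (d := X i ^ n - X j ^ n) (hXi.pow n)
    (by simpa using Ideal.mem_sup_right (X_pow_mem_span_X j hn))
  rw [sup_comm]
  refine isSMulRegular_quotient_congr
    (isSMulRegular_neg ((isSMulRegular_quotient_swap hXj hsub).pow n)) ?_
  rw [← neg_mem_iff]
  simpa using Ideal.mem_sup_left (X_pow_mem_span_X l hn)

lemma isWeaklyRegular_X_pow [IsDomain R] (n : ℕ) :
    IsWeaklyRegular (MvPolynomial (Fin 3) R)
      [(X 0 : MvPolynomial (Fin 3) R) ^ n, X 1 ^ n, X 2 ^ n] :=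
  isWeaklyRegular_triple_iff.mpr ⟨(IsSMulRegular.of_ne_zero (X_ne_zero _)).pow n,
    (isSMulRegular_quotient_span_X_pow (by decide) n).pow n,
    (isSMulRegular_quotient_span_X_pow_sup (by decide) (by decide) n n).pow n⟩

lemma isWeaklyRegular_X_pow_sub_X_pow [IsDomain R] {n : ℕ} (hn : n ≠ 0) (m : ℕ) :
    IsWeaklyRegular (MvPolynomial (Fin 3) R)
      [(X 1 : MvPolynomial (Fin 3) R) ^ n - X 0 ^ n, (X 0 * X 1 * X 2) ^ m,
        X 2 ^ n - X 0 ^ n] := by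
  have hX (i : Fin 3) : IsSMulRegular _ (X i : MvPolynomial (Fin 3) R) :=
    isSMulRegular_quotient_span_X_pow_sub_X_pow hn (show (0 : Fin 3) ≠ 1 by decide) i
  have h₀ := isSMulRegular_quotient_X_pow_sub_sup_X (R := R) hn
    (show (1 : Fin 3) ≠ 2 by decide) (show (0 : Fin 3) ≠ 2 by decide)
  have h₁ := isSMulRegular_quotient_congr (d := X 2 ^ n - X 0 ^ n)
    (isSMulRegular_quotient_X_pow_sub_sup_X (R := R) hn (show (0 : Fin 3) ≠ 2 by decide)
      (show (1 : Fin 3) ≠ 2 by decide))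
    (by rw [sub_sub_sub_cancel_left]
        exact Ideal.mem_sup_left (Ideal.mem_span_singleton_self _))
  rw [← Ideal.span_singleton_neg, neg_sub] at h₁
  have h₂ := isSMulRegular_quotient_X_pow_sub_sup_X_of_ne (R := R) hn
    (show (1 : Fin 3) ≠ 0 by decide) (show (1 : Fin 3) ≠ 2 by decide) (by decide)
  have hxy := isSMulRegular_quotient_sup_span_mul (hX 0) h₀ h₁
  have hxyz := isSMulRegular_quotient_sup_span_mul ((hX 0).mul (hX 1)) hxy h₂
  refine isWeaklyRegular_triple_iff.mpr ⟨.of_ne_zero fun h => ?_,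
    (((hX 0).mul (hX 1)).mul (hX 2)).pow m,
    isSMulRegular_quotient_sup_span_pow (((hX 0).mul (hX 1)).mul (hX 2)) hxyz m⟩
  exact not_X_dvd_X_pow_sub_X_pow (show (0 : Fin 3) ≠ 1 by decide)
    (show (0 : Fin 3) ≠ 1 by decide) hn (h ▸ dvd_zero (X 0 : MvPolynomial (Fin 3) R))

end MvPolynomial

end RegularSequences

/-! ### Depth of the Rees algebra -/

section Depth

open RingTheory.Sequence

lemma le_depthOn {A : Type*} [CommRing A] {J : Ideal A} (hJ : J ≠ ⊤) {rs : List A}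
    (hrs : ∀ r ∈ rs, r ∈ J) (h : IsWeaklyRegular A rs) : (rs.length : ℕ∞) ≤ depthOn J := by
  refine le_iSup₂_of_le rs ⟨hrs, h, fun htop => hJ ?_⟩ le_rfl
  rw [smul_eq_mul, Ideal.mul_top, Ideal.ofList] at htop
  rw [eq_top_iff, htop, Ideal.span_le]
  exact hrs

lemma isWeaklyRegular_of_surjective {P B A : Type*} [CommRing P] [CommRing B] [Algebra P B]
    [CommRing A] {ψ : B →+* A} (hψ : Function.Surjective ψ) {K : Ideal B} (hK : K = RingHom.ker ψ)
    {cs : List P} (h : IsWeaklyRegular (B ⧸ K) cs) :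
    IsWeaklyRegular A (cs.map (ψ.comp (algebraMap P B))) := by
  subst hK
  let e := RingHom.quotientKerEquivOfSurjective hψ
  refine (e.toAddEquiv.isWeaklyRegular_congr (List.forall₂_map_right_iff.mpr
    (List.forall₂_same.mpr fun c _ m => ?_))).mp h
  rw [Algebra.smul_def]
  exact map_mul e _ _

variable {k : Type*} [Field k] {n : ℕ} {I : Ideal (MvPolynomial (Fin n) k)}

lemma mem_reesMaxIdeal_of_coeff_zero_mem {c : reesAlgebra I}
    (hc : (c : Polynomial (MvPolynomial (Fin n) k)).coeff 0 ∈ Ideal.span (Set.range X)) :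
    c ∈ reesMaxIdeal I := by
  rw [← sub_add_cancel c
    (algebraMap _ _ ((c : Polynomial (MvPolynomial (Fin n) k)).coeff 0))]
  refine Ideal.add_mem _ (Ideal.mem_sup_right ?_)
    (Ideal.mem_sup_left (Ideal.mem_map_of_mem _ hc))
  rw [reesIrrelevant, RingHom.mem_ker]
  simp

lemma reesMaxIdeal_ne_top (I : Ideal (MvPolynomial (Fin n) k)) : reesMaxIdeal I ≠ ⊤ := by
  let π : reesAlgebra I →+* k := (constantCoeff (R := k)).comp
    ((Polynomial.constantCoeff (R := MvPolynomial (Fin n) k)).comp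
      (reesAlgebra I).val.toRingHom)
  have hle : reesMaxIdeal I ≤ RingHom.ker π := by
    refine sup_le ?_ fun c hc => ?_
    · rw [Ideal.map_span, Ideal.span_le]
      rintro _ ⟨_, ⟨i, rfl⟩, rfl⟩
      simp [π]
    · rw [RingHom.mem_ker, RingHom.comp_apply, (RingHom.mem_ker).mp hc, map_zero]
  exact fun h => RingHom.ker_ne_top π (top_le_iff.mp (h ▸ hle))

end Depth

/-! ### Change of variables -/

section ChangeOfVariables

variable {R ι : Type*} [CommRing R] {f : ι → R} {j : Fin 3 → R} {h : R}
  {e : MvPolynomial ι R ≃ₐ[R] Polynomial (MvPolynomial (Fin 3) R)}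

lemma extReesMap_algEquiv (he : ∀ i, extReesMap j h (e (X i)) = Polynomial.monomial 1 (f i))
    (F : MvPolynomial ι R) : extReesMap j h (e F) = reesPresentation f F := by
  have hcomp : (extReesMap j h).comp e.toAlgHom = aeval fun i => Polynomial.monomial 1 (f i) := by
    ext i : 1
    simpa using he i
  rw [coe_reesPresentation, ← hcomp]
  rfl

lemma ker_extReesMap (he : ∀ i, extReesMap j h (e (X i)) = Polynomial.monomial 1 (f i)) :
    RingHom.ker (extReesMap j h) = (reesIdeal f).map e.toRingEquiv := by
  rw [← Ideal.comap_symm]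
  ext F
  obtain ⟨F, rfl⟩ := e.surjective F
  rw [RingHom.mem_ker, extReesMap_algEquiv he, ZeroMemClass.coe_eq_zero, Ideal.mem_comap]
  simp [reesIdeal]

lemma ker_extReesMap_le (he : ∀ i, extReesMap j h (e (X i)) = Polynomial.monomial 1 (f i))
    {I : Ideal R} {F : MvPolynomial ι R} (hI : reesIdeal f ≤ I.map C ⊔ Ideal.span {F}) :
    RingHom.ker (extReesMap j h) ≤ (I.map C).map Polynomial.C ⊔ Ideal.span {e F} := by
  have hC : (e.toRingEquiv : MvPolynomial ι R →+* Polynomial (MvPolynomial (Fin 3) R)).comp C =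
      Polynomial.C.comp C := RingHom.ext e.commutes
  rw [ker_extReesMap he]
  refine (Ideal.map_mono hI).trans_eq ?_
  rw [Ideal.map_sup, Ideal.map_span, Set.image_singleton, Ideal.map_map C Polynomial.C, ← hC,
    ← Ideal.map_map]
  rfl

/-- The surjection `R[X 0, X 1, X 2][X] → R[IT]` induced by the presentation of the Rees algebra
and the change of variables `e`. -/
noncomputable def reesProj (f : ι → R)
    (e : MvPolynomial ι R ≃ₐ[R] Polynomial (MvPolynomial (Fin 3) R)) :
    Polynomial (MvPolynomial (Fin 3) R) →ₐ[R] reesAlgebra (Ideal.span (Set.range f)) :=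
  (reesPresentation f).comp e.symm.toAlgHom

lemma reesProj_surjective : Function.Surjective (reesProj f e) :=
  (reesPresentation_surjective f).comp e.symm.surjective

lemma coe_reesProj (he : ∀ i, extReesMap j h (e (X i)) = Polynomial.monomial 1 (f i))
    (G : Polynomial (MvPolynomial (Fin 3) R)) : (reesProj f e G : Polynomial R) =
      extReesMap j h G := by
  obtain ⟨F, rfl⟩ := e.surjective G
  rw [extReesMap_algEquiv he]
  simp [reesProj]

lemma ker_reesProj (he : ∀ i, extReesMap j h (e (X i)) = Polynomial.monomial 1 (f i)) :
    RingHom.ker (reesProj f e) = RingHom.ker (extReesMap j h) := by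
  ext G
  rw [RingHom.mem_ker, RingHom.mem_ker, ← coe_reesProj he, ZeroMemClass.coe_eq_zero]

lemma coeff_zero_reesProj_C (he : ∀ i, extReesMap j h (e (X i)) = Polynomial.monomial 1 (f i))
    (p : MvPolynomial (Fin 3) R) :
    (reesProj f e (Polynomial.C p) : Polynomial R).coeff 0 = constantCoeff p := by
  rw [coe_reesProj he, extReesMap_C, coeff_zero_reesMap]

end ChangeOfVariables

section ReesAlgebra

open RingTheory.Sequence

lemma projDimLE_quotient_reesIdeal {R : Type*} {ι : Type} [CommRing R] [IsDomain R]
    [UniqueFactorizationMonoid R] {f : ι → R} {j : Fin 3 → R} {h : R}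
    {e : MvPolynomial ι R ≃ₐ[R] Polynomial (MvPolynomial (Fin 3) R)}
    (hR : ∀ K : Ideal R, ProjDimLE R (R ⧸ K) 3)
    (he : ∀ i, extReesMap j h (e (X i)) = Polynomial.monomial 1 (f i))
    (hj : IsWeaklyRegular R [j 0, j 1, j 2]) (hj₂ : j 2 ≠ 0) {K₁ K₂ : Ideal R}
    (hfil : CyclicFiltration (extReesGen j h) ![relIdeal j, K₁.map C, K₂.map C]) :
    ProjDimLE (MvPolynomial ι R) (MvPolynomial ι R ⧸ reesIdeal f) 4 := by
  refine (projDimLE_quotient_ker_extReesMap hR hj hj₂ hfil).quotient_of_ringEquiv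
    e.toRingEquiv.symm ?_
  rw [ker_extReesMap he]
  exact (Ideal.map_of_equiv e.toRingEquiv).symm

lemma isAlmostCohenMacaulayRees_of_cyclicFiltration {k ι : Type*} [Field k] {f : ι → R k}
    {j : Fin 3 → R k} {h : R k}
    {e : MvPolynomial ι (R k) ≃ₐ[R k] Polynomial (MvPolynomial (Fin 3) (R k))}
    (he : ∀ i, extReesMap j h (e (X i)) = Polynomial.monomial 1 (f i))
    (hj : IsWeaklyRegular (R k) [j 0, j 1, j 2]) (hj₀ : j 0 ∈ Ideal.span (Set.range X))
    (hj₁ : j 1 ∈ Ideal.span (Set.range X)) {K₁ K₂ : Ideal (R k)}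
    (hfil : CyclicFiltration (extReesGen j h) ![relIdeal j, K₁.map C, K₂.map C]) :
    IsAlmostCohenMacaulayRees (Ideal.span (Set.range f)) := by
  refine le_depthOn (reesMaxIdeal_ne_top _) ?_ (isWeaklyRegular_of_surjective
    (ψ := (reesProj f e).toRingHom) reesProj_surjective
    (ker_reesProj he).symm (isWeaklyRegular_quotient_ker_extReesMap hj hfil))
  simp only [List.map_cons, List.map_nil, List.forall_mem_cons, List.not_mem_nil]
  refine ⟨?_, ?_, ?_, by simp⟩ <;> refine mem_reesMaxIdeal_of_coeff_zero_mem ?_ <;>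
    refine (coeff_zero_reesProj_C he _).symm ▸ ?_
  · simp
  · simpa using hj₀
  · simpa using hj₁

end ReesAlgebra

/-! ### The two cases -/

section QuadraticCoefficients

variable {k : Type*} [Field k] {b d m n l : ℕ}

/-- The powers `X i ^ m` and `(X i * X j) ^ n` of the variables and of their pairwise products.
With the exponents used below, they generate the ideal of leading coefficients of the elements of
the Rees ideal that are quadratic in the variable adjoined last. -/
def quadraticCoeffs (k : Type*) [Field k] (m n : ℕ) : Set (R k) :=
  {x k ^ m, y k ^ m, z k ^ m, (x k * y k) ^ n, (x k * z k) ^ n, (y k * z k) ^ n}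

lemma C_mul_mem_map_C {A ι : Type*} [CommRing A] {s : Set A} {r r' : A} (hr : r ∈ s)
    (h : r ∣ r') (F : MvPolynomial ι A) : C r' * F ∈ (Ideal.span s).map (C (σ := ι)) :=
  Ideal.mul_mem_right _ _ (Ideal.mem_map_of_mem _ (Ideal.mem_of_dvd _ h (Ideal.subset_span hr)))

lemma C_X_pow_mul_mem_map_C (i : Fin 3) (hl : m ≤ l) (F : S k) :
    C (X i ^ l : R k) * F ∈ (Ideal.span (quadraticCoeffs k m n)).map C := by
  refine C_mul_mem_map_C (r := X i ^ m) ?_ (pow_dvd_pow _ hl) F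
  fin_cases i <;> simp [quadraticCoeffs]

lemma C_X_mul_X_pow_mul_mem_map_C {i j : Fin 3} (hij : i < j) (hl : n ≤ l) (F : S k) :
    C ((X i * X j) ^ l : R k) * F ∈ (Ideal.span (quadraticCoeffs k m n)).map C := by
  refine C_mul_mem_map_C (r := (X i * X j) ^ n) ?_ (pow_dvd_pow _ hl) F
  fin_cases i <;> fin_cases j <;> first | exact absurd hij (by decide) | simp [quadraticCoeffs]

lemma L_subset_map_C (hm : m ≤ b + d) (hn : n ≤ b) :
    L k (2 * b + d) b ⊆ ((Ideal.span (quadraticCoeffs k m n)).map C : Ideal (S k)) := by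
  have hb : 2 * b + d - b = b + d := by omega
  have hma : m ≤ 2 * b + d := by omega
  rintro _ (rfl | rfl | rfl | rfl | rfl | rfl)
  · exact sub_mem (C_X_pow_mul_mem_map_C 0 hma _) (C_X_pow_mul_mem_map_C 1 hma _)
  · exact sub_mem (C_X_pow_mul_mem_map_C 0 hma _) (C_X_pow_mul_mem_map_C 2 hma _)
  · exact sub_mem (C_X_pow_mul_mem_map_C 1 hma _) (C_X_pow_mul_mem_map_C 2 hma _)
  all_goals rw [SetLike.mem_coe]
  · rw [g₁, hb]
    exact sub_mem (C_X_pow_mul_mem_map_C 0 hm _) (C_X_mul_X_pow_mul_mem_map_C (by decide) hn _)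
  · rw [g₂, hb]
    exact sub_mem (C_X_pow_mul_mem_map_C 1 hm _) (C_X_mul_X_pow_mul_mem_map_C (by decide) hn _)
  · rw [g₃, hb]
    exact sub_mem (C_X_pow_mul_mem_map_C 2 hm _) (C_X_mul_X_pow_mul_mem_map_C (by decide) hn _)

lemma H_subset_map_C (hm : m ≤ 2 * b) (hn : n ≤ d) :
    {H₁ k (2 * b + d) b, H₂ k (2 * b + d) b, H₃ k (2 * b + d) b} ⊆
      (((Ideal.span (quadraticCoeffs k m n)).map C : Ideal (S k)) : Set (S k)) := by
  have hd : 2 * b + d - 2 * b = d := by omega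
  rintro _ (rfl | rfl | rfl) <;> rw [SetLike.mem_coe]
  · rw [H₁, hd, mul_assoc]
    exact sub_mem (C_X_mul_X_pow_mul_mem_map_C (by decide) hn _) (C_X_pow_mul_mem_map_C 2 hm _)
  · rw [H₂, hd, mul_assoc]
    exact sub_mem (C_X_mul_X_pow_mul_mem_map_C (by decide) hn _) (C_X_pow_mul_mem_map_C 1 hm _)
  · rw [H₃, hd, mul_assoc]
    exact sub_mem (C_X_mul_X_pow_mul_mem_map_C (by decide) hn _) (C_X_pow_mul_mem_map_C 0 hm _)

lemma reesIdeal_le_map_C_sup {F : S k} (hm : m ≤ b + d) (hm' : m ≤ 2 * b) (hn : n ≤ b)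
    (hn' : n ≤ d) (hI : reesIdeal (gens k (2 * b + d) b) = Ideal.span (L k (2 * b + d) b ∪
      {H₁ k (2 * b + d) b, H₂ k (2 * b + d) b, H₃ k (2 * b + d) b, F})) :
    reesIdeal (gens k (2 * b + d) b) ≤
      (Ideal.span (quadraticCoeffs k m n)).map C ⊔ Ideal.span {F} := by
  rw [hI, Ideal.span_le]
  rintro G (hG | hH₁ | hH₂ | hH₃ | hF)
  · exact Ideal.mem_sup_left (L_subset_map_C hm hn hG)
  · exact Ideal.mem_sup_left (H_subset_map_C hm' hn' (.inl hH₁))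
  · exact Ideal.mem_sup_left (H_subset_map_C hm' hn' (.inr (.inl hH₂)))
  · exact Ideal.mem_sup_left (H_subset_map_C hm' hn' (.inr (.inr hH₃)))
  · exact Ideal.mem_sup_right (Ideal.subset_span hF)

lemma X_pow_mem_span_range_X (i : Fin 3) (hn : n ≠ 0) :
    (X i : R k) ^ n ∈ Ideal.span (Set.range (X : Fin 3 → R k)) :=
  Ideal.pow_mem_of_mem _ (Ideal.subset_span (Set.mem_range_self i)) _ (Nat.pos_of_ne_zero hn)

end QuadraticCoefficients

section ReesMap

variable {A : Type*} [CommRing A] (j : Fin 3 → A)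

lemma reesMap_X (i : Fin 3) : reesMap j (X i) = Polynomial.C (j i) * Polynomial.X := by
  simp [reesMap, Polynomial.C_mul_X_eq_monomial]

end ReesMap

section LastVariable

variable {k : Type*} [Field k] {b d e : ℕ}

/-- The generators `x^a, y^a, z^a`. -/
noncomputable def purePowers (k : Type*) [Field k] (a : ℕ) : Fin 3 → R k :=
  ![x k ^ a, y k ^ a, z k ^ a]

/-- The change of variables `t, u, v, w ↦ X 0, X 1, X 2, X`. -/
noncomputable def lastVarEquiv (k : Type*) [Field k] :
    S k ≃ₐ[R k] Polynomial (MvPolynomial (Fin 3) (R k)) :=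
  AlgEquiv.ofAlgHom
    (aeval ![Polynomial.C (X 0), Polynomial.C (X 1), Polynomial.C (X 2), Polynomial.X])
    (Polynomial.eval₂AlgHom (aeval ![t k, u k, v k]) (w k) fun _ => Commute.all _ _)
    (Polynomial.algHom_ext' (by ext i : 1; fin_cases i <;> simp) (by simp))
    (by ext i : 1; fin_cases i <;> simp)

lemma lastVarEquiv_X (i : Fin 4) : lastVarEquiv k (X i) =
    ![Polynomial.C (X 0), Polynomial.C (X 1), Polynomial.C (X 2), Polynomial.X] i :=
  aeval_X _ i

lemma lastVarEquiv_C (r : R k) : lastVarEquiv k (C r) = Polynomial.C (C r) :=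
  (lastVarEquiv k).commutes r

lemma extReesMap_lastVarEquiv (a b : ℕ) (i : Fin 4) :
    extReesMap (purePowers k a) ((x k * y k * z k) ^ b) (lastVarEquiv k (X i)) =
      Polynomial.monomial 1 (gens k a b i) := by
  rw [lastVarEquiv_X]
  fin_cases i <;> simp [extReesMap_C, extReesMap_X, reesMap, purePowers, gens]

lemma lastVarEquiv_E (h : b = d + e) : lastVarEquiv k (E k (2 * b + d) b) =
    Polynomial.X ^ 3 - Polynomial.C (C ((x k * y k * z k) ^ e) * X 0 * X 1 * X 2) := by
  have h3b : 3 * b - (2 * b + d) = e := by omega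
  simp only [E, h3b, map_sub, map_mul _ (_ : S k), map_pow _ (_ : S k), lastVarEquiv_C,
    lastVarEquiv_X, Matrix.cons_val, Polynomial.C_mul]

lemma C_mul_monomial_sq_purePowers {r : R k} (hr : r ∈ quadraticCoeffs k (b + d) d) :
    ∃ p₀ p₁, Polynomial.C r * Polynomial.monomial 1 ((x k * y k * z k) ^ b) ^ 2 =
      reesMap (purePowers k (2 * b + d)) p₀ + reesMap (purePowers k (2 * b + d)) p₁ *
        Polynomial.monomial 1 ((x k * y k * z k) ^ b) := by
  suffices h : ∃ p₀ p₁, _ = _ by simpa only [← Polynomial.C_mul_X_eq_monomial] using h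
  rcases hr with rfl | rfl | rfl | rfl | rfl | rfl
  · exact ⟨0, C ((y k * z k) ^ b) * X 0, by simp [purePowers, reesMap_X]; ring⟩
  · exact ⟨0, C ((x k * z k) ^ b) * X 1, by simp [purePowers, reesMap_X]; ring⟩
  · exact ⟨0, C ((x k * y k) ^ b) * X 2, by simp [purePowers, reesMap_X]; ring⟩
  · exact ⟨C (z k ^ (2 * b)) * X 0 * X 1, 0, by simp [purePowers, reesMap_X]; ring⟩
  · exact ⟨C (y k ^ (2 * b)) * X 0 * X 2, 0, by simp [purePowers, reesMap_X]; ring⟩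
  · exact ⟨C (x k ^ (2 * b)) * X 1 * X 2, 0, by simp [purePowers, reesMap_X]; ring⟩

end LastVariable

section Shear

variable {k : Type*} [Field k] {b d e : ℕ}

/-- Together with `x^a`, these generate the ideal `(x^a, y^a, z^a, (xyz)^b)`. -/
noncomputable def shearedGens (k : Type*) [Field k] (a b : ℕ) : Fin 3 → R k :=
  ![y k ^ a - x k ^ a, (x k * y k * z k) ^ b, z k ^ a - x k ^ a]

/-- The change of variables `t, u, v, w ↦ X, X + X 0, X + X 2, X 1`, after which the last form of
the Rees ideal is monic in `X` also when `a > 3b`. -/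
noncomputable def shearEquiv (k : Type*) [Field k] :
    S k ≃ₐ[R k] Polynomial (MvPolynomial (Fin 3) (R k)) :=
  AlgEquiv.ofAlgHom
    (aeval ![Polynomial.X, Polynomial.X + Polynomial.C (X 0), Polynomial.X + Polynomial.C (X 2),
      Polynomial.C (X 1)])
    (Polynomial.eval₂AlgHom (aeval ![u k - t k, w k, v k - t k]) (t k) fun _ => Commute.all _ _)
    (Polynomial.algHom_ext' (by ext i : 1; fin_cases i <;> simp <;> ring) (by simp))
    (by ext i : 1; fin_cases i <;> simp)

lemma shearEquiv_X (i : Fin 4) : shearEquiv k (X i) =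
    ![Polynomial.X, Polynomial.X + Polynomial.C (X 0), Polynomial.X + Polynomial.C (X 2),
      Polynomial.C (X 1)] i :=
  aeval_X _ i

lemma shearEquiv_C (r : R k) : shearEquiv k (C r) = Polynomial.C (C r) :=
  (shearEquiv k).commutes r

lemma extReesMap_shearEquiv (a b : ℕ) (i : Fin 4) :
    extReesMap (shearedGens k a b) (x k ^ a) (shearEquiv k (X i)) =
      Polynomial.monomial 1 (gens k a b i) := by
  rw [shearEquiv_X]
  fin_cases i <;> simp [extReesMap_C, extReesMap_X, reesMap, shearedGens, gens]

lemma shearEquiv_neg_E' (h : d = b + e) : shearEquiv k (-E' k (2 * b + d) b) =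
    Polynomial.C 1 * Polynomial.X ^ 3 + Polynomial.C (X 0 + X 2) * Polynomial.X ^ 2 +
      Polynomial.C (X 0 * X 2) * Polynomial.X +
      Polynomial.C (-(C ((x k * y k * z k) ^ e) * X 1 ^ 3)) := by
  have h3b : 2 * b + d - 3 * b = e := by omega
  simp only [E', h3b, map_neg, map_sub, map_mul _ (_ : S k), map_pow _ (_ : S k), shearEquiv_C,
    shearEquiv_X, Matrix.cons_val, Polynomial.C_mul, Polynomial.C_add,
    Polynomial.C_pow, Polynomial.C_1]
  ring

lemma C_mul_monomial_sq_shearedGens {r : R k} (hr : r ∈ quadraticCoeffs k (2 * b) b) :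
    ∃ p₀ p₁, Polynomial.C r * Polynomial.monomial 1 (x k ^ (2 * b + d)) ^ 2 =
      reesMap (shearedGens k (2 * b + d) b) p₀ +
        reesMap (shearedGens k (2 * b + d) b) p₁ * Polynomial.monomial 1 (x k ^ (2 * b + d)) := by
  suffices h : ∃ p₀ p₁, _ = _ by simpa only [← Polynomial.C_mul_X_eq_monomial] using h
  rcases hr with rfl | rfl | rfl | rfl | rfl | rfl
  · exact ⟨C ((y k * z k) ^ d) * X 1 ^ 2 - C (x k ^ (2 * b)) * X 0 * X 2,
      -(C (x k ^ (2 * b)) * (X 0 + X 2)), by simp [shearedGens, reesMap_X]; ring⟩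
  · exact ⟨C ((x k * z k) ^ d) * X 1 ^ 2, -(C (y k ^ (2 * b)) * X 2),
      by simp [shearedGens, reesMap_X]; ring⟩
  · exact ⟨C ((x k * y k) ^ d) * X 1 ^ 2, -(C (z k ^ (2 * b)) * X 0),
      by simp [shearedGens, reesMap_X]; ring⟩
  · exact ⟨0, C (z k ^ (b + d)) * X 1 - C ((x k * y k) ^ b) * X 2,
      by simp [shearedGens, reesMap_X]; ring⟩
  · exact ⟨0, C (y k ^ (b + d)) * X 1 - C ((x k * z k) ^ b) * X 0,
      by simp [shearedGens, reesMap_X]; ring⟩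
  · exact ⟨0, C (x k ^ (b + d)) * X 1, by simp [shearedGens, reesMap_X]; ring⟩

end Shear

section Conclusion

variable {k : Type*} [Field k] {a b d e : ℕ}

lemma cyclicFiltration_purePowers (h : b = d + e) :
    CyclicFiltration (extReesGen (purePowers k (2 * b + d)) ((x k * y k * z k) ^ b))
      ![relIdeal (purePowers k (2 * b + d)),
        ((Ideal.span (Set.range (purePowers k (2 * b + d)))).colon
          {(x k * y k * z k) ^ b}).map C,
        (Ideal.span (quadraticCoeffs k (b + d) d)).map C] := by
  refine cyclicFiltration_extReesGen (F := lastVarEquiv k (E k (2 * b + d) b))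
    (isWeaklyRegular_X_pow _) ?_ ?_ ?_ (fun _ => C_mul_monomial_sq_purePowers)
    (ker_extReesMap_le (extReesMap_lastVarEquiv _ _)
      (reesIdeal_le_map_C_sup le_rfl (by omega) (by omega) le_rfl (reesIdeal_eq_of_le h)))
  · rw [lastVarEquiv_E h]
    exact Polynomial.monic_X_pow_sub_C _ (by norm_num)
  · rw [lastVarEquiv_E h]
    exact Polynomial.natDegree_X_pow_sub_C
  · rw [extReesMap_algEquiv (extReesMap_lastVarEquiv _ _), ZeroMemClass.coe_eq_zero]
    exact E_mem_reesIdeal h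

lemma cyclicFiltration_shearedGens (hb : b ≠ 0) (h : d = b + e) :
    CyclicFiltration (extReesGen (shearedGens k (2 * b + d) b) (x k ^ (2 * b + d)))
      ![relIdeal (shearedGens k (2 * b + d) b),
        ((Ideal.span (Set.range (shearedGens k (2 * b + d) b))).colon
          {x k ^ (2 * b + d)}).map C,
        (Ideal.span (quadraticCoeffs k (2 * b) b)).map C] := by
  refine cyclicFiltration_extReesGen (F := shearEquiv k (-E' k (2 * b + d) b))
    (isWeaklyRegular_X_pow_sub_X_pow (by omega) _) ?_ ?_ ?_
    (fun _ => C_mul_monomial_sq_shearedGens) (ker_extReesMap_le (extReesMap_shearEquiv _ _) ?_)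
  · rw [shearEquiv_neg_E' h]
    exact Polynomial.leadingCoeff_cubic one_ne_zero
  · rw [shearEquiv_neg_E' h]
    exact Polynomial.natDegree_cubic one_ne_zero
  · rw [extReesMap_algEquiv (extReesMap_shearEquiv _ _), ZeroMemClass.coe_eq_zero]
    exact neg_mem (E'_mem_reesIdeal h)
  · rw [Ideal.span_singleton_neg]
    exact reesIdeal_le_map_C_sup (by omega) le_rfl le_rfl (by omega) (reesIdeal_eq_of_ge h)

lemma shearedGens_two_ne_zero (ha : a ≠ 0) : shearedGens k a b 2 ≠ 0 := fun h =>
  not_X_dvd_X_pow_sub_X_pow (R := k) (i := (0 : Fin 3)) (j := 0) (l := 2) (by decide)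
    (by decide) ha ((show z k ^ a - x k ^ a = 0 from h) ▸ dvd_zero _)

theorem projDimLE_and_isAlmostCohenMacaulayRees_of_le (hb : b ≠ 0) (h : b = d + e) :
    ProjDimLE (S k) (S k ⧸ reesIdeal (gens k (2 * b + d) b)) 4 ∧
      IsAlmostCohenMacaulayRees (Ideal.span (Set.range (gens k (2 * b + d) b))) := by
  have ha : 2 * b + d ≠ 0 := by omega
  have he := extReesMap_lastVarEquiv (k := k) (2 * b + d) b
  have hfil := cyclicFiltration_purePowers (k := k) h
  exact ⟨projDimLE_quotient_reesIdeal (fun _ => projDimLE_mvPolynomial k 3 _) he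
      (isWeaklyRegular_X_pow _) (pow_ne_zero _ (X_ne_zero _)) hfil,
    isAlmostCohenMacaulayRees_of_cyclicFiltration he (isWeaklyRegular_X_pow _)
      (X_pow_mem_span_range_X 0 ha) (X_pow_mem_span_range_X 1 ha) hfil⟩

theorem projDimLE_and_isAlmostCohenMacaulayRees_of_ge (hb : b ≠ 0) (h : d = b + e) :
    ProjDimLE (S k) (S k ⧸ reesIdeal (gens k (2 * b + d) b)) 4 ∧
      IsAlmostCohenMacaulayRees (Ideal.span (Set.range (gens k (2 * b + d) b))) := by
  have ha : 2 * b + d ≠ 0 := by omega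
  have he := extReesMap_shearEquiv (k := k) (2 * b + d) b
  have hfil := cyclicFiltration_shearedGens (k := k) hb h
  have hxyz : (x k * y k * z k) ^ b ∈ Ideal.span (Set.range X) :=
    Ideal.pow_mem_of_mem _ (Ideal.mul_mem_left _ _ (Ideal.subset_span (Set.mem_range_self 2))) _
      (Nat.pos_of_ne_zero hb)
  exact ⟨projDimLE_quotient_reesIdeal (fun _ => projDimLE_mvPolynomial k 3 _) he
      (isWeaklyRegular_X_pow_sub_X_pow ha b) (shearedGens_two_ne_zero ha) hfil,
    isAlmostCohenMacaulayRees_of_cyclicFiltration he (isWeaklyRegular_X_pow_sub_X_pow ha b)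
      (sub_mem (X_pow_mem_span_range_X 1 ha) (X_pow_mem_span_range_X 0 ha)) hxyz hfil⟩

end Conclusion

end ReesSylvester

open ReesSylvester in
theorem theorem2p13 {k : Type*} [Field k] (a b : ℕ) (hb : 0 < b) (hab : 2 * b < a) :
    -- `L` is the set of forms of a generating set of the syzygy module
    (Submodule.span (R k) (syzygyColumns k a b) = syzygyModule (gens k a b) ∧
      linearForm '' syzygyColumns k a b = L k a b) ∧
    -- `H₁, H₂, H₃` are Sylvester forms of elements of `L`
    (IsSylvesterForm (genDegrees a b) (x k ^ b) (y k ^ b) (g₁ k a b) (g₂ k a b) (H₁ k a b) ∧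
      IsSylvesterForm (genDegrees a b) (x k ^ b) (z k ^ b) (g₁ k a b) (g₃ k a b) (H₂ k a b) ∧
      IsSylvesterForm (genDegrees a b) (y k ^ b) (z k ^ b) (g₂ k a b) (g₃ k a b) (H₃ k a b)) ∧
    -- the last generator is a Sylvester form of `g₁` and `H₃`, and the Rees ideal is generated by
    -- these ten forms
    (a ≤ 3 * b →
      IsSylvesterForm (genDegrees a b) (x k ^ (a - b)) ((y k * z k) ^ (a - 2 * b))
        (g₁ k a b) (H₃ k a b) (E k a b) ∧
      reesIdeal (gens k a b) =
        Ideal.span (L k a b ∪ {H₁ k a b, H₂ k a b, H₃ k a b, E k a b})) ∧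
    (3 * b < a →
      IsSylvesterForm (genDegrees a b) (x k ^ (2 * b)) ((y k * z k) ^ b)
        (g₁ k a b) (H₃ k a b) (E' k a b) ∧
      reesIdeal (gens k a b) =
        Ideal.span (L k a b ∪ {H₁ k a b, H₂ k a b, H₃ k a b, E' k a b})) ∧
    -- the Rees algebra is almost Cohen–Macaulay, and as an `S`-module, via the surjection
    -- `S → R[IT]`, it has projective dimension at most `4`
    IsAlmostCohenMacaulayRees (Ideal.span (Set.range (gens k a b))) ∧
    Function.Surjective (reesPresentation (gens k a b)) ∧
    CategoryTheory.HasProjectiveDimensionLE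
      (ModuleCat.of (S k) (S k ⧸ reesIdeal (gens k a b))) 4 := by
  obtain ⟨d, rfl⟩ := Nat.exists_eq_add_of_le hab.le
  refine ⟨⟨?_, linearForm_image_syzygyColumns _ _⟩,
    ⟨isSylvesterForm_H₁, isSylvesterForm_H₂, isSylvesterForm_H₃⟩, fun h => ?_, fun h => ?_, ?_⟩
  · obtain h | h := le_total d b <;> obtain ⟨e, he⟩ := Nat.exists_eq_add_of_le h
    · exact span_syzygyColumns (linearPart_E _ _) (reesIdeal_eq_of_le he)
    · exact span_syzygyColumns (linearPart_E' _ _) (reesIdeal_eq_of_ge he)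
  · obtain ⟨e, he⟩ := Nat.exists_eq_add_of_le (show d ≤ b by omega)
    exact ⟨isSylvesterForm_E he, reesIdeal_eq_of_le he⟩
  · obtain ⟨e, he⟩ := Nat.exists_eq_add_of_le (show b ≤ d by omega)
    exact ⟨isSylvesterForm_E' he, reesIdeal_eq_of_ge he⟩
  · suffices h : _ ∧ _ from ⟨h.2, reesPresentation_surjective _, h.1⟩
    obtain h | h := le_total d b <;> obtain ⟨e, he⟩ := Nat.exists_eq_add_of_le h
    · exact projDimLE_and_isAlmostCohenMacaulayRees_of_le hb.ne' he
    · exact projDimLE_and_isAlmostCohenMacaulayRees_of_ge hb.ne' he
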